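/- Let $k$ be a field, $S=k[x_1,\dots,x_n]$ with its $\mathbb Z^n$-grading, $[n]=\{1,\dots,n\}$, and let ${}^*\mathbf{Mod}$ be the category of $\mathbb Z^n$-graded $S$-modules and degree-preserving $S$-linear maps; $M(\mathbf a)_{\mathbf b}=M_{\mathbf a+\mathbf b}$. For $\mathbf a\in\mathbb Z^n$ put $\operatorname{supp}_+(\mathbf a)=\{i: a_i>0\}$, and identify $F\subset[n]$ with the $0/1$-vector with support $F$; $F^{c}=[n]\setminus F$. Put $P_F=(x_i\mid i\notin F)$ and $\omega_S=S(-1,\dots,-1)$. A $\mathbb Z^n$-graded module $M$ is *squarefree* if $M_{\mathbf a}=0$ for $\mathbf a\notin\mathbb N^n$, $\dim_k M_{\mathbf a}<\infty$ for all $\mathbf a$, and multiplication by $x^{\mathbf b}$ is a bijection $M_{\mathbf a}\to M_{\mathbf a+\mathbf b}$ whenever $\mathbf a,\mathbf b\in\mathbb N^n$ and $\operatorname{supp}_+(\mathbf a+\mathbf b)=\operatorname{supp}_+(\mathbf a)$. Let $\mathbf{Sq}\subset{}^*\mathbf{Mod}$ be the full subcategory of squarefree modules and $\mathrm{Com}^b(\mathbf{Sq})$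 the category of bounded cochain complexes in $\mathbf{Sq}$. * A minimal injective resolution of $M^\bullet\in\mathrm{Com}^b(\mathbf{Sq})$ is a quasi-isomorphism $M^\bullet\to I^\bullet$ with $I^\bullet\in\mathrm{Com}^b(\mathbf{Sq})$, each $I^i$ injective in $\mathbf{Sq}$, such that every nonzero $\mathbb Z^n$-graded submodule of $I^i$ meets $\ker(I^i\to I^{i+1})$ nontrivially. The numbers $\bar\mu^i(F,M^\bullet)\in\mathbb N$ ($i\in\mathbb Z$, $F\subset[n]$) are defined by $I^i\cong\bigoplus_{F\subset[n]}(S/P_F)^{\bar\mu^i(F,M^\bullet)}$. * A minimal projective resolution of $M^\bullet$ is a quasi-isomorphism $P^\bullet\to M^\bullet$ with $P^\bullet\in\mathrm{Com}^b(\mathbf{Sq})$, each $P^i$ projective in $\mathbf{Sq}$, and $d(P^{i-1})\subset(x_1,\dots,x_n)P^i$ for all $i$. The numbers $\beta_i(F,M^\bullet)\in\mathbb N$ are defined by $P^{-i}\cong\bigoplus_{F\subset[n]}S(-F)^{\beta_i(F,M^\bullet)}$. * $\mathcal Z(M^\bullet)$ is the complex with $\mathcal Z(M^j)_{\mathbf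 a}=M^j_{\operatorname{supp}_+(\mathbf a)}$ for $\mathbf a\in\mathbb Z^n$, the multiplication $\mathcal Z(M^j)_{\mathbf a}\to\mathcal Z(M^j)_{\mathbf a+\mathbf b}$ by $x^{\mathbf b}$ being the multiplication of $M^j$ from degree $\operatorname{supp}_+(\mathbf a)$ to degree $\operatorname{supp}_+(\mathbf a+\mathbf b)$. For a prime $P$ of $S$ and a complex $X^\bullet$ of $S$-modules, $\mu^i(P,X^\bullet)=\dim_{\kappa(P)}\operatorname{Ext}^i_{S_P}(\kappa(P),X^\bullet_P)$ is the usual Bass number. * $[\operatorname{Ext}^i_S(M^\bullet,\omega_S)]_{\mathbf a}=\operatorname{Ext}^i_{{}^*\mathbf{Mod}}(M^\bullet,\omega_S(\mathbf a))$, the morphisms $M^\bullet\to\omega_S(\mathbf a)[i]$ in the derived category of ${}^*\mathbf{Mod}$. * $\mathbf A$ is the Alexander duality functor, the exact contravariant functor from $\mathbf{Sq}$ to itself such that $\mathbf A(M)_F$ is the $k$-dual of $M_{F^{c}}$ and multiplication by $x_i$, $i\notin F$, from $\mathbf A(M)_F$ to $\mathbf A(M)_{F\cup\{i\}}$ is the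 $k$-dual of multiplication by $x_i$ from $M_{F^{c}\setminus\{i\}}$ to $M_{F^{c}}$; on complexes, $\mathbf A(M^\bullet)^j=\mathbf A(M^{-j})$. **Proposition.** Let $M^\bullet\in\mathrm{Com}^b(\mathbf{Sq})$. The numbers $\bar\mu^i(F,M^\bullet)$ and $\beta_i(F,M^\bullet)$ exist and do not depend on the choice of the minimal resolutions, and for all $i\in\mathbb Z$ and $F\subset[n]$ $$\bar\mu^i(F,M^\bullet)=\mu^i(P_F,\mathcal Z(M^\bullet))=\dim_k[\operatorname{Ext}_S^{\,n-|F|-i}(M^\bullet,\omega_S)]_F,$$ $$\beta_i(F,M^\bullet)=\dim_k[\operatorname{Ext}_S^{\,|F|-i}(\mathbf A(M^\bullet),\omega_S)]_{F^{c}}.$$ -/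

import Mathlib

open CategoryTheory CategoryTheory.Limits

universe u

noncomputable section

namespace SqfreeMod

/-! ## Multidegrees -/

/-- The group `ℤⁿ` of multidegrees, with the componentwise order. -/
def Deg (n : ℕ) : Type := Fin n → ℤ

instance (n : ℕ) : AddCommGroup (Deg n) := inferInstanceAs (AddCommGroup (Fin n → ℤ))

instance (n : ℕ) : PartialOrder (Deg n) := inferInstanceAs (PartialOrder (Fin n → ℤ))

instance (n : ℕ) : DecidableEq (Deg n) := inferInstanceAs (DecidableEq (Fin n → ℤ))

instance (n : ℕ) : IsOrderedAddMonoid (Deg n) :=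
  inferInstanceAs (IsOrderedAddMonoid (Fin n → ℤ))

variable {n : ℕ}

/-- `supp₊(a) = {i | a i > 0}`. -/
def posSupp (a : Deg n) : Finset (Fin n) :=
  {i : Fin n | (0 : ℤ) < (show ℤ from a i)}

/-- A subset `F ⊆ [n]` regarded as a squarefree multidegree. -/
def ind (F : Finset (Fin n)) : Deg n := fun i => if i ∈ F then 1 else 0

/-- The degree `(1, …, 1)`. -/
def ones (n : ℕ) : Deg n := fun _ => 1

/-- The `j`-th unit vector. -/
def unitDeg (j : Fin n) : Deg n := fun i => if i = j then 1 else 0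

/-- An exponent vector `b ∈ ℕⁿ` regarded as a degree. -/
def expDeg (b : Fin n →₀ ℕ) : Deg n := fun i => (b i : ℤ)

lemma mem_posSupp {a : Deg n} {i : Fin n} : i ∈ posSupp a ↔ (0 : ℤ) < a i := by
  simp [posSupp]

lemma posSupp_mono {a b : Deg n} (h : a ≤ b) : posSupp a ⊆ posSupp b := by
  intro i hi
  rw [mem_posSupp] at hi ⊢
  exact lt_of_lt_of_le hi (h i)

lemma ind_mono {F G : Finset (Fin n)} (h : F ⊆ G) : ind F ≤ ind G := by
  intro i
  by_cases hF : i ∈ F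
  · simp [ind, hF, h hF]
  · by_cases hG : i ∈ G <;> simp [ind, hF, hG]

lemma ind_nonneg (F : Finset (Fin n)) : 0 ≤ ind F := by
  intro i
  change (0 : ℤ) ≤ if i ∈ F then 1 else 0
  split_ifs <;> norm_num

lemma le_add_expDeg (a : Deg n) (b : Fin n →₀ ℕ) : a ≤ a + expDeg b := by
  intro i
  change a i ≤ a i + (b i : ℤ)
  simp

lemma sub_unitDeg_le (a : Deg n) (j : Fin n) : a - unitDeg j ≤ a := by
  intro i
  change a i - (if i = j then 1 else 0) ≤ a i
  split_ifs <;> simp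

lemma compl_posSupp_le {a b : Deg n} (h : a ≤ b) :
    ind (posSupp b)ᶜ ≤ ind (posSupp a)ᶜ :=
  ind_mono (Finset.compl_subset_compl.mpr (posSupp_mono h))

/-! ## Graded modules over the polynomial ring -/

/-- The category `*Mod` of `ℤⁿ`-graded modules over `S = k[x₁, …, xₙ]` (with `deg xᵢ = eᵢ`) and
degree-preserving `S`-linear maps. Such a module `M` is given by its components: the `k`-vector
spaces `M_a = M.obj a` for `a ∈ ℤⁿ` and, for `a ≤ b`, the map `M_a → M_b` of multiplication
by the monomial `x^(b - a)`, subject to `x^(c - b) x^(b - a) = x^(c - a)`. The associated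
`S`-module `⨁ a, M_a` is `total.obj M` below. -/
abbrev GrMod (k : Type u) [Field k] (n : ℕ) := Deg n ⥤ ModuleCat.{u} k

variable {k : Type u} [Field k]

/-- Multiplication by `x^(b - a)` from degree `a` to degree `b`. -/
def mulMap (M : GrMod k n) {a b : Deg n} (h : a ≤ b) : M.obj a →ₗ[k] M.obj b :=
  (M.map (homOfLE h)).hom

lemma mulMap_refl (M : GrMod k n) (a : Deg n) (h : a ≤ a) : mulMap M h = LinearMap.id := by
  simp [mulMap]

lemma mulMap_mulMap (M : GrMod k n) {a b c : Deg n} (h : a ≤ b) (h' : b ≤ c) (y : M.obj a) :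
    mulMap M h' (mulMap M h y) = mulMap M (h.trans h') y := by
  have := congrArg (fun g => g.hom y) (M.map_comp (homOfLE h) (homOfLE h'))
  exact this.symm

lemma app_mulMap {M N : GrMod k n} (f : M ⟶ N) {a b : Deg n} (h : a ≤ b) (y : M.obj a) :
    (f.app b).hom (mulMap M h y) = mulMap N h ((f.app a).hom y) := by
  have := congrArg (fun g => g.hom y) (f.naturality (homOfLE h))
  exact this

/-- For a `k`-vector space `V` and a proposition `p`, the subspace of `V` which is `V` if `p` holds
and `0` otherwise. -/
def only (p : Prop) (V : Type u) [AddCommGroup V] [Module k V] : Submodule k V where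
  carrier := {y | ¬ p → y = 0}
  add_mem' := fun hx hy h => by rw [hx h, hy h, add_zero]
  zero_mem' := fun _ => rfl
  smul_mem' := fun c _ hx h => by rw [hx h, smul_zero]

/-- Translation by `a` on degrees. -/
def addFunctor (a : Deg n) : Deg n ⥤ Deg n :=
  Monotone.functor (f := fun b => a + b) fun _ _ h => add_le_add_right h a

/-- The shift `M(a)`, with `M(a)_b = M_(a + b)`. -/
def shift (M : GrMod k n) (a : Deg n) : GrMod k n := addFunctor a ⋙ M

/-- For an order-convex `U ⊆ ℤⁿ`, the graded module with basis `x^a`, `a ∈ U`, where the product of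
a monomial with `x^a` is the expected basis element, or `0` if its degree leaves `U`. -/
def monomialModule (k : Type u) [Field k] (U : Set (Deg n)) (hU : U.OrdConnected) :
    GrMod k n where
  obj a := ModuleCat.of k
    (only (a ∈ U) k : Submodule k k)
  map {a b} _ := ModuleCat.ofHom
    { toFun := fun c => ⟨by classical exact if b ∈ U then c.1 else 0, fun h => by simp [h]⟩
      map_add' := fun x y => by
        ext
        by_cases h : b ∈ U <;> simp [h]
      map_smul' := fun r x => by
        ext
        by_cases h : b ∈ U <;> simp [h] }
  map_id a := by
    ext x
    by_cases h : a ∈ U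
    · simp [h]
    · simp [h, x.2 h]
  map_comp {a b c} f g := by
    ext x
    by_cases hc : c ∈ U
    · by_cases hb : b ∈ U
      · simp [hb, hc]
      · have ha : a ∉ U := fun ha => hb (hU.out ha hc ⟨leOfHom f, leOfHom g⟩)
        simp [hb, hc, x.2 ha]
    · simp [hc]

/-- The polynomial ring `S`, as a graded module over itself. -/
def polyRing (k : Type u) [Field k] (n : ℕ) : GrMod k n :=
  monomialModule k (Set.Ici 0) Set.ordConnected_Ici

/-- The free module `S(-F)`. -/
def freeModule (k : Type u) [Field k] (F : Finset (Fin n)) : GrMod k n :=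
  shift (polyRing k n) (-ind F)

/-- The canonical module `ω_S = S(-1, …, -1)`. -/
def omega (k : Type u) [Field k] (n : ℕ) : GrMod k n :=
  shift (polyRing k n) (-ones n)

/-- `S/P_F`, where `P_F = (xᵢ | i ∉ F)`: it has as basis the monomials in the `xᵢ` with `i ∈ F`. -/
def quotPrime (k : Type u) [Field k] (F : Finset (Fin n)) : GrMod k n :=
  monomialModule k {a | 0 ≤ a ∧ ∀ i ∉ F, a i = 0}
    ⟨fun _ ha _ hb _ hc =>
      ⟨ha.1.trans hc.1, fun i hi => le_antisymm ((hc.2 i).trans (hb.2 i hi).le)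
        ((ha.1.trans hc.1) i)⟩⟩

/-! ## Squarefree modules and straight modules -/

/-- Squarefree modules. In (b), `b` plays the role of `a + b'` with `b' ∈ ℕⁿ`. -/
structure IsSquarefree (M : GrMod k n) : Prop where
  subsingleton : ∀ a : Deg n, ¬ 0 ≤ a → Subsingleton (M.obj a)
  finite : ∀ a : Deg n, Module.Finite k (M.obj a)
  bijective : ∀ (a b : Deg n) (h : a ≤ b), 0 ≤ a → posSupp b = posSupp a →
    Function.Bijective (mulMap M h)

/-- Straight modules. -/
structure IsStraight (M : GrMod k n) : Prop where
  finite : ∀ a : Deg n, Module.Finite k (M.obj a)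
  bijective : ∀ (a b : Deg n) (h : a ≤ b), posSupp b = posSupp a →
    Function.Bijective (mulMap M h)

/-- The category `Sq` of squarefree modules, a full subcategory of `*Mod`. -/
abbrev Sq (k : Type u) [Field k] (n : ℕ) :=
  ObjectProperty.FullSubcategory (fun M : GrMod k n => IsSquarefree M)

/-- The inclusion `Sq ⥤ *Mod`. -/
abbrev incl (k : Type u) [Field k] (n : ℕ) : Sq k n ⥤ GrMod k n :=
  ObjectProperty.ι (fun M : GrMod k n => IsSquarefree M)

/-- The inclusion, on complexes. -/
abbrev inclComplex (k : Type u) [Field k] (n : ℕ) :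
    CochainComplex (Sq k n) ℤ ⥤ CochainComplex (GrMod k n) ℤ :=
  (incl k n).mapHomologicalComplex (ComplexShape.up ℤ)

/-- The `ℕⁿ`-graded part `𝒩(M)` of a graded module. -/
def natPart (M : GrMod k n) : GrMod k n where
  obj a := ModuleCat.of k
    (only (0 ≤ a) (M.obj a) : Submodule k (M.obj a))
  map {a b} f := ModuleCat.ofHom ((mulMap M (leOfHom f)).restrict fun y hy h => by
    rw [hy fun h0 => h (h0.trans (leOfHom f)), map_zero])
  map_id a := by
    ext y
    simp [mulMap_refl]
  map_comp f g := by
    refine ModuleCat.hom_ext (LinearMap.ext fun y => Subtype.ext ?_)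
    exact (mulMap_mulMap M _ _ _).symm

/-- The monotone map `a ↦ supp₊(a)` on degrees. -/
def supFunctor (n : ℕ) : Deg n ⥤ Deg n :=
  Monotone.functor (f := fun a => ind (posSupp a)) fun _ _ h => ind_mono (posSupp_mono h)

/-- The functor `𝒵`, from squarefree modules to straight modules: `𝒵(M)_a = M_(supp₊ a)`, and
multiplication from degree `a` to degree `b` is multiplication from degree `supp₊ a` to
degree `supp₊ b` on `M`. -/
def straightFunctor (k : Type u) [Field k] (n : ℕ) : GrMod k n ⥤ GrMod k n :=
  (Functor.whiskeringLeft _ _ _).obj (supFunctor n)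

instance : (straightFunctor k n).Additive :=
  inferInstanceAs ((Functor.whiskeringLeft _ _ _).obj (supFunctor n)).Additive

/-- `𝒵(M)` is straight. -/
theorem isStraight_straightFunctor (M : GrMod k n) (hM : IsSquarefree M) :
    IsStraight ((straightFunctor k n).obj M) where
  finite a := hM.finite _
  bijective a b h hs := by
    have key : ∀ (c d : Deg n) (hcd : c ≤ d), c = d → Function.Bijective (mulMap M hcd) := by
      rintro c d hcd rfl
      rw [mulMap_refl]
      exact Function.bijective_id
    exact key (ind (posSupp a)) (ind (posSupp b)) (ind_mono (posSupp_mono h)) (by rw [hs])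

lemma ind_posSupp_le {a : Deg n} (ha : 0 ≤ a) : ind (posSupp a) ≤ a := by
  intro i
  have h0 : (0 : ℤ) ≤ a i := ha i
  by_cases h : 0 < a i
  · have h1 : ind (posSupp a) i = 1 := if_pos (mem_posSupp.2 h)
    rw [h1]
    exact h
  · have h1 : ind (posSupp a) i = 0 := if_neg fun h' => h (mem_posSupp.1 h')
    rw [h1]
    exact h0

lemma posSupp_ind (F : Finset (Fin n)) : posSupp (ind F) = F := by
  ext i
  by_cases h : i ∈ F <;> simp [mem_posSupp, ind, h]

/-- The `ℕⁿ`-graded part of `𝒵(M)` is isomorphic to `M`. -/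
theorem nonempty_natPart_straightFunctor_iso (M : GrMod k n) (hM : IsSquarefree M) :
    Nonempty (natPart ((straightFunctor k n).obj M) ≅ M) := by
  classical
  let e : natPart ((straightFunctor k n).obj M) ⟶ M :=
    { app := fun a => ModuleCat.ofHom
        (if ha : 0 ≤ a then (mulMap M (ind_posSupp_le ha)).comp (Submodule.subtype _) else 0)
      naturality := by
        intro a b f
        ext y
        by_cases ha : 0 ≤ a
        · have hb : 0 ≤ b := ha.trans (leOfHom f)
          simp only [ha, hb, dif_pos]
          change mulMap M _ (mulMap M _ y.1) = mulMap M _ (mulMap M _ y.1)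
          exact (mulMap_mulMap M _ _ _).trans (mulMap_mulMap M _ _ _).symm
        · have hy : y = 0 := Subtype.ext (y.2 ha)
          rw [hy, map_zero, map_zero] }
  have he : ∀ a, Function.Bijective (e.app a).hom := by
    intro a
    by_cases ha : 0 ≤ a
    · have h1 := hM.bijective _ _ (ind_posSupp_le ha) (ind_nonneg _) (posSupp_ind _).symm
      have h2 : (e.app a).hom = (mulMap M (ind_posSupp_le ha)).comp (Submodule.subtype _) := by
        simp only [e, ha, dif_pos]
        rfl
      rw [h2]
      constructor
      · exact h1.1.comp Subtype.val_injective
      · intro z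
        obtain ⟨y, hy⟩ := h1.2 z
        exact ⟨⟨y, fun h => absurd ha h⟩, hy⟩
    · have h1 := hM.subsingleton a ha
      constructor
      · intro x y _
        exact Subtype.ext ((x.2 ha).trans (y.2 ha).symm)
      · intro z
        exact ⟨0, Subsingleton.elim _ _⟩
  have : ∀ a, IsIso (e.app a) := fun a => (ConcreteCategory.isIso_iff_bijective _).2 (he a)
  have : IsIso e := NatIso.isIso_of_isIso_app e
  exact ⟨asIso e⟩

/-! ## Alexander duality -/

/-- The underlying graded module of `𝐀(M)`: for `a ∈ ℕⁿ` with `F = supp₊ a`, the component of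
degree `a` is the `k`-dual of `M_(Fᶜ)`, and the other components vanish. Multiplications are the
`k`-duals of multiplications of `M`. -/
def alexanderObj (M : GrMod k n) : GrMod k n where
  obj a := ModuleCat.of k
    (only (0 ≤ a) _ : Submodule k (Module.Dual k (M.obj (ind (posSupp a)ᶜ))))
  map {a b} f := ModuleCat.ofHom
    ((Module.Dual.transpose (mulMap M (compl_posSupp_le (leOfHom f)))).restrict fun φ hφ h => by
      rw [hφ fun h0 => h (h0.trans (leOfHom f)), map_zero])
  map_id a := by
    refine ModuleCat.hom_ext (LinearMap.ext fun φ => Subtype.ext (LinearMap.ext fun y => ?_))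
    change φ.1 (mulMap M _ y) = φ.1 y
    rw [mulMap_refl, LinearMap.id_apply]
  map_comp f g := by
    refine ModuleCat.hom_ext (LinearMap.ext fun φ => Subtype.ext (LinearMap.ext fun y => ?_))
    change φ.1 (mulMap M _ y) = φ.1 (mulMap M _ (mulMap M _ y))
    rw [mulMap_mulMap]

/-- `𝐀` on morphisms. -/
def alexanderMap {M N : GrMod k n} (f : M ⟶ N) : alexanderObj N ⟶ alexanderObj M where
  app a := ModuleCat.ofHom
    ((Module.Dual.transpose (f.app (ind (posSupp a)ᶜ)).hom).restrict fun φ hφ h => by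
      rw [hφ h, map_zero])
  naturality a b g := by
    refine ModuleCat.hom_ext (LinearMap.ext fun φ => Subtype.ext (LinearMap.ext fun y => ?_))
    change φ.1 (mulMap N _ ((f.app _).hom y)) = φ.1 ((f.app _).hom (mulMap M _ y))
    rw [app_mulMap]

theorem isSquarefree_alexanderObj {M : GrMod k n} (hM : IsSquarefree M) :
    IsSquarefree (alexanderObj M) where
  subsingleton a ha := ⟨fun x y => Subtype.ext ((x.2 ha).trans (y.2 ha).symm)⟩
  finite a := by
    have := hM.finite (ind (posSupp a)ᶜ)
    exact inferInstanceAs (Module.Finite k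
      (only (k := k) (0 ≤ a) (Module.Dual k (M.obj (ind (posSupp a)ᶜ)))))
  bijective a b h ha hs := by
    have hb := ha.trans h
    have key : ∀ (c d : Deg n) (hcd : c ≤ d), c = d → Function.Bijective (mulMap M hcd) := by
      rintro c d hcd rfl
      rw [mulMap_refl]
      exact Function.bijective_id
    have hbij := key _ _ (compl_posSupp_le h) (by rw [hs])
    constructor
    · intro x y hxy
      refine Subtype.ext (LinearMap.ext fun z => ?_)
      obtain ⟨w, rfl⟩ := hbij.2 z
      exact LinearMap.congr_fun (congrArg Subtype.val hxy) w
    · intro ψ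
      let E := LinearEquiv.ofBijective _ hbij
      refine ⟨⟨ψ.1.comp E.symm.toLinearMap, fun h0 => absurd ha h0⟩, ?_⟩
      refine Subtype.ext (LinearMap.ext fun z => ?_)
      change ψ.1 (E.symm (E z)) = ψ.1 z
      rw [LinearEquiv.symm_apply_apply]

/-- The Alexander duality functor `𝐀`, a contravariant functor from `Sq` to itself. -/
def alexander (k : Type u) [Field k] (n : ℕ) : (Sq k n)ᵒᵖ ⥤ Sq k n where
  obj M := ⟨alexanderObj M.unop.obj, isSquarefree_alexanderObj M.unop.property⟩
  map f := ObjectProperty.homMk (alexanderMap f.unop.hom)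
  map_id M := by
    ext
    rfl
  map_comp f g := by
    ext
    rfl

lemma alexanderMap_zero (M N : GrMod k n) : alexanderMap (0 : M ⟶ N) = 0 := by
  ext a : 2
  refine ModuleCat.hom_ext (LinearMap.ext fun φ => Subtype.ext (LinearMap.ext fun y => ?_))
  change φ.1 0 = 0
  exact map_zero _

/-- `𝐀` on complexes: `𝐀(M)^j = 𝐀(M^(-j))`. -/
def alexanderComplex (M : CochainComplex (Sq k n) ℤ) : CochainComplex (Sq k n) ℤ where
  X j := (alexander k n).obj (Opposite.op (M.X (-j)))
  d i j := (alexander k n).map (M.d (-j) (-i)).op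
  shape i j h := by
    rw [M.shape _ _ fun h' => h (by simp only [ComplexShape.up_Rel] at h' ⊢; omega)]
    ext : 1
    exact alexanderMap_zero _ _
  d_comp_d' i j l _ _ := by
    rw [← Functor.map_comp, ← op_comp, M.d_comp_d]
    ext : 1
    exact alexanderMap_zero _ _

/-! ## Minimal resolutions and the numbers `β_i(F, M)`, `μ̄^i(F, M)` -/

/-- Bounded complexes, i.e. the objects of `Com^b(Sq)`. -/
def IsBounded (M : CochainComplex (Sq k n) ℤ) : Prop :=
  ∃ N : ℕ, ∀ i : ℤ, (N : ℤ) < |i| → IsZero (M.X i)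

/-- A (graded) submodule of a graded module. -/
structure GrSubmodule (M : GrMod k n) where
  comp : ∀ a : Deg n, Submodule k (M.obj a)
  mul_mem : ∀ (a b : Deg n) (h : a ≤ b) (y : M.obj a), y ∈ comp a → mulMap M h y ∈ comp b

/-- `I`, with `M ⟶ I`, is a minimal injective resolution of `M` in `Com^b(Sq)`: `I` is a bounded
complex of injective objects of `Sq`, the map is a quasi-isomorphism, and each `I^i` is a
*essential extension of `ker (I^i ⟶ I^(i+1))`. -/
structure IsMinimalInjectiveResolution {M I : CochainComplex (Sq k n) ℤ} (f : M ⟶ I) : Prop where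
  bounded : IsBounded I
  injective : ∀ i, Injective (I.X i)
  quasiIso : QuasiIso ((inclComplex k n).map f)
  essential : ∀ (i : ℤ) (L : GrSubmodule (I.X i).obj), (∃ a, L.comp a ≠ ⊥) →
    ∃ a, L.comp a ⊓ LinearMap.ker (((I.d i (i + 1)).hom.app a).hom) ≠ ⊥

/-- `P`, with `P ⟶ M`, is a minimal projective resolution of `M` in `Com^b(Sq)`: `P` is a bounded
complex of projective objects of `Sq`, the map is a quasi-isomorphism, and the image
of `P^(i-1) ⟶ P^i` is contained in `𝔪 P^i`, whose component of degree `a`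
is `∑ⱼ xⱼ (P^i)_(a - eⱼ)`. -/
structure IsMinimalProjectiveResolution {P M : CochainComplex (Sq k n) ℤ} (f : P ⟶ M) : Prop where
  bounded : IsBounded P
  projective : ∀ i, Projective (P.X i)
  quasiIso : QuasiIso ((inclComplex k n).map f)
  minimal : ∀ (i : ℤ) (a : Deg n),
    LinearMap.range (((P.d (i - 1) i).hom.app a).hom) ≤
      ⨆ j : Fin n, LinearMap.range (mulMap (P.X i).obj (sub_unitDeg_le a j))

instance : HasFiniteBiproducts (GrMod k n) := Abelian.hasFiniteBiproducts

/-- `μ i F` are the numbers `μ̄^i(F, M)`: there is a minimal injective resolution `I` of `M` in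
`Com^b(Sq)` such that `I^i` is the direct sum of `μ i F` copies of `S/P_F`, `F ⊆ [n]`. -/
def IsSquarefreeBassNumbers (M : CochainComplex (Sq k n) ℤ)
    (μ : ℤ → Finset (Fin n) → ℕ) : Prop :=
  ∃ (I : CochainComplex (Sq k n) ℤ) (f : M ⟶ I), IsMinimalInjectiveResolution f ∧
    ∀ i : ℤ, Nonempty ((I.X i).obj ≅
      ⨁ fun p : (F : Finset (Fin n)) × Fin (μ i F) => quotPrime k p.1)

/-- `β i F` are the numbers `β_i(F, M)`: there is a minimal projective resolution `P` of `M` in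
`Com^b(Sq)` such that `P^(-i)` is the direct sum of `β i F` copies of `S(-F)`, `F ⊆ [n]`. -/
def IsSquarefreeBettiNumbers (M : CochainComplex (Sq k n) ℤ)
    (β : ℤ → Finset (Fin n) → ℕ) : Prop :=
  ∃ (P : CochainComplex (Sq k n) ℤ) (f : P ⟶ M), IsMinimalProjectiveResolution f ∧
    ∀ i : ℤ, Nonempty ((P.X (-i)).obj ≅
      ⨁ fun p : (F : Finset (Fin n)) × Fin (β i F) => freeModule k p.1)

/-! ## Ext -/

section HyperExt

universe v w

variable {C : Type w} [Category.{v} C] [Abelian C]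

/-- `Ext^i(K, L)` for complexes `K`, `L`: the morphisms `K ⟶ L⟦i⟧` in the derived category. -/
def HyperExt (K L : CochainComplex C ℤ) (i : ℤ) : Type (max w v) :=
  letI := HasDerivedCategory.standard C
  DerivedCategory.Q.obj K ⟶ (DerivedCategory.Q.obj L)⟦i⟧

instance (K L : CochainComplex C ℤ) (i : ℤ) : AddCommGroup (HyperExt K L i) :=
  letI := HasDerivedCategory.standard C
  inferInstanceAs (AddCommGroup (DerivedCategory.Q.obj K ⟶ (DerivedCategory.Q.obj L)⟦i⟧))

instance (R : Type*) [Ring R] [Linear R C] (K L : CochainComplex C ℤ) (i : ℤ) :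
    Module R (HyperExt K L i) :=
  letI := HasDerivedCategory.standard C
  inferInstanceAs (Module R (DerivedCategory.Q.obj K ⟶ (DerivedCategory.Q.obj L)⟦i⟧))

end HyperExt

/-- A graded module as a complex concentrated in degree `0`. -/
def single (N : GrMod k n) : CochainComplex (GrMod k n) ℤ :=
  (HomologicalComplex.single (GrMod k n) (ComplexShape.up ℤ) 0).obj N

/-- The component `[Ext_S^i(M, N)]_a = Ext_{*Mod}^i(M, N(a))` of degree `a`. -/
abbrev gradedExt (M : CochainComplex (Sq k n) ℤ) (N : GrMod k n) (i : ℤ) (a : Deg n) :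
    Type (u + 1) :=
  HyperExt ((inclComplex k n).obj M) (single (shift N a)) i

/-! ## The underlying module over the polynomial ring -/

/-- The direct sum of all components of a graded module. -/
def Total (M : GrMod k n) : Type u := DirectSum (Deg n) fun a => M.obj a

instance (M : GrMod k n) : AddCommGroup (Total M) :=
  inferInstanceAs (AddCommGroup (DirectSum (Deg n) fun a => M.obj a))

/-- The `k`-vector space structure on the direct sum. -/
instance totalModuleField (M : GrMod k n) : Module k (Total M) :=
  inferInstanceAs (Module k (DirectSum (Deg n) fun a => M.obj a))

/-- The inclusion of the component of degree `a`. -/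
def totalOf (M : GrMod k n) (a : Deg n) : M.obj a →ₗ[k] Total M :=
  DirectSum.lof k (Deg n) (fun a => M.obj a) a

lemma total_ext {M : GrMod k n} {V : Type*} [AddCommGroup V] [Module k V]
    {f g : Total M →ₗ[k] V} (h : ∀ a y, f (totalOf M a y) = g (totalOf M a y)) : f = g :=
  DirectSum.linearMap_ext k fun a => LinearMap.ext fun y => h a y

lemma totalOf_mulMap (M : GrMod k n) {a b c : Deg n} (hb : a ≤ b) (hc : a ≤ c) (e : b = c)
    (y : M.obj a) : totalOf M b (mulMap M hb y) = totalOf M c (mulMap M hc y) := by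
  subst e
  rfl

/-- Multiplication by the monomial `x^b`, which maps degree `a` to degree `a + b`. -/
def monomialAction (M : GrMod k n) (b : Fin n →₀ ℕ) : Module.End k (Total M) :=
  DirectSum.toModule k (Deg n) (Total M) fun a =>
    (totalOf M (a + expDeg b)).comp (mulMap M (le_add_expDeg a b))

lemma monomialAction_totalOf (M : GrMod k n) (b : Fin n →₀ ℕ) (a : Deg n) (y : M.obj a) :
    monomialAction M b (totalOf M a y) =
      totalOf M (a + expDeg b) (mulMap M (le_add_expDeg a b) y) :=
  DirectSum.toModule_lof k (φ := fun a => (totalOf M (a + expDeg b)).comp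
    (mulMap M (le_add_expDeg a b))) a y

/-- The action of the monoid of monomials. -/
def monomialHom (M : GrMod k n) : Multiplicative (Fin n →₀ ℕ) →* Module.End k (Total M) where
  toFun b := monomialAction M b.toAdd
  map_one' := total_ext fun a y => by
    rw [monomialAction_totalOf]
    have e : a + expDeg (Multiplicative.toAdd (1 : Multiplicative (Fin n →₀ ℕ))) = a :=
      funext fun i => add_zero (a i : ℤ)
    rw [totalOf_mulMap M _ le_rfl e, mulMap_refl]
    rfl
  map_mul' b c := total_ext fun a y => by
    rw [Module.End.mul_apply, monomialAction_totalOf, monomialAction_totalOf,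
      monomialAction_totalOf, mulMap_mulMap]
    refine totalOf_mulMap M _ _ (funext fun i => ?_) y
    change a i + ((b.toAdd i + c.toAdd i : ℕ) : ℤ) = a i + (c.toAdd i : ℤ) + (b.toAdd i : ℤ)
    push_cast
    ring

/-- The `S`-module structure on the direct sum. -/
instance totalModule (M : GrMod k n) : Module (MvPolynomial (Fin n) k) (Total M) :=
  Module.compHom (Total M)
    (AddMonoidAlgebra.lift k (Module.End k (Total M)) (Fin n →₀ ℕ) (monomialHom M)).toRingHom

/-- The term `c x^b` sends `y` of degree `a` to `c • x^b y`, of degree `a + b`. -/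
theorem monomial_smul_totalOf (M : GrMod k n) (b : Fin n →₀ ℕ) (c : k) (a : Deg n)
    (y : M.obj a) :
    MvPolynomial.monomial b c • totalOf M a y =
      totalOf M (a + expDeg b) (c • mulMap M (le_add_expDeg a b) y) := by
  have h : AddMonoidAlgebra.lift k (Module.End k (Total M)) (Fin n →₀ ℕ) (monomialHom M)
      (MvPolynomial.monomial b c) = c • monomialAction M b :=
    AddMonoidAlgebra.lift_single _ _ _
  change AddMonoidAlgebra.lift k (Module.End k (Total M)) (Fin n →₀ ℕ) (monomialHom M)
      (MvPolynomial.monomial b c) (totalOf M a y) = _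
  rw [h, LinearMap.smul_apply, monomialAction_totalOf, map_smul]

/-- The map on direct sums, as a `k`-linear map. -/
def totalMapAux {M N : GrMod k n} (f : M ⟶ N) : Total M →ₗ[k] Total N :=
  DirectSum.toModule k (Deg n) (Total N) fun a => (totalOf N a).comp (f.app a).hom

lemma totalMapAux_totalOf {M N : GrMod k n} (f : M ⟶ N) (a : Deg n) (y : M.obj a) :
    totalMapAux f (totalOf M a y) = totalOf N a ((f.app a).hom y) :=
  DirectSum.toModule_lof k (φ := fun a => (totalOf N a).comp (f.app a).hom) a y

/-- The `S`-linear map on direct sums induced by a map of graded modules. -/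
def totalMap {M N : GrMod k n} (f : M ⟶ N) : Total M →ₗ[MvPolynomial (Fin n) k] Total N where
  toFun := totalMapAux f
  map_add' := map_add _
  map_smul' p x := by
    simp only [RingHom.id_apply]
    induction p using MvPolynomial.induction_on' with
    | monomial b c =>
      let A (L : GrMod k n) : Total L →ₗ[k] Total L :=
        AddMonoidAlgebra.lift k (Module.End k (Total L)) (Fin n →₀ ℕ) (monomialHom L)
          (MvPolynomial.monomial b c)
      have : (totalMapAux f).comp (A M) = (A N).comp (totalMapAux f) := total_ext fun a y => by
        change totalMapAux f (MvPolynomial.monomial b c • totalOf M a y) =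
          MvPolynomial.monomial b c • totalMapAux f (totalOf M a y)
        rw [monomial_smul_totalOf, totalMapAux_totalOf, totalMapAux_totalOf,
          monomial_smul_totalOf, map_smul, app_mulMap]
      exact LinearMap.congr_fun this x
    | add p q hp hq => rw [add_smul, map_add, hp, hq, add_smul]

/-- The functor from graded modules to modules over `S = k[x₁, …, xₙ]` that forgets the grading. -/
def total (k : Type u) [Field k] (n : ℕ) :
    GrMod k n ⥤ ModuleCat.{u} (MvPolynomial (Fin n) k) where
  obj M := ModuleCat.of (MvPolynomial (Fin n) k) (Total M)
  map f := ModuleCat.ofHom (totalMap f)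
  map_id M := by
    refine ModuleCat.hom_ext (LinearMap.ext fun x => ?_)
    have : totalMapAux (𝟙 M) = LinearMap.id := total_ext fun a y => totalMapAux_totalOf _ a y
    exact LinearMap.congr_fun this x
  map_comp {L M N} f g := by
    refine ModuleCat.hom_ext (LinearMap.ext fun x => ?_)
    have : totalMapAux (f ≫ g) = (totalMapAux g).comp (totalMapAux f) := total_ext fun a y => by
      rw [LinearMap.comp_apply, totalMapAux_totalOf, totalMapAux_totalOf, totalMapAux_totalOf]
      rfl
    exact LinearMap.congr_fun this x

instance : (total k n).Additive where
  map_add {M N f g} := by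
    refine ModuleCat.hom_ext (LinearMap.ext fun x => ?_)
    have : totalMapAux (f + g) = totalMapAux f + totalMapAux g := total_ext fun a y => by
      rw [LinearMap.add_apply, totalMapAux_totalOf, totalMapAux_totalOf, totalMapAux_totalOf,
        ← map_add]
      rfl
    exact LinearMap.congr_fun this x

/-! The functor `total` identifies `GrMod k n` with the category of `S`-modules equipped with a
`ℤⁿ`-grading and degree-preserving `S`-linear maps. -/

lemma exists_eq_add_expDeg {a b : Deg n} (h : a ≤ b) :
    ∃ c : Fin n →₀ ℕ, b = a + expDeg c := by
  refine ⟨Finsupp.equivFunOnFinite.symm fun i => Int.toNat (b i - a i), funext fun i => ?_⟩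
  have hi : (a i : ℤ) ≤ b i := h i
  change (b i : ℤ) = a i + ((Int.toNat (b i - a i) : ℕ) : ℤ)
  rw [Int.toNat_of_nonneg (by linarith)]
  ring

lemma totalOf_injective (M : GrMod k n) (a : Deg n) : Function.Injective (totalOf M a) :=
  DirectSum.of_injective a

/-- Degree-preserving `S`-linear maps are the maps induced by morphisms of `GrMod k n`. -/
theorem existsUnique_totalMap_eq {M N : GrMod k n}
    (g : Total M →ₗ[MvPolynomial (Fin n) k] Total N)
    (hg : ∀ a y, g (totalOf M a y) ∈ LinearMap.range (totalOf N a)) :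
    ∃! f : M ⟶ N, totalMap f = g := by
  have hk : ∀ (c : k) (L : GrMod k n) (x : Total L),
      c • x = (MvPolynomial.C c : MvPolynomial (Fin n) k) • x := by
    intro c L x
    have h : AddMonoidAlgebra.lift k (Module.End k (Total L)) (Fin n →₀ ℕ) (monomialHom L)
        (MvPolynomial.C c) = algebraMap k _ c := AlgHom.commutes _ c
    change _ = AddMonoidAlgebra.lift k (Module.End k (Total L)) (Fin n →₀ ℕ) (monomialHom L)
        (MvPolynomial.C c) x
    rw [h]
    rfl
  choose φ hφ using hg
  have hnat : ∀ {a b : Deg n} (h : a ≤ b) (y : M.obj a),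
      φ b (mulMap M h y) = mulMap N h (φ a y) := by
    intro a b h y
    obtain ⟨c, rfl⟩ := exists_eq_add_expDeg h
    apply totalOf_injective N
    have h1 := monomial_smul_totalOf M c 1 a y
    have h2 := monomial_smul_totalOf N c 1 a (φ a y)
    rw [one_smul] at h1 h2
    rw [hφ, ← h1, map_smul, ← hφ, h2]
  let f : M ⟶ N :=
    { app := fun a => ModuleCat.ofHom
        { toFun := φ a
          map_add' := fun x y => totalOf_injective N a (by
            rw [map_add, hφ, hφ, hφ, map_add, map_add])
          map_smul' := fun c x => totalOf_injective N a (by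
            rw [RingHom.id_apply, map_smul, hφ, hφ, map_smul, hk, hk, map_smul]) }
      naturality := fun a b h => by
        refine ModuleCat.hom_ext (LinearMap.ext fun y => ?_)
        exact hnat (leOfHom h) y }
  refine ⟨f, ?_, fun f' hf' => ?_⟩
  · refine LinearMap.ext fun x => ?_
    let gk : Total M →ₗ[k] Total N :=
      { toFun := g
        map_add' := map_add g
        map_smul' := fun c x => by rw [RingHom.id_apply, hk, hk, map_smul] }
    have : totalMapAux f = gk := total_ext fun a y => by
      rw [totalMapAux_totalOf]
      exact hφ a y
    exact LinearMap.congr_fun this x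
  · ext a : 2
    refine ModuleCat.hom_ext (LinearMap.ext fun y => totalOf_injective N a ?_)
    rw [← totalMapAux_totalOf]
    exact (LinearMap.congr_fun hf' (totalOf M a y)).trans (hφ a y).symm

/-- Every `S`-module with a `ℤⁿ`-grading is the module underlying an object of `GrMod k n`. -/
theorem exists_total_equiv {V : Type u} [AddCommGroup V] [Module k V]
    [Module (MvPolynomial (Fin n) k) V] [IsScalarTower k (MvPolynomial (Fin n) k) V]
    (𝒱 : Deg n → Submodule k V) (h𝒱 : DirectSum.IsInternal 𝒱)
    (hmul : ∀ (a : Deg n) (b : Fin n →₀ ℕ), ∀ v ∈ 𝒱 a,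
      (MvPolynomial.monomial b (1 : k)) • v ∈ 𝒱 (a + expDeg b)) :
    ∃ (M : GrMod k n) (e : Total M ≃ₗ[MvPolynomial (Fin n) k] V),
      ∀ (a : Deg n) (v : V), v ∈ 𝒱 a ↔ ∃ y, e (totalOf M a y) = v := by
  have ex : ∀ {a b : Deg n} (h : a ≤ b), b = a + expDeg (exists_eq_add_expDeg h).choose :=
    fun h => (exists_eq_add_expDeg h).choose_spec
  have exp_inj : ∀ {c d : Fin n →₀ ℕ}, expDeg c = expDeg d → c = d := by
    intro c d h
    ext i
    exact Int.ofNat.inj (congrFun h i)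
  have exp_add : ∀ c d : Fin n →₀ ℕ, expDeg (c + d) = expDeg c + expDeg d := by
    intro c d
    exact funext fun i => by
      change ((c i + d i : ℕ) : ℤ) = (c i : ℤ) + (d i : ℤ)
      push_cast
      rfl
  let μ : (Fin n →₀ ℕ) → V →ₗ[k] V := fun c =>
    LinearMap.restrictScalars k
      (LinearMap.lsmul (MvPolynomial (Fin n) k) V (MvPolynomial.monomial c (1 : k)))
  have hμ0 : ∀ v, μ 0 v = v := fun v => one_smul (MvPolynomial (Fin n) k) v
  have hμ : ∀ c d v, μ (c + d) v = μ d (μ c v) := by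
    intro c d v
    change MvPolynomial.monomial (c + d) (1 : k) • v =
      MvPolynomial.monomial d (1 : k) • MvPolynomial.monomial c (1 : k) • v
    rw [smul_smul, MvPolynomial.monomial_mul, mul_one, add_comm c d]
  let M : GrMod k n :=
    { obj := fun a => ModuleCat.of k (𝒱 a)
      map := fun {a b} h => ModuleCat.ofHom
        ((μ (exists_eq_add_expDeg (leOfHom h)).choose).restrict fun v hv => by
          have := hmul a (exists_eq_add_expDeg (leOfHom h)).choose v hv
          rw [← ex (leOfHom h)] at this
          exact this)
      map_id := fun a => by
        refine ModuleCat.hom_ext (LinearMap.ext fun y => Subtype.ext ?_)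
        change μ (exists_eq_add_expDeg (le_refl a)).choose y.1 = y.1
        have h0 : (exists_eq_add_expDeg (le_refl a)).choose = 0 := exp_inj (by
          have := ex (le_refl a)
          rw [left_eq_add] at this
          rw [this]
          rfl)
        rw [h0, hμ0]
      map_comp := fun {a b c} f g => by
        refine ModuleCat.hom_ext (LinearMap.ext fun y => Subtype.ext ?_)
        change μ (exists_eq_add_expDeg (leOfHom (f ≫ g))).choose y.1 =
          μ (exists_eq_add_expDeg (leOfHom g)).choose
            (μ (exists_eq_add_expDeg (leOfHom f)).choose y.1)
        rw [← hμ]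
        congr 2
        apply exp_inj
        rw [exp_add]
        have h1 := ex (leOfHom f)
        have h2 := ex (leOfHom g)
        have h3 := ex (leOfHom (f ≫ g))
        have h4 : a + expDeg (exists_eq_add_expDeg (leOfHom (f ≫ g))).choose =
            a + (expDeg (exists_eq_add_expDeg (leOfHom f)).choose +
              expDeg (exists_eq_add_expDeg (leOfHom g)).choose) := by
          rw [← add_assoc, ← h1, ← h2, ← h3]
        exact add_left_cancel h4 }
  have hmap : ∀ (a : Deg n) (c : Fin n →₀ ℕ) (y : 𝒱 a),
      (mulMap M (le_add_expDeg a c) y : 𝒱 (a + expDeg c)).1 =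
        MvPolynomial.monomial c (1 : k) • y.1 := by
    intro a c y
    change μ (exists_eq_add_expDeg (le_add_expDeg a c)).choose y.1 = μ c y.1
    congr 2
    exact exp_inj (add_left_cancel (ex (le_add_expDeg a c))).symm
  let e₀ : Total M →ₗ[k] V := DirectSum.coeLinearMap 𝒱
  have he₀ : ∀ a (y : 𝒱 a), e₀ (totalOf M a y) = y.1 := fun a y =>
    DirectSum.coeLinearMap_lof 𝒱 a y
  let e₁ : Total M →ₗ[MvPolynomial (Fin n) k] V :=
    { toFun := e₀
      map_add' := map_add e₀
      map_smul' := fun p x => by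
        rw [RingHom.id_apply]
        induction p using MvPolynomial.induction_on' with
        | monomial b c =>
          let A : Total M →ₗ[k] Total M :=
            AddMonoidAlgebra.lift k (Module.End k (Total M)) (Fin n →₀ ℕ) (monomialHom M)
              (MvPolynomial.monomial b c)
          have : e₀.comp A = (c • μ b).comp e₀ := total_ext fun a y => by
            change e₀ (MvPolynomial.monomial b c • totalOf M a y) = c • μ b (e₀ (totalOf M a y))
            rw [monomial_smul_totalOf, he₀, he₀]
            change c • (mulMap M (le_add_expDeg a b) y : 𝒱 (a + expDeg b)).1 = _
            rw [hmap]
            rfl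
          refine (LinearMap.congr_fun this x).trans ?_
          change c • MvPolynomial.monomial b (1 : k) • e₀ x = _
          rw [← smul_assoc, MvPolynomial.smul_monomial, smul_eq_mul, mul_one]
        | add p q hp hq => rw [add_smul, map_add, hp, hq, add_smul] }
  refine ⟨M, LinearEquiv.ofBijective e₁ h𝒱, fun a v => ⟨fun hv => ⟨⟨v, hv⟩, he₀ a ⟨v, hv⟩⟩, ?_⟩⟩
  rintro ⟨y, rfl⟩
  have : e₀ (totalOf M a y) ∈ 𝒱 a := by
    rw [he₀]
    exact y.2
  exact this

/-- The complex of `S`-modules underlying `𝒵(M)`. -/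
def straightComplex (M : CochainComplex (Sq k n) ℤ) :
    CochainComplex (ModuleCat.{u} (MvPolynomial (Fin n) k)) ℤ :=
  ((straightFunctor k n ⋙ total k n).mapHomologicalComplex (ComplexShape.up ℤ)).obj
    ((inclComplex k n).obj M)

/-! ## Bass numbers -/

section Bass

variable {R : Type u} [CommRing R]

/-- The residue field `κ(P)` of `R_P`, as a complex of `R_P`-modules in degree `0`. -/
def residueComplex (P : Ideal R) [P.IsPrime] :
    CochainComplex (ModuleCat.{u} (Localization.AtPrime P)) ℤ :=
  (HomologicalComplex.single (ModuleCat.{u} (Localization.AtPrime P)) (ComplexShape.up ℤ) 0).obj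
    (ModuleCat.of (Localization.AtPrime P)
      (IsLocalRing.ResidueField (Localization.AtPrime P)))

/-- The localization `X_P` of a complex of `R`-modules. -/
def localizedComplex (P : Ideal R) [P.IsPrime] (X : CochainComplex (ModuleCat.{u} R) ℤ) :
    CochainComplex (ModuleCat.{u} (Localization.AtPrime P)) ℤ :=
  ((ModuleCat.localizedModuleFunctor.{u} P.primeCompl).mapHomologicalComplex
    (ComplexShape.up ℤ)).obj X

/-- `Ext^i_{R_P}(κ(P), X_P)`. -/
abbrev BassExt (P : Ideal R) [P.IsPrime] (X : CochainComplex (ModuleCat.{u} R) ℤ) (i : ℤ) :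
    Type (u + 1) :=
  HyperExt (residueComplex P) (localizedComplex P X) i

lemma smul_id_single {A : Type u} [CommRing A] (r : A) (V : ModuleCat.{u} A) (h : r • 𝟙 V = 0) :
    r • 𝟙 ((HomologicalComplex.single (ModuleCat.{u} A) (ComplexShape.up ℤ) 0).obj V) = 0 := by
  apply HomologicalComplex.from_single_hom_ext
  let e := HomologicalComplex.singleObjXSelf (ComplexShape.up ℤ) 0 V
  rw [HomologicalComplex.smul_f_apply, HomologicalComplex.id_f, HomologicalComplex.zero_f,
    ← e.hom_inv_id, ← Category.id_comp e.inv, ← Linear.comp_smul, ← Linear.smul_comp, h, zero_comp,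
    comp_zero]

lemma bassExt_torsion (P : Ideal R) [P.IsPrime] (X : CochainComplex (ModuleCat.{u} R) ℤ)
    (i : ℤ) :
    Module.IsTorsionBySet (Localization.AtPrime P) (BassExt P X i)
      (IsLocalRing.maximalIdeal (Localization.AtPrime P)) := by
  let _ := HasDerivedCategory.standard (ModuleCat.{u} (Localization.AtPrime P))
  rintro f ⟨r, hr⟩
  have h0 : r • 𝟙 (ModuleCat.of (Localization.AtPrime P)
      (IsLocalRing.ResidueField (Localization.AtPrime P))) = 0 := by
    refine ModuleCat.hom_ext (LinearMap.ext fun x => ?_)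
    obtain ⟨y, rfl⟩ := IsLocalRing.residue_surjective x
    change IsLocalRing.residue _ (r * y) = 0
    exact Ideal.Quotient.eq_zero_iff_mem.2 (Ideal.mul_mem_right y _ hr)
  have h1 : r • 𝟙 (residueComplex P) = 0 := by
    exact smul_id_single r _ h0
  have h2 : r • 𝟙 (DerivedCategory.Q.obj (residueComplex P)) = 0 := by
    rw [← CategoryTheory.Functor.map_id, ← Functor.map_smul, h1, Functor.map_zero]
  have h3 : ∀ g : DerivedCategory.Q.obj (residueComplex P) ⟶
      (DerivedCategory.Q.obj (localizedComplex P X))⟦i⟧, r • g = 0 := fun g => by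
    rw [← Category.id_comp g, ← Linear.smul_comp, h2, zero_comp]
  exact h3 f

/-- The `κ(P)`-vector space structure on `Ext^i_{R_P}(κ(P), X_P)`. -/
instance bassExtModule (P : Ideal R) [P.IsPrime] (X : CochainComplex (ModuleCat.{u} R) ℤ)
    (i : ℤ) :
    Module (IsLocalRing.ResidueField (Localization.AtPrime P)) (BassExt P X i) :=
  (bassExt_torsion P X i).module

/-- The Bass number `μ^i(P, X) = dim_{κ(P)} Ext^i_{R_P}(κ(P), X_P)` of a complex. -/
def bassNumber (P : Ideal R) [P.IsPrime] (X : CochainComplex (ModuleCat.{u} R) ℤ) (i : ℤ) :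
    Cardinal.{u + 1} :=
  Module.rank (IsLocalRing.ResidueField (Localization.AtPrime P)) (BassExt P X i)

end Bass

/-- The prime ideal `P_F = (xᵢ | i ∉ F)` of `S`. -/
def primeIdeal (k : Type u) [Field k] (F : Finset (Fin n)) : Ideal (MvPolynomial (Fin n) k) :=
  Ideal.span (MvPolynomial.X '' {i : Fin n | i ∉ F})

instance (F : Finset (Fin n)) : (primeIdeal k F).IsPrime := by
  classical
  let φ : MvPolynomial (Fin n) k →ₐ[k] MvPolynomial (Fin n) k :=
    MvPolynomial.aeval fun i => if i ∈ F then MvPolynomial.X i else 0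
  have key : primeIdeal k F = RingHom.ker φ := by
    apply le_antisymm
    · refine Ideal.span_le.2 ?_
      rintro _ ⟨i, hi, rfl⟩
      have hi' : i ∉ F := hi
      change φ (MvPolynomial.X i) = 0
      simp [φ, hi']
    · have h : ((Ideal.Quotient.mkₐ k (primeIdeal k F)).comp φ) =
          Ideal.Quotient.mkₐ k (primeIdeal k F) := by
        ext i
        by_cases hi : i ∈ F
        · simp [φ, hi]
        · have : MvPolynomial.X i ∈ primeIdeal k F := Ideal.subset_span ⟨i, hi, rfl⟩
          simpa [φ, hi] using (Ideal.Quotient.eq_zero_iff_mem.2 this).symm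
      intro p hp
      have h0 : φ p = 0 := hp
      have := AlgHom.congr_fun h p
      rw [AlgHom.comp_apply, h0, map_zero] at this
      exact Ideal.Quotient.eq_zero_iff_mem.1 this.symm
  rw [key]
  exact RingHom.ker_isPrime _

end SqfreeMod

end

/-! Call a function `r X m` of complexes of graded modules a cohomological rank if it behaves like
the dimensions of the groups of a cohomological functor: compatible with short exact sequences,
finite direct sums and quasi-isomorphisms (`IsCohomologicalRank`). For fixed `F`, both `μ^m(P_F,
𝒵(X))` and `dim Ext^(n-|F|-m)(X, ω_S(F))` are of this kind. On `S/P_G` placed in cohomological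
degree `t`, both take the value 1 if `G = F` and `t = m`, and 0 otherwise (`bassNumber_single`,
`rank_hyperExt_singleAt_quotPrime`). The first value holds because the localization of `𝒵(S/P_G)` at
`P_F` either vanishes, or has a variable of `P_F` acting bijectively, or (for `G = F`) behaves like
the injective hull of the residue field. The second is a Koszul computation, one variable at a time.

Any such rank counts the summands `S/P_F` of a minimal complex `I` of direct sums of modules `S/P_G`
(`rank_eq_of_killsSocle`). Dividing out the elements killed by `x^F` removes the summands with `F ⊄
G`. In the quotient, the elements killed by all `x_j`, `j ∉ F`, form the summands `S/P_F`. What is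
discarded has rank zero by dévissage on terms, and minimality says exactly that the differential
induced on this subquotient is zero, so the subquotient is the direct sum of its terms. As the rank
is a quasi-isomorphism invariant, this gives both formulas for `μ̄`, and independence of the
resolution.

Existence of minimal injective resolutions is elementary linear algebra. A squarefree module embeds
in the coinduced module `⨁_G N_G ⊗ S/P_G`, which is injective, and the cokernel lives on smaller
faces; the resolutions are spliced by mapping cocones (`exists_injective_resolution_aux`). A socle
element not killed by the differential allows a contractible complex `S/P_F ⟶ S/P_F` to be split
off, and dimensions drop (`exists_minimal_injective_aux`). Injective objects are sums of modules
`S/P_F`, read off from their socles (`exists_iso_biproduct`).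

The statements on `β` follow by Alexander duality, which is exact and involutive up to isomorphism,
exchanges `S(-F)` and `S/P_(Fᶜ)`, and exchanges the two notions of minimality. Hence `β_i(F, M) =
μ̄^i(Fᶜ, 𝐀(M))`. -/

noncomputable section

namespace SqfreeMod

universe w w' v

variable {n : ℕ} {k : Type u} [Field k]

/-! ## Elementwise criteria -/

/-- The component in degree `a` of a morphism of graded modules. -/
abbrev ev {M N : GrMod k n} (f : M ⟶ N) (a : Deg n) : M.obj a →ₗ[k] N.obj a := (f.app a).hom

lemma ev_comp {L M N : GrMod k n} (f : L ⟶ M) (g : M ⟶ N) (a : Deg n) (x : L.obj a) :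
    ev (f ≫ g) a x = ev g a (ev f a x) := rfl

lemma ev_id (M : GrMod k n) (a : Deg n) (x : M.obj a) : ev (𝟙 M) a x = x := rfl

lemma ev_zero (M N : GrMod k n) (a : Deg n) (x : M.obj a) : ev (0 : M ⟶ N) a x = 0 := rfl

lemma ev_add {M N : GrMod k n} (f g : M ⟶ N) (a : Deg n) (x : M.obj a) :
    ev (f + g) a x = ev f a x + ev g a x := rfl

lemma ev_sub {M N : GrMod k n} (f g : M ⟶ N) (a : Deg n) (x : M.obj a) :
    ev (f - g) a x = ev f a x - ev g a x := by
  rw [eq_sub_iff_add_eq, ← ev_add, sub_add_cancel]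

lemma ev_neg {M N : GrMod k n} (f : M ⟶ N) (a : Deg n) (x : M.obj a) :
    ev (-f) a x = -ev f a x := by
  rw [eq_neg_iff_add_eq_zero, ← ev_add, neg_add_cancel, ev_zero]

lemma ev_sum {J : Type*} (s : Finset J) {M N : GrMod k n} (f : J → (M ⟶ N)) (a : Deg n)
    (x : M.obj a) : ev (∑ j ∈ s, f j) a x = ∑ j ∈ s, ev (f j) a x := by
  classical
  induction s using Finset.induction_on with
  | empty => simp [ev_zero]
  | insert j s hj ih => rw [Finset.sum_insert hj, Finset.sum_insert hj, ev_add, ih]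

lemma hom_ext_ev {M N : GrMod k n} {f g : M ⟶ N} (h : ∀ a x, ev f a x = ev g a x) : f = g := by
  ext a : 2
  exact ModuleCat.hom_ext (LinearMap.ext fun x => h a x)

lemma ev_mulMap {M N : GrMod k n} (f : M ⟶ N) {a b : Deg n} (h : a ≤ b) (y : M.obj a) :
    ev f b (mulMap M h y) = mulMap N h (ev f a y) := app_mulMap f h y

/-- A morphism of graded modules from its components. -/
def homOfLinear {M N : GrMod k n} (f : ∀ a, M.obj a →ₗ[k] N.obj a)
    (hf : ∀ {a b : Deg n} (h : a ≤ b) (y : M.obj a), f b (mulMap M h y) = mulMap N h (f a y)) :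
    M ⟶ N where
  app a := ModuleCat.ofHom (f a)
  naturality _ _ g := ModuleCat.hom_ext (LinearMap.ext fun y => hf (leOfHom g) y)

lemma isZero_iff_subsingleton (M : GrMod k n) : IsZero M ↔ ∀ a, Subsingleton (M.obj a) := by
  rw [Functor.isZero_iff]
  exact forall_congr' fun a => ModuleCat.isZero_iff_subsingleton

lemma isZero_iff_eq_zero (M : GrMod k n) : IsZero M ↔ ∀ a (y : M.obj a), y = 0 := by
  rw [isZero_iff_subsingleton]
  exact forall_congr' fun a => subsingleton_iff_forall_eq 0

lemma mono_iff_ev {M N : GrMod k n} (f : M ⟶ N) : Mono f ↔ ∀ a, Function.Injective (ev f a) := by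
  rw [NatTrans.mono_iff_mono_app]
  exact forall_congr' fun a => ModuleCat.mono_iff_injective _

lemma epi_iff_ev {M N : GrMod k n} (f : M ⟶ N) : Epi f ↔ ∀ a, Function.Surjective (ev f a) := by
  rw [NatTrans.epi_iff_epi_app]
  exact forall_congr' fun a => ModuleCat.epi_iff_surjective _

lemma isIso_iff_ev {M N : GrMod k n} (f : M ⟶ N) :
    IsIso f ↔ ∀ a, Function.Bijective (ev f a) := by
  rw [NatTrans.isIso_iff_isIso_app]
  exact forall_congr' fun a => ConcreteCategory.isIso_iff_bijective _

/-- Evaluation in degree `a`. -/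
abbrev evFunctor (k : Type u) [Field k] (a : Deg n) : GrMod k n ⥤ ModuleCat.{u} k :=
  (evaluation (Deg n) (ModuleCat.{u} k)).obj a

/-- Evaluation in a degree is exact, so it commutes with homology, and a functor to vector spaces is
zero when all its values are. -/
lemma exact_iff_ev (S : ShortComplex (GrMod k n)) :
    S.Exact ↔ ∀ a (y : S.X₂.obj a), ev S.g a y = 0 → ∃ x, ev S.f a x = y := by
  rw [ShortComplex.exact_iff_isZero_homology, Functor.isZero_iff]
  refine forall_congr' fun a => (S.mapHomologyIso (evFunctor k a)).isZero_iff.symm.trans ?_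
  rw [← ShortComplex.exact_iff_isZero_homology, ShortComplex.moduleCat_exact_iff]
  exact Iff.rfl

lemma shortExact_of_ev (S : ShortComplex (GrMod k n)) (h₁ : ∀ a, Function.Injective (ev S.f a))
    (h₂ : ∀ a (y : S.X₂.obj a), ev S.g a y = 0 → ∃ x, ev S.f a x = y)
    (h₃ : ∀ a, Function.Surjective (ev S.g a)) : S.ShortExact where
  exact := (exact_iff_ev S).2 h₂
  mono_f := (mono_iff_ev _).2 h₁
  epi_g := (epi_iff_ev _).2 h₃

/-! ### Quasi-isomorphisms in terms of elements -/

section QuasiIso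

variable {K L : CochainComplex (GrMod k n) ℤ}

lemma ev_d_d (K : CochainComplex (GrMod k n) ℤ) (i j l : ℤ) (a : Deg n) (x : (K.X i).obj a) :
    ev (K.d j l) a (ev (K.d i j) a x) = 0 := by
  rw [← ev_comp, K.d_comp_d, ev_zero]

lemma ev_comm (f : K ⟶ L) (i j : ℤ) (a : Deg n) (x : (K.X i).obj a) :
    ev (f.f j) a (ev (K.d i j) a x) = ev (L.d i j) a (ev (f.f i) a x) := by
  rw [← ev_comp, ← ev_comp, f.comm]

/-- Isomorphisms of functors are detected objectwise, and evaluation commutes with homology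
naturally. -/
lemma quasiIso_iff_quasiIso_ev (f : K ⟶ L) :
    QuasiIso f ↔ ∀ a, QuasiIso (((evFunctor k a).mapHomologicalComplex _).map f) := by
  constructor
  · intro h a
    infer_instance
  · intro h
    refine (quasiIso_iff _).2 fun i => ?_
    rw [quasiIsoAt_iff, ShortComplex.quasiIso_iff, NatTrans.isIso_iff_isIso_app]
    intro a
    have h1 := (quasiIso_iff _).1 (h a) i
    rw [quasiIsoAt_iff, ShortComplex.quasiIso_iff] at h1
    have h2 := ShortComplex.mapHomologyIso_hom_naturality (F := evFunctor k a)
      ((HomologicalComplex.shortComplexFunctor (GrMod k n) _ i).map f)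
    have h3 := (Iso.inv_comp_eq _).2 h2
    have h4 : IsIso (ShortComplex.homologyMap ((evFunctor k a).mapShortComplex.map
        ((HomologicalComplex.shortComplexFunctor (GrMod k n) (ComplexShape.up ℤ) i).map f))) := h1
    have h5 : IsIso ((evFunctor k a).map (ShortComplex.homologyMap
        ((HomologicalComplex.shortComplexFunctor (GrMod k n) (ComplexShape.up ℤ) i).map f))) := by
      rw [← h3]
      exact @IsIso.comp_isIso _ _ _ _ _ _ _ inferInstance
        (@IsIso.comp_isIso _ _ _ _ _ _ _ h4 inferInstance)
    exact h5

/-- Up to signs, the right side says that every cocycle `(z, w)` of the mapping cone is a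
coboundary. Injectivity on cohomology in degree `j` writes `z` as a coboundary; the resulting error
in `w` is a cocycle, which surjectivity in degree `i` corrects. -/
lemma quasiIso_iff_exists_moduleCat {A B : CochainComplex (ModuleCat.{u} k) ℤ} (f : A ⟶ B) :
    QuasiIso f ↔ ∀ (h i j l : ℤ), h + 1 = i → i + 1 = j → j + 1 = l →
      ∀ (z : A.X j) (w : B.X i), (A.d j l).hom z = 0 → (f.f j).hom z = (B.d i j).hom w →
        ∃ z' w', z = (A.d i j).hom z' ∧ w = (f.f i).hom z' + (B.d h i).hom w' := by
  have lift : ∀ {X A' : ModuleCat.{u} k} (y : X) (π : A' ⟶ ModuleCat.of k (ULift.{u} k)),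
      Epi π → ∃ t : A', π.hom t = ULift.up 1 :=
    fun _ π hπ => (ModuleCat.epi_iff_surjective π).1 hπ _
  have prev' : ∀ i j : ℤ, i + 1 = j → (ComplexShape.up ℤ).prev j = i := by
    rintro i j rfl; simp
  have next' : ∀ i j : ℤ, i + 1 = j → (ComplexShape.up ℤ).next i = j := by
    rintro i j rfl; simp
  -- The criteria up to refinements speak of morphisms; an element is a morphism from the line `k`,
  -- lifted to the right universe.
  let el {X : ModuleCat.{u} k} (x : X) : ModuleCat.of k (ULift.{u} k) ⟶ X :=
    ModuleCat.ofHom ((LinearMap.toSpanSingleton k X x).comp ULift.moduleEquiv.toLinearMap)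
  have hel : ∀ {X Y : ModuleCat.{u} k} (x : X) (g : X ⟶ Y), el x ≫ g = el (g.hom x) := by
    intro X Y x g
    ext
    simp [el]
  have hel1 : ∀ {X : ModuleCat.{u} k} (x : X), (el x).hom (ULift.up 1) = x := by
    intro X x
    simp [el]
  have hel0 : ∀ {X : ModuleCat.{u} k}, el (0 : X) = 0 := by
    intro X
    ext
    simp [el]
  constructor
  · intro hf h i j l hi hj hl z w hz hw
    have hmono : Mono (HomologicalComplex.homologyMap f j) := by
      have := (quasiIsoAt_iff_isIso_homologyMap f j).1 ((quasiIso_iff _).1 hf j)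
      infer_instance
    have hepi : Epi (HomologicalComplex.homologyMap f i) := by
      have := (quasiIsoAt_iff_isIso_homologyMap f i).1 ((quasiIso_iff _).1 hf i)
      infer_instance
    rw [HomologicalComplex.mono_homologyMap_iff_up_to_refinements f i j l (prev' _ _ hj)
      (next' _ _ hl)] at hmono
    rw [HomologicalComplex.epi_homologyMap_iff_up_to_refinements f h i j (prev' _ _ hi)
      (next' _ _ hj)] at hepi
    obtain ⟨A', π, hπ, x₁, hx₁⟩ := hmono (el z) (by rw [hel, hz, hel0]) (el w)
      (by rw [hel, hel, hw])
    obtain ⟨t, ht⟩ := lift z π hπ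
    have h1 : z = (A.d i j).hom (x₁.hom t) := by
      have := congrArg (fun g => g.hom t) hx₁
      simpa [ht, hel1] using this
    have h2 : (B.d i j).hom (w - (f.f i).hom (x₁.hom t)) = 0 := by
      rw [map_sub, ← hw, sub_eq_zero, h1]
      exact congrArg (fun g => g.hom (x₁.hom t)) (f.comm i j).symm
    obtain ⟨A'', π', hπ', x₂, hx₂, y₁, hy₁⟩ :=
      hepi (el (w - (f.f i).hom (x₁.hom t))) (by rw [hel, h2, hel0])
    obtain ⟨t', ht'⟩ := lift z π' hπ'
    refine ⟨x₁.hom t + x₂.hom t', y₁.hom t', ?_, ?_⟩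
    · have := congrArg (fun g => g.hom t') hx₂
      rw [map_add, ← h1]
      have h3 : (A.d i j).hom (x₂.hom t') = 0 := this
      rw [h3, add_zero]
    · have := congrArg (fun g => g.hom t') hy₁
      have h3 : w - (f.f i).hom (x₁.hom t) =
          (f.f i).hom (x₂.hom t') + (B.d h i).hom (y₁.hom t') := by
        simpa [ht', hel1] using this
      rw [map_add, add_assoc, ← h3]
      abel
  · intro hf
    refine (quasiIso_iff _).2 fun j => ?_
    rw [quasiIsoAt_iff_isIso_homologyMap]
    have hmono : Mono (HomologicalComplex.homologyMap f j) := by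
      rw [HomologicalComplex.mono_homologyMap_iff_up_to_refinements f (j - 1) j (j + 1)
        (prev' _ _ (by ring)) (next' _ _ rfl)]
      intro X x₂ hx₂ y₁ hy₁
      have key : ∀ t : X, ∃ z', x₂.hom t = (A.d (j - 1) j).hom z' := fun t => by
        obtain ⟨z', w', h1, -⟩ := hf (j - 2) (j - 1) j (j + 1) (by ring) (by ring) rfl
          (x₂.hom t) (y₁.hom t) (congrArg (fun g => g.hom t) hx₂)
          (congrArg (fun g => g.hom t) hy₁)
        exact ⟨z', h1⟩
      -- Over a field, pointwise choices on a basis extend linearly, so the trivial refinement `𝟙 X`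
      -- suffices.
      let b := Module.Basis.ofVectorSpace k X
      choose φ hφ using key
      refine ⟨X, 𝟙 X, inferInstance, ModuleCat.ofHom (b.constr k fun i => φ (b i)), ?_⟩
      rw [Category.id_comp]
      refine ModuleCat.hom_ext (b.ext fun i => ?_)
      simp [hφ]
    have hepi : Epi (HomologicalComplex.homologyMap f j) := by
      rw [HomologicalComplex.epi_homologyMap_iff_up_to_refinements f (j - 1) j (j + 1)
        (prev' _ _ (by ring)) (next' _ _ rfl)]
      intro X y₂ hy₂
      have key : ∀ t : X, ∃ z' w', (A.d j (j + 1)).hom z' = 0 ∧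
          y₂.hom t = (f.f j).hom z' + (B.d (j - 1) j).hom w' := fun t => by
        -- With `z = 0`, the condition says that a cocycle of `B` is the image of a cocycle of `A`
        -- up to a coboundary.
        obtain ⟨z', w', h1, h2⟩ := hf (j - 1) j (j + 1) (j + 2) (by ring) rfl (by ring)
          0 (y₂.hom t) (map_zero _) (by
            rw [map_zero]
            exact (congrArg (fun g => g.hom t) hy₂).symm)
        exact ⟨z', w', h1.symm, h2⟩
      let b := Module.Basis.ofVectorSpace k X
      choose φ ψ h0 hφ using key
      refine ⟨X, 𝟙 X, inferInstance, ModuleCat.ofHom (b.constr k fun i => φ (b i)), ?_,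
        ModuleCat.ofHom (b.constr k fun i => ψ (b i)), ?_⟩
      · refine ModuleCat.hom_ext (b.ext fun i => ?_)
        simp [h0]
      · rw [Category.id_comp]
        refine ModuleCat.hom_ext (b.ext fun i => ?_)
        simp [hφ]
    exact isIso_of_mono_of_epi _

/-- A morphism is a quasi-isomorphism if and only if its mapping cone has no cohomology, in terms
of elements. -/
lemma quasiIso_iff_exists (f : K ⟶ L) :
    QuasiIso f ↔ ∀ (h i j l : ℤ), h + 1 = i → i + 1 = j → j + 1 = l →
      ∀ (a : Deg n) (z : (K.X j).obj a) (w : (L.X i).obj a), ev (K.d j l) a z = 0 →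
        ev (f.f j) a z = ev (L.d i j) a w →
        ∃ z' w', z = ev (K.d i j) a z' ∧ w = ev (f.f i) a z' + ev (L.d h i) a w' := by
  rw [quasiIso_iff_quasiIso_ev]
  constructor
  · intro hf h i j l hi hj hl a
    exact (quasiIso_iff_exists_moduleCat _).1 (hf a) h i j l hi hj hl
  · intro hf a
    exact (quasiIso_iff_exists_moduleCat _).2 fun h i j l hi hj hl => hf h i j l hi hj hl a

end QuasiIso

/-! ## Cohomological rank functions on complexes -/

section RankFunctions

open Pretriangulated

/-- The properties of the dimensions of the groups `H^m(X)`, for a cohomological functor `H`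
on complexes. -/
structure IsCohomologicalRank {C : Type w} [Category.{v} C] [Abelian C]
    (r : CochainComplex C ℤ → ℤ → Cardinal.{w'}) : Prop where
  eq_zero : ∀ (S : ShortComplex (CochainComplex C ℤ)), S.ShortExact → ∀ m,
    r S.X₁ m = 0 → r S.X₃ m = 0 → r S.X₂ m = 0
  eq₂₃ : ∀ (S : ShortComplex (CochainComplex C ℤ)), S.ShortExact → (∀ m, r S.X₁ m = 0) →
    ∀ m, r S.X₂ m = r S.X₃ m
  eq₁₂ : ∀ (S : ShortComplex (CochainComplex C ℤ)), S.ShortExact → (∀ m, r S.X₃ m = 0) →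
    ∀ m, r S.X₁ m = r S.X₂ m
  sum : ∀ {J : Type} [Fintype J] (X : CochainComplex C ℤ) (Y : J → CochainComplex C ℤ)
    (i : ∀ j, Y j ⟶ X) (p : ∀ j, X ⟶ Y j), (∀ j, i j ≫ p j = 𝟙 _) →
    (∀ j l, j ≠ l → i j ≫ p l = 0) → ∑ j, p j ≫ i j = 𝟙 X → ∀ m, r X m = ∑ j, r (Y j) m
  quasiIso : ∀ {X Y : CochainComplex C ℤ} (f : X ⟶ Y), QuasiIso f → ∀ m, r X m = r Y m

/-! ### Long exact sequences of Hom in a triangulated category -/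

section Triangulated

variable {D : Type w} [Category.{v} D] [Preadditive D] [HasZeroObject D] [HasShift D ℤ]
  [∀ n : ℤ, (shiftFunctor D n).Additive] [Pretriangulated D]

/-- The morphisms of the shifted triangle carry the sign `(-1)^m`, which is absorbed into `g`. -/
lemma coyoneda_exact₂_shift (A : D) (T : Triangle D) (hT : T ∈ distTriang D) (m : ℤ)
    (f : A ⟶ T.obj₂⟦m⟧) (hf : f ≫ T.mor₂⟦m⟧' = 0) : ∃ g : A ⟶ T.obj₁⟦m⟧, f = g ≫ T.mor₁⟦m⟧' := by
  obtain ⟨g, hg⟩ := Triangle.coyoneda_exact₂ _ (Triangle.shift_distinguished T hT m) f (by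
    change f ≫ (m.negOnePow • T.mor₂⟦m⟧') = 0
    rw [Linear.comp_units_smul, hf, smul_zero])
  refine ⟨m.negOnePow • g, hg.trans ?_⟩
  exact (Linear.comp_units_smul (C := D) (X := A) (Y := T.obj₁⟦m⟧) g m.negOnePow
    (T.mor₁⟦m⟧')).trans (Linear.units_smul_comp (C := D) (Y := T.obj₁⟦m⟧) m.negOnePow g _).symm

omit [Preadditive D] [HasZeroObject D] [∀ n : ℤ, (shiftFunctor D n).Additive] [Pretriangulated D] in
lemma subsingleton_hom_shift_iff (A B : D) (a b c : ℤ) (h : a + b = c) :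
    Subsingleton (A ⟶ B⟦a⟧⟦b⟧) ↔ Subsingleton (A ⟶ B⟦c⟧) :=
  (Iso.homToEquiv ((shiftFunctorAdd' D a b c h).app B).symm (Z := A)).subsingleton_congr

lemma coyoneda_subsingleton₂ (A : D) (T : Triangle D) (hT : T ∈ distTriang D) (m : ℤ)
    (h₁ : Subsingleton (A ⟶ T.obj₁⟦m⟧)) (h₃ : Subsingleton (A ⟶ T.obj₃⟦m⟧)) :
    Subsingleton (A ⟶ T.obj₂⟦m⟧) := by
  refine subsingleton_of_forall_eq 0 fun f => ?_
  obtain ⟨g, rfl⟩ := coyoneda_exact₂_shift A T hT m f (Subsingleton.elim _ _)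
  rw [Subsingleton.elim g 0, zero_comp]

/-- Vanishing for the first object in degree `m` gives injectivity; vanishing in degree `m + 1`,
through the rotated triangle, gives surjectivity. -/
lemma coyoneda_bijective₂₃ (A : D) (T : Triangle D) (hT : T ∈ distTriang D)
    (h₁ : ∀ m : ℤ, Subsingleton (A ⟶ T.obj₁⟦m⟧)) (m : ℤ) :
    Function.Bijective (fun f : A ⟶ T.obj₂⟦m⟧ => f ≫ T.mor₂⟦m⟧') := by
  constructor
  · intro f g hfg
    rw [← sub_eq_zero]
    obtain ⟨h, hh⟩ := coyoneda_exact₂_shift A T hT m (f - g) (by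
      rw [Preadditive.sub_comp, sub_eq_zero]
      exact hfg)
    rw [hh, Subsingleton.elim h 0, zero_comp]
  · intro f
    have := (subsingleton_hom_shift_iff A T.obj₁ 1 m (1 + m) rfl).2 (h₁ _)
    obtain ⟨g, hg⟩ := coyoneda_exact₂_shift A T.rotate (rot_of_distTriang T hT) m f
      (Subsingleton.elim (α := A ⟶ T.obj₁⟦(1 : ℤ)⟧⟦m⟧) _ _)
    exact ⟨g, hg.symm⟩

lemma coyoneda_bijective₁₂ (A : D) (T : Triangle D) (hT : T ∈ distTriang D)
    (h₃ : ∀ m : ℤ, Subsingleton (A ⟶ T.obj₃⟦m⟧)) (m : ℤ) :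
    Function.Bijective (fun f : A ⟶ T.obj₁⟦m⟧ => f ≫ T.mor₁⟦m⟧') := by
  refine coyoneda_bijective₂₃ A T.invRotate (inv_rot_of_distTriang T hT) (fun l => ?_) m
  exact (subsingleton_hom_shift_iff A T.obj₃ (-1) l (-1 + l) rfl).2 (h₃ _)

lemma yoneda_subsingleton₂ (B : D) (T : Triangle D) (hT : T ∈ distTriang D)
    (h₁ : Subsingleton (T.obj₁ ⟶ B)) (h₃ : Subsingleton (T.obj₃ ⟶ B)) :
    Subsingleton (T.obj₂ ⟶ B) := by
  refine subsingleton_of_forall_eq 0 fun f => ?_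
  obtain ⟨g, rfl⟩ := Triangle.yoneda_exact₂ T hT f (Subsingleton.elim _ _)
  rw [Subsingleton.elim g 0, comp_zero]

omit [HasZeroObject D] [Pretriangulated D] in
lemma subsingleton_shift_hom (A B : D) (a : ℤ) (h : ∀ m : ℤ, Subsingleton (A ⟶ B⟦m⟧)) (l : ℤ) :
    Subsingleton (A⟦a⟧ ⟶ B⟦l⟧) := by
  have e : B⟦l⟧ ≅ B⟦l - a⟧⟦a⟧ := (shiftFunctorAdd' D (l - a) a l (by ring)).app B
  refine subsingleton_of_forall_eq 0 fun f => ?_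
  obtain ⟨g, hg⟩ := (shiftFunctor D a).map_surjective (f ≫ e.hom)
  have := h (l - a)
  rw [Subsingleton.elim g 0, Functor.map_zero] at hg
  rw [← cancel_mono e.hom, ← hg, zero_comp]

lemma yoneda_bijective₁₂ (B : D) (T : Triangle D) (hT : T ∈ distTriang D)
    (h₃ : ∀ m : ℤ, Subsingleton (T.obj₃ ⟶ B⟦m⟧)) (m : ℤ) :
    Function.Bijective (fun f : T.obj₂ ⟶ B⟦m⟧ => T.mor₁ ≫ f) := by
  constructor
  · intro f g hfg
    rw [← sub_eq_zero]
    obtain ⟨h, hh⟩ := Triangle.yoneda_exact₂ T hT (f - g) (by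
      rw [Preadditive.comp_sub, sub_eq_zero]
      exact hfg)
    rw [hh, Subsingleton.elim h 0, comp_zero]
  · intro f
    have := subsingleton_shift_hom T.obj₃ B (-1) h₃ m
    obtain ⟨g, hg⟩ := Triangle.yoneda_exact₂ T.invRotate (inv_rot_of_distTriang T hT) f
      (Subsingleton.elim (α := T.obj₃⟦(-1 : ℤ)⟧ ⟶ B⟦m⟧) _ _)
    exact ⟨g, hg.symm⟩

lemma yoneda_bijective₂₃ (B : D) (T : Triangle D) (hT : T ∈ distTriang D)
    (h₁ : ∀ m : ℤ, Subsingleton (T.obj₁ ⟶ B⟦m⟧)) (m : ℤ) :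
    Function.Bijective (fun f : T.obj₃ ⟶ B⟦m⟧ => T.mor₂ ≫ f) :=
  yoneda_bijective₁₂ B T.rotate (rot_of_distTriang T hT)
    (fun l => subsingleton_shift_hom T.obj₁ B 1 h₁ l) m

end Triangulated

/-! ### Dimensions of Hom groups as cohomological ranks -/

section Rank

variable {R K : Type*} [CommRing R] [Field K] [Algebra R K]

/-- As `R → K` is onto, `R`-linear maps between `K`-spaces are `K`-linear. So one can argue in an
`R`-linear category, with `R` local, and measure dimensions over the residue field. -/
lemma rank_eq_of_linearEquiv_restrict (hs : Function.Surjective (algebraMap R K))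
    {V W : Type w'} [AddCommGroup V] [AddCommGroup W] [Module K V] [Module K W] [Module R V]
    [Module R W] [IsScalarTower R K V] [IsScalarTower R K W] (e : V ≃ₗ[R] W) :
    Module.rank K V = Module.rank K W :=
  (LinearEquiv.extendScalarsOfSurjective hs e).rank_eq

lemma cardinal_sum_eq_finset_sum {J : Type} [Fintype J] (f : J → Cardinal.{w'}) :
    Cardinal.sum f = ∑ j, f j := by
  revert f
  refine Fintype.induction_empty_option (P := fun J _ => ∀ f : J → Cardinal.{w'},
    Cardinal.sum f = ∑ j, f j) ?_ ?_ ?_ J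
  · intro α β _ e h f
    let _ := Fintype.ofEquiv β e.symm
    rw [← Equiv.sum_comp e f, ← h]
    exact (Cardinal.mk_congr (Equiv.sigmaCongrLeft (β := fun b => (f b).out) e)).symm
  · intro f
    rw [Finset.univ_eq_empty, Finset.sum_empty]
    exact Cardinal.mk_eq_zero _
  · intro α _ h f
    rw [Fintype.sum_option, ← h]
    refine (Cardinal.mk_congr
      { toFun := fun x => match x with
          | ⟨none, y⟩ => Sum.inl y
          | ⟨some a, y⟩ => Sum.inr ⟨a, y⟩
        invFun := Sum.elim (fun y => ⟨none, y⟩) (fun x => ⟨some x.1, x.2⟩)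
        left_inv := by rintro ⟨_ | a, y⟩ <;> rfl
        right_inv := by rintro (y | y) <;> rfl } :
        Cardinal.sum f = Cardinal.mk ((f none).out ⊕ Σ a, (f (some a)).out)).trans ?_
    rw [Cardinal.mk_sum, Cardinal.mk_out, Cardinal.lift_id, Cardinal.lift_id]
    rfl

lemma rank_eq_sum_of_linearEquiv_restrict (hs : Function.Surjective (algebraMap R K))
    {J : Type} [Fintype J]
    {V : Type w'} {W : J → Type w'} [AddCommGroup V] [∀ j, AddCommGroup (W j)] [Module K V]
    [∀ j, Module K (W j)] [Module R V] [∀ j, Module R (W j)] [IsScalarTower R K V]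
    [∀ j, IsScalarTower R K (W j)] (e : V ≃ₗ[R] ∀ j, W j) :
    Module.rank K V = ∑ j, Module.rank K (W j) := by
  have := (LinearEquiv.extendScalarsOfSurjective hs e).lift_rank_eq
  rw [rank_pi, Cardinal.lift_id, cardinal_sum_eq_finset_sum] at this
  simpa using this

variable {C : Type*} [Category* C] [Abelian C]
  {D : Type w} [Category.{v} D] [Preadditive D] [HasZeroObject D] [HasShift D ℤ]
  [∀ n : ℤ, (shiftFunctor D n).Additive] [Pretriangulated D] [Linear R D]
  (Φ : CochainComplex C ℤ ⥤ D) [Φ.Additive]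
  (V : CochainComplex C ℤ → ℤ → Type w') [∀ X m, AddCommGroup (V X m)]
  [∀ X m, Module K (V X m)] [∀ X m, Module R (V X m)] [∀ X m, IsScalarTower R K (V X m)]

/-- The dimensions of `Hom(A, Φ(X)[m])`, where `Φ` maps short exact sequences to distinguished
triangles. -/
theorem isCohomologicalRank_coyoneda
    (hΦ : ∀ S : ShortComplex (CochainComplex C ℤ), S.ShortExact →
      ∃ δ : Φ.obj S.X₃ ⟶ (Φ.obj S.X₁)⟦(1 : ℤ)⟧,
        Triangle.mk (Φ.map S.f) (Φ.map S.g) δ ∈ distTriang D)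
    (hq : ∀ {X Y : CochainComplex C ℤ} (f : X ⟶ Y), QuasiIso f → IsIso (Φ.map f))
    (hs : Function.Surjective (algebraMap R K))
    (A : D)
    (e : ∀ X m, V X m ≃ₗ[R] (A ⟶ (Φ.obj X)⟦m⟧)) :
    IsCohomologicalRank fun X m => Module.rank K (V X m) := by
  have h0 : ∀ X m, Module.rank K (V X m) = 0 ↔ Subsingleton (A ⟶ (Φ.obj X)⟦m⟧) := fun X m => by
    rw [rank_zero_iff]
    exact (e X m).toEquiv.subsingleton_congr
  have hb : ∀ {X Y : CochainComplex C ℤ} (f : X ⟶ Y) (m : ℤ),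
      Function.Bijective (fun g : A ⟶ (Φ.obj X)⟦m⟧ => g ≫ (Φ.map f)⟦m⟧') →
      Module.rank K (V X m) = Module.rank K (V Y m) := fun {X Y} f m hf =>
    rank_eq_of_linearEquiv_restrict hs ((e X m).trans
      ((LinearEquiv.ofBijective (Linear.rightComp R A ((Φ.map f)⟦m⟧')) hf).trans (e Y m).symm))
  refine ⟨?_, ?_, ?_, ?_, ?_⟩
  · intro S hS m h₁ h₃
    obtain ⟨δ, hT⟩ := hΦ S hS
    exact (h0 _ _).2 (coyoneda_subsingleton₂ A _ hT m ((h0 _ _).1 h₁) ((h0 _ _).1 h₃))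
  · intro S hS h₁ m
    obtain ⟨δ, hT⟩ := hΦ S hS
    exact hb S.g m (coyoneda_bijective₂₃ A _ hT (fun l => (h0 _ _).1 (h₁ l)) m)
  · intro S hS h₃ m
    obtain ⟨δ, hT⟩ := hΦ S hS
    exact hb S.f m (coyoneda_bijective₁₂ A _ hT (fun l => (h0 _ _).1 (h₃ l)) m)
  · intro J _ X Y i p hip hip0 hsum m
    let F := Φ ⋙ shiftFunctor D m
    have h1 : ∀ j, F.map (i j) ≫ F.map (p j) = 𝟙 _ := fun j => by
      rw [← F.map_comp, hip, F.map_id]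
    have h2 : ∀ j l, j ≠ l → F.map (i j) ≫ F.map (p l) = 0 := fun j l hjl => by
      rw [← F.map_comp, hip0 j l hjl, F.map_zero]
    have h3 : ∑ j, F.map (p j) ≫ F.map (i j) = 𝟙 _ := by
      rw [← F.map_id, ← hsum, F.map_sum]
      simp only [F.map_comp]
    let E : (A ⟶ F.obj X) ≃ₗ[R] ∀ j, (A ⟶ F.obj (Y j)) :=
      LinearEquiv.ofLinearMap (LinearMap.pi fun j => Linear.rightComp R A (F.map (p j)))
        (∑ j, (Linear.rightComp R A (F.map (i j))).comp (LinearMap.proj j))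
        (by
          classical
          refine LinearMap.ext fun g => funext fun l => ?_
          simp only [LinearMap.comp_apply, LinearMap.pi_apply, LinearMap.sum_apply,
            LinearMap.proj_apply, Linear.rightComp_apply, LinearMap.id_apply,
            Preadditive.sum_comp, Category.assoc]
          rw [Finset.sum_eq_single l]
          · rw [h1, Category.comp_id]
          · intro j _ hj
            rw [h2 j l hj, comp_zero]
          · simp)
        (by
          refine LinearMap.ext fun g => ?_
          simp only [LinearMap.comp_apply, LinearMap.pi_apply, LinearMap.sum_apply,
            LinearMap.proj_apply, Linear.rightComp_apply, LinearMap.id_apply, Category.assoc]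
          rw [← Preadditive.comp_sum, h3, Category.comp_id])
    exact rank_eq_sum_of_linearEquiv_restrict hs ((e X m).trans
      (E.trans (LinearEquiv.piCongrRight fun j => (e (Y j) m).symm)))
  · intro X Y f hf m
    have := hq f hf
    refine hb f m ⟨fun g h hgh => (cancel_mono ((Φ.map f)⟦m⟧')).1 hgh, fun g =>
      ⟨g ≫ inv ((Φ.map f)⟦m⟧'), ?_⟩⟩
    simp

/-- The dimensions of `Hom(Φ(X), B[c - m])`, where `Φ` maps short exact sequences to distinguished
triangles. -/
theorem isCohomologicalRank_yoneda
    (hΦ : ∀ S : ShortComplex (CochainComplex C ℤ), S.ShortExact →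
      ∃ δ : Φ.obj S.X₃ ⟶ (Φ.obj S.X₁)⟦(1 : ℤ)⟧,
        Triangle.mk (Φ.map S.f) (Φ.map S.g) δ ∈ distTriang D)
    (hq : ∀ {X Y : CochainComplex C ℤ} (f : X ⟶ Y), QuasiIso f → IsIso (Φ.map f))
    (hs : Function.Surjective (algebraMap R K))
    (B : D) (c : ℤ)
    (e : ∀ X m, V X m ≃ₗ[R] (Φ.obj X ⟶ B⟦c - m⟧)) :
    IsCohomologicalRank fun X m => Module.rank K (V X m) := by
  have h0 : ∀ X m, Module.rank K (V X m) = 0 ↔ Subsingleton (Φ.obj X ⟶ B⟦c - m⟧) := fun X m => by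
    rw [rank_zero_iff]
    exact (e X m).toEquiv.subsingleton_congr
  -- As `m` runs through the integers, `c - m` reaches every shift.
  have h0' : ∀ X, (∀ m, Module.rank K (V X m) = 0) → ∀ m : ℤ, Subsingleton (Φ.obj X ⟶ B⟦m⟧) :=
    fun X hX m => by
      have := (h0 X (c - m)).1 (hX _)
      rwa [sub_sub_cancel] at this
  have hb : ∀ {X Y : CochainComplex C ℤ} (f : X ⟶ Y) (m : ℤ),
      Function.Bijective (fun g : Φ.obj Y ⟶ B⟦c - m⟧ => Φ.map f ≫ g) →
      Module.rank K (V X m) = Module.rank K (V Y m) := fun {X Y} f m hf =>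
    rank_eq_of_linearEquiv_restrict hs (((e Y m).trans
      ((LinearEquiv.ofBijective (Linear.leftComp R (B⟦c - m⟧) (Φ.map f)) hf).trans
        (e X m).symm)).symm)
  refine ⟨?_, ?_, ?_, ?_, ?_⟩
  · intro S hS m h₁ h₃
    obtain ⟨δ, hT⟩ := hΦ S hS
    exact (h0 _ _).2 (yoneda_subsingleton₂ _ _ hT ((h0 _ _).1 h₁) ((h0 _ _).1 h₃))
  · intro S hS h₁ m
    obtain ⟨δ, hT⟩ := hΦ S hS
    exact hb S.g m (yoneda_bijective₂₃ B _ hT (h0' _ h₁) _)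
  · intro S hS h₃ m
    obtain ⟨δ, hT⟩ := hΦ S hS
    exact hb S.f m (yoneda_bijective₁₂ B _ hT (h0' _ h₃) _)
  · intro J _ X Y i p hip hip0 hsum m
    have h1 : ∀ j, Φ.map (i j) ≫ Φ.map (p j) = 𝟙 _ := fun j => by
      rw [← Φ.map_comp, hip, Φ.map_id]
    have h2 : ∀ j l, j ≠ l → Φ.map (i j) ≫ Φ.map (p l) = 0 := fun j l hjl => by
      rw [← Φ.map_comp, hip0 j l hjl, Φ.map_zero]
    have h3 : ∑ j, Φ.map (p j) ≫ Φ.map (i j) = 𝟙 _ := by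
      rw [← Φ.map_id, ← hsum, Φ.map_sum]
      simp only [Φ.map_comp]
    let E : (Φ.obj X ⟶ B⟦c - m⟧) ≃ₗ[R] ∀ j, (Φ.obj (Y j) ⟶ B⟦c - m⟧) :=
      LinearEquiv.ofLinearMap (LinearMap.pi fun j => Linear.leftComp R _ (Φ.map (i j)))
        (∑ j, (Linear.leftComp R _ (Φ.map (p j))).comp (LinearMap.proj j))
        (by
          classical
          refine LinearMap.ext fun g => funext fun l => ?_
          simp only [LinearMap.comp_apply, LinearMap.pi_apply, LinearMap.sum_apply,
            LinearMap.proj_apply, Linear.leftComp_apply, LinearMap.id_apply,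
            Preadditive.comp_sum, ← Category.assoc]
          rw [Finset.sum_eq_single l]
          · rw [h1, Category.id_comp]
          · intro j _ hj
            rw [h2 l j hj.symm, zero_comp]
          · simp)
        (by
          refine LinearMap.ext fun g => ?_
          simp only [LinearMap.comp_apply, LinearMap.pi_apply, LinearMap.sum_apply,
            LinearMap.proj_apply, Linear.leftComp_apply, LinearMap.id_apply, ← Category.assoc]
          rw [← Preadditive.sum_comp, h3, Category.id_comp])
    exact rank_eq_sum_of_linearEquiv_restrict hs ((e X m).trans
      (E.trans (LinearEquiv.piCongrRight fun j => (e (Y j) m).symm)))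
  · intro X Y f hf m
    have := hq f hf
    refine hb f m ⟨fun g h hgh => (cancel_epi (Φ.map f)).1 hgh, fun g =>
      ⟨inv (Φ.map f) ≫ g, ?_⟩⟩
    simp

end Rank

lemma complex_sum_f {C : Type w} [Category.{v} C] [Preadditive C] {J : Type*} (s : Finset J)
    {X Y : CochainComplex C ℤ} (g : J → (X ⟶ Y)) (l : ℤ) :
    (∑ j ∈ s, g j).f l = ∑ j ∈ s, (g j).f l :=
  map_sum (HomologicalComplex.Hom.fAddMonoidHom l) g s

namespace IsCohomologicalRank

variable {C : Type w} [Category.{v} C] [Abelian C]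
  {r : CochainComplex C ℤ → ℤ → Cardinal.{w'}}

lemma of_iso (hr : IsCohomologicalRank r) {X Y : CochainComplex C ℤ} (e : X ≅ Y)
    (m : ℤ) : r X m = r Y m :=
  hr.quasiIso e.hom inferInstance m

/-- A zero complex is the direct sum of the empty family. -/
lemma of_isZero (hr : IsCohomologicalRank r) {X : CochainComplex C ℤ} (h : IsZero X)
    (m : ℤ) : r X m = 0 := by
  have := hr.sum (J := Empty) X (fun _ => X) (fun _ => 𝟙 X) (fun _ => 𝟙 X) (fun j => j.elim)
    (fun j => j.elim) (h.eq_of_src _ _) m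
  simpa using this

/-- Devissage: if `H^m` vanishes on all terms of a bounded complex, then it vanishes on the
complex. -/
lemma eq_zero_of_terms (hr : IsCohomologicalRank r) (m : ℤ) (N : ℕ) : ∀ (X : CochainComplex C ℤ)
    (a : ℤ),
    (∀ i, i < a → IsZero (X.X i)) → (∀ i, a + N ≤ i → IsZero (X.X i)) →
    (∀ i, r ((HomologicalComplex.single C (ComplexShape.up ℤ) i).obj (X.X i)) m = 0) →
    r X m = 0 := by
  induction N with
  | zero =>
    intro X a h1 h2 _
    refine hr.of_isZero ((IsZero.iff_id_eq_zero X).2 ?_) m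
    ext i
    rcases lt_or_ge i a with h | h
    · exact (h1 i h).eq_of_src _ _
    · exact (h2 i (by simpa using h)).eq_of_src _ _
  | succ N ih =>
    intro X a h1 h2 h
    -- The projection onto the lowest term is a chain map because the preceding term is zero. Its
    -- kernel is the brutal truncation, one term shorter.
    let p : X ⟶ (HomologicalComplex.single C (ComplexShape.up ℤ) a).obj (X.X a) :=
      HomologicalComplex.mkHomToSingle (𝟙 _) fun i hi =>
        (h1 i (by simp only [ComplexShape.up_Rel] at hi; lia)).eq_of_src _ _
    have hpa : IsIso (p.f a) := by
      rw [HomologicalComplex.mkHomToSingle_f]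
      infer_instance
    have hp : ∀ i, Epi (p.f i) := fun i => by
      by_cases hi : i = a
      · subst hi
        infer_instance
      · exact ⟨fun _ _ _ => (HomologicalComplex.isZero_single_obj_X
          (ComplexShape.up ℤ) _ _ _ hi).eq_of_src _ _⟩
    have hp' : Epi p := HomologicalComplex.epi_of_epi_f _ hp
    let S := ShortComplex.mk (kernel.ι p) p (kernel.condition p)
    have hS : S.ShortExact :=
      { exact := ShortComplex.exact_of_f_is_kernel _ (kernelIsKernel p) }
    have hSi := (HomologicalComplex.shortExact_iff_degreewise_shortExact S).1 hS
    have hiso : ∀ i, i ≠ a → IsIso ((kernel.ι p).f i) := fun i hi => by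
      have h3 := (hSi i).isIso_f_iff.2 (HomologicalComplex.isZero_single_obj_X
          (ComplexShape.up ℤ) _ _ _ hi)
      exact h3
    have hz : ∀ i, i ≤ a → IsZero ((kernel p).X i) := fun i hi => by
      by_cases hia : i = a
      · subst hia
        exact (hSi i).isIso_g_iff.1 hpa
      · have := hiso i hia
        exact (h1 i (lt_of_le_of_ne hi hia)).of_iso (asIso ((kernel.ι p).f i))
    refine hr.eq_zero S hS m (ih _ (a + 1) (fun i hi => hz i (by lia)) ?_ ?_) (h a)
    · intro i hi
      have := hiso i (by lia)
      exact (h2 i (by push_cast; lia)).of_iso (asIso ((kernel.ι p).f i))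
    · intro i
      by_cases hi : i ≤ a
      · exact hr.of_isZero (((HomologicalComplex.single C (ComplexShape.up ℤ) i).map_isZero
          (hz i hi))) m
      · have := hiso i (by lia)
        rw [hr.of_iso ((HomologicalComplex.single C (ComplexShape.up ℤ) i).mapIso
          (asIso ((kernel.ι p).f i))) m]
        exact h i

/-- The terms of a complex with zero differentials are direct summands. -/
lemma eq_sum_of_d_eq_zero (hr : IsCohomologicalRank r) (X : CochainComplex C ℤ)
    (hd : ∀ i j, X.d i j = 0) (s : Finset ℤ)
    (hs : ∀ i ∉ s, IsZero (X.X i)) (m : ℤ) :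
    r X m = ∑ i ∈ s, r ((HomologicalComplex.single C (ComplexShape.up ℤ) i).obj (X.X i)) m := by
  classical
  let ι (i : ℤ) : (HomologicalComplex.single C (ComplexShape.up ℤ) i).obj (X.X i) ⟶ X :=
    HomologicalComplex.mkHomFromSingle (𝟙 _) fun j _ => by rw [hd, comp_zero]
  let π (i : ℤ) : X ⟶ (HomologicalComplex.single C (ComplexShape.up ℤ) i).obj (X.X i) :=
    HomologicalComplex.mkHomToSingle (𝟙 _) fun j _ => by rw [hd, zero_comp]
  have h1 : ∀ i, ι i ≫ π i = 𝟙 _ := fun i => by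
    apply HomologicalComplex.from_single_hom_ext
    simp [ι, π]
  have h2 : ∀ i j, i ≠ j → ι i ≫ π j = 0 := fun i j hij => by
    apply HomologicalComplex.from_single_hom_ext
    exact (HomologicalComplex.isZero_single_obj_X (ComplexShape.up ℤ) _ _ _ hij).eq_of_tgt _ _
  have h3 : ∑ i : Fin s.card, π (s.equivFin.symm i).1 ≫ ι (s.equivFin.symm i).1 = 𝟙 X := by
    ext l
    rw [complex_sum_f]
    by_cases hl : l ∈ s
    · rw [Finset.sum_eq_single (s.equivFin ⟨l, hl⟩)]
      · have key : ∀ t : ℤ, t = l → (π t ≫ ι t).f l = 𝟙 _ := by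
          rintro t rfl
          simp [ι, π]
        rw [key _ (by simp), HomologicalComplex.id_f]
      · intro j _ hj
        have hne : l ≠ (s.equivFin.symm j).1 := fun h => hj (by
          apply s.equivFin.symm.injective
          rw [Equiv.symm_apply_apply]
          exact Subtype.ext h.symm)
        rw [HomologicalComplex.comp_f]
        exact (HomologicalComplex.isZero_single_obj_X (ComplexShape.up ℤ) _ _ _
            hne).eq_zero_of_tgt (f := (π _).f l)
          |> fun h => by rw [h, zero_comp]
      · simp
    · exact (hs l hl).eq_of_src _ _
  rw [hr.sum X (fun i : Fin s.card => (HomologicalComplex.single C (ComplexShape.up ℤ) _).obj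
      (X.X (s.equivFin.symm i).1)) (fun i => ι _) (fun i => π _) (fun i => h1 _)
    (fun i j hij => h2 _ _ fun h => hij (s.equivFin.symm.injective (Subtype.ext h))) h3 m,
    ← Finset.sum_coe_sort s]
  exact Equiv.sum_comp s.equivFin.symm (fun i : s =>
    r ((HomologicalComplex.single C (ComplexShape.up ℤ) i.1).obj (X.X i.1)) m)

/-- Finite direct sums in a single degree. -/
lemma single_sum (hr : IsCohomologicalRank r) {J : Type} [Fintype J] (X : C) (Y : J → C)
    (i : ∀ j, Y j ⟶ X) (p : ∀ j, X ⟶ Y j)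
    (h1 : ∀ j, i j ≫ p j = 𝟙 _) (h2 : ∀ j l, j ≠ l → i j ≫ p l = 0)
    (h3 : ∑ j, p j ≫ i j = 𝟙 X) (t m : ℤ) :
    r ((HomologicalComplex.single C (ComplexShape.up ℤ) t).obj X) m =
      ∑ j, r ((HomologicalComplex.single C (ComplexShape.up ℤ) t).obj (Y j)) m := by
  let F := HomologicalComplex.single C (ComplexShape.up ℤ) t
  refine hr.sum _ _ (fun j => F.map (i j)) (fun j => F.map (p j)) (fun j => ?_) (fun j l hjl => ?_)
    ?_ m
  · rw [← F.map_comp, h1, F.map_id]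
  · rw [← F.map_comp, h2 j l hjl, F.map_zero]
  · rw [← F.map_id, ← h3, F.map_sum]
    simp only [F.map_comp]

end IsCohomologicalRank

end RankFunctions

/-! ## Graded submodules, quotients and torsion -/

lemma deg_add_apply (a b : Deg n) (i : Fin n) : ((a + b) i : ℤ) = (a i : ℤ) + (b i : ℤ) := rfl

lemma deg_zero_apply (i : Fin n) : ((0 : Deg n) i : ℤ) = (0 : ℤ) := rfl

lemma unitDeg_apply (i j : Fin n) : (unitDeg j i : ℤ) = if i = j then (1 : ℤ) else (0 : ℤ) := rfl

lemma ind_apply (F : Finset (Fin n)) (i : Fin n) :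
    (ind F i : ℤ) = if i ∈ F then (1 : ℤ) else (0 : ℤ) := rfl

lemma unitDeg_nonneg (j : Fin n) : 0 ≤ unitDeg j := by
  intro i
  change (0 : ℤ) ≤ if i = j then 1 else 0
  split_ifs <;> norm_num

lemma le_add_unitDeg (a : Deg n) (j : Fin n) : a ≤ a + unitDeg j :=
  le_add_of_nonneg_right (unitDeg_nonneg j)

lemma le_add_ind (a : Deg n) (F : Finset (Fin n)) : a ≤ a + ind F :=
  le_add_of_nonneg_right (ind_nonneg F)

lemma mulMap_eq_zero_of_le (M : GrMod k n) {a b c : Deg n} (h : a ≤ b) (h' : a ≤ c) (hbc : b ≤ c)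
    {y : M.obj a} (hy : mulMap M h y = 0) : mulMap M h' y = 0 := by
  rw [← mulMap_mulMap M h hbc, hy, map_zero]

lemma mulMap_coe_monomialModule {U : Set (Deg n)} (hU : U.OrdConnected)
    {a b : Deg n} [Decidable (b ∈ U)] (h : a ≤ b) (y : (monomialModule k U hU).obj a) :
    (mulMap (monomialModule k U hU) h y).1 = if b ∈ U then y.1 else 0 := by
  change @ite _ (b ∈ U) (Classical.propDecidable _) y.1 0 = _
  congr

/-- A graded submodule, as a graded module. -/
def GrSubmodule.toMod {M : GrMod k n} (L : GrSubmodule M) : GrMod k n where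
  obj a := ModuleCat.of k (L.comp a)
  map {a b} f := ModuleCat.ofHom ((mulMap M (leOfHom f)).restrict (L.mul_mem a b (leOfHom f)))
  map_id a := by
    refine ModuleCat.hom_ext (LinearMap.ext fun y => Subtype.ext ?_)
    change mulMap M _ y.1 = y.1
    rw [mulMap_refl, LinearMap.id_apply]
  map_comp f g := by
    refine ModuleCat.hom_ext (LinearMap.ext fun y => Subtype.ext ?_)
    exact (mulMap_mulMap M _ _ _).symm

/-- The quotient by a graded submodule. -/
def GrSubmodule.quot {M : GrMod k n} (L : GrSubmodule M) : GrMod k n where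
  obj a := ModuleCat.of k (M.obj a ⧸ L.comp a)
  map {a b} f := ModuleCat.ofHom (Submodule.mapQ _ _ (mulMap M (leOfHom f))
    (L.mul_mem a b (leOfHom f)))
  map_id a := by
    refine ModuleCat.hom_ext (Submodule.linearMap_qext _ (LinearMap.ext fun y => ?_))
    change (Submodule.Quotient.mk (mulMap M _ y) : M.obj a ⧸ L.comp a) = Submodule.Quotient.mk y
    rw [mulMap_refl, LinearMap.id_apply]
  map_comp {a b c} f g := by
    refine ModuleCat.hom_ext (Submodule.linearMap_qext _ (LinearMap.ext fun y => ?_))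
    change (Submodule.Quotient.mk (mulMap M _ y) : M.obj c ⧸ L.comp c) =
      Submodule.Quotient.mk (mulMap M _ (mulMap M _ y))
    rw [mulMap_mulMap]

/-- The inclusion of a graded submodule. -/
def GrSubmodule.ι {M : GrMod k n} (L : GrSubmodule M) : L.toMod ⟶ M :=
  homOfLinear (fun a => (L.comp a).subtype) fun _ _ => rfl

/-- The projection to the quotient by a graded submodule. -/
def GrSubmodule.π {M : GrMod k n} (L : GrSubmodule M) : M ⟶ L.quot :=
  homOfLinear (fun a => (L.comp a).mkQ) fun _ _ => rfl

lemma GrSubmodule.shortExact {M : GrMod k n} (L : GrSubmodule M) (w : L.ι ≫ L.π = 0) :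
    (ShortComplex.mk L.ι L.π w).ShortExact :=
  shortExact_of_ev _ (fun _ => Subtype.val_injective)
    (fun _ y hy => ⟨⟨y, (Submodule.Quotient.mk_eq_zero _).1 hy⟩, rfl⟩)
    (fun _ => Submodule.mkQ_surjective _)

/-- The map on graded submodules induced by a morphism. -/
def GrSubmodule.mapSub {M N : GrMod k n} (L : GrSubmodule M) (L' : GrSubmodule N) (f : M ⟶ N)
    (hf : ∀ a y, y ∈ L.comp a → ev f a y ∈ L'.comp a) : L.toMod ⟶ L'.toMod :=
  homOfLinear (fun a => (ev f a).restrict (hf a)) fun h y => Subtype.ext (ev_mulMap f h y.1)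

/-- The map on quotients induced by a morphism. -/
def GrSubmodule.mapQuot {M N : GrMod k n} (L : GrSubmodule M) (L' : GrSubmodule N) (f : M ⟶ N)
    (hf : ∀ a y, y ∈ L.comp a → ev f a y ∈ L'.comp a) : L.quot ⟶ L'.quot :=
  homOfLinear (fun a => Submodule.mapQ _ _ (ev f a) (hf a)) fun {a b} h y => by
    obtain ⟨y, rfl⟩ := Submodule.Quotient.mk_surjective _ y
    exact congrArg (Submodule.Quotient.mk (p := L'.comp b)) (ev_mulMap f h y)

/-- The submodule of elements killed by the monomials `x^e`, `e ∈ E`. -/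
def torsion (E : Set (Deg n)) (M : GrMod k n) : GrSubmodule M where
  comp a :=
    { carrier := {y | ∀ e ∈ E, ∀ h : a ≤ a + e, mulMap M h y = 0}
      add_mem' := fun hx hy e he h => by rw [map_add, hx e he h, hy e he h, add_zero]
      zero_mem' := fun _ _ _ => map_zero _
      smul_mem' := fun c x hx e he h => by rw [map_smul, hx e he h, smul_zero] }
  mul_mem a b h y hy e he h' := by
    have h0 : a ≤ a + e := (le_add_iff_nonneg_right a).2 ((le_add_iff_nonneg_right b).1 h')
    rw [mulMap_mulMap]
    exact mulMap_eq_zero_of_le M h0 _ (add_le_add_left h e) (hy e he h0)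

lemma ev_mem_torsion (E : Set (Deg n)) {M N : GrMod k n} (f : M ⟶ N) (a : Deg n) (y : M.obj a)
    (hy : y ∈ (torsion E M).comp a) : ev f a y ∈ (torsion E N).comp a := fun e he h => by
  rw [← ev_mulMap, hy e he h, map_zero]

/-- The elements killed by `x^e`, `e ∈ E`, as a functor. -/
def torsionFunctor (k : Type u) [Field k] (E : Set (Deg n)) : GrMod k n ⥤ GrMod k n where
  obj M := (torsion E M).toMod
  map f := GrSubmodule.mapSub _ _ f (ev_mem_torsion E f)
  map_id _ := rfl
  map_comp _ _ := rfl

/-- The quotient by the elements killed by `x^e`, `e ∈ E`, as a functor. -/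
def quotFunctor (k : Type u) [Field k] (E : Set (Deg n)) : GrMod k n ⥤ GrMod k n where
  obj M := (torsion E M).quot
  map f := GrSubmodule.mapQuot _ _ f (ev_mem_torsion E f)
  map_id M := hom_ext_ev fun a x => by
    obtain ⟨x, rfl⟩ := Submodule.Quotient.mk_surjective _ x
    rfl
  map_comp f g := hom_ext_ev fun a x => by
    obtain ⟨x, rfl⟩ := Submodule.Quotient.mk_surjective _ x
    rfl

instance (E : Set (Deg n)) : (torsionFunctor k E).Additive where
  map_add := rfl

instance (E : Set (Deg n)) : (quotFunctor k E).Additive where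
  map_add := hom_ext_ev fun a x => by
    obtain ⟨x, rfl⟩ := Submodule.Quotient.mk_surjective _ x
    rfl

/-- The short exact sequence of complexes `0 ⟶ Γ(X) ⟶ X ⟶ X/Γ(X) ⟶ 0`. -/
def torsionSequence (E : Set (Deg n)) (X : CochainComplex (GrMod k n) ℤ) :
    ShortComplex (CochainComplex (GrMod k n) ℤ) where
  X₁ := ((torsionFunctor k E).mapHomologicalComplex _).obj X
  X₂ := X
  X₃ := ((quotFunctor k E).mapHomologicalComplex _).obj X
  f := { f := fun i => (torsion E (X.X i)).ι, comm' := fun _ _ _ => rfl }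
  g := { f := fun i => (torsion E (X.X i)).π, comm' := fun _ _ _ => rfl }
  zero := by
    ext i a y
    exact (Submodule.Quotient.mk_eq_zero _).2 y.2

lemma torsionSequence_shortExact (E : Set (Deg n)) (X : CochainComplex (GrMod k n) ℤ) :
    (torsionSequence E X).ShortExact :=
  HomologicalComplex.shortExact_of_degreewise_shortExact _ fun i =>
    (torsion E (X.X i)).shortExact _

lemma isZero_torsion {E : Set (Deg n)} {M : GrMod k n}
    (h : ∀ a (y : M.obj a), y ∈ (torsion E M).comp a → y = 0) :
    IsZero ((torsionFunctor k E).obj M) :=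
  (isZero_iff_eq_zero _).2 fun a y => Subtype.ext (h a y.1 y.2)

lemma nonempty_quot_iso {E : Set (Deg n)} {M : GrMod k n}
    (h : ∀ a (y : M.obj a), y ∈ (torsion E M).comp a → y = 0) :
    Nonempty ((quotFunctor k E).obj M ≅ M) := by
  have : IsIso (torsion E M).π := (isIso_iff_ev _).2 fun a =>
    ⟨(injective_iff_map_eq_zero _).2 fun y hy => h a y ((Submodule.Quotient.mk_eq_zero _).1 hy),
      Submodule.mkQ_surjective _⟩
  exact ⟨(asIso (torsion E M).π).symm⟩

lemma isZero_quot {E : Set (Deg n)} {M : GrMod k n}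
    (h : ∀ a (y : M.obj a), y ∈ (torsion E M).comp a) : IsZero ((quotFunctor k E).obj M) :=
  (isZero_iff_eq_zero _).2 fun a y => by
    obtain ⟨y, rfl⟩ := Submodule.Quotient.mk_surjective _ y
    exact (Submodule.Quotient.mk_eq_zero _).2 (h a y)

lemma nonempty_torsion_iso {E : Set (Deg n)} {M : GrMod k n}
    (h : ∀ a (y : M.obj a), y ∈ (torsion E M).comp a) :
    Nonempty ((torsionFunctor k E).obj M ≅ M) := by
  have : IsIso (torsion E M).ι := (isIso_iff_ev _).2 fun a =>
    ⟨Subtype.val_injective, fun y => ⟨⟨y, h a y⟩, rfl⟩⟩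
  let e := asIso (torsion E M).ι
  exact ⟨e⟩

/-! ### The torsion of `S/P_G` -/

lemma quotPrime_eq_zero {G : Finset (Fin n)} {a : Deg n} (y : (quotPrime k G).obj a)
    (h : ¬ (0 ≤ a ∧ ∀ i ∉ G, a i = 0)) : y = 0 := Subtype.ext (y.2 h)

lemma mulMap_quotPrime_eq_zero {G : Finset (Fin n)} {a b : Deg n} (h : a ≤ b)
    (y : (quotPrime k G).obj a) (hb : ¬ (0 ≤ b ∧ ∀ i ∉ G, b i = 0)) :
    mulMap (quotPrime k G) h y = 0 := quotPrime_eq_zero _ hb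

lemma mulMap_quotPrime_injective {G : Finset (Fin n)} {a b : Deg n} (h : a ≤ b)
    (hab : ∀ i ∉ G, (a i : ℤ) = b i) : Function.Injective (mulMap (quotPrime k G) h) := by
  classical
  refine (injective_iff_map_eq_zero _).2 fun y hy => ?_
  by_cases ha : 0 ≤ a ∧ ∀ i ∉ G, a i = 0
  · have hb : b ∈ {a : Deg n | 0 ≤ a ∧ ∀ i ∉ G, (a i : ℤ) = 0} :=
      ⟨ha.1.trans h, fun i hi => (hab i hi).symm.trans (ha.2 i hi)⟩
    have h1 := (mulMap_coe_monomialModule (k := k) _ h y).symm.trans (congrArg Subtype.val hy)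
    exact Subtype.ext ((if_pos hb).symm.trans h1)
  · exact quotPrime_eq_zero y ha

/-- If `F ⊆ G`, the monomial `x^F` involves only nonzerodivisors on `S/P_G`; otherwise it is zero
there. So `x^F`-torsion separates the faces containing `F` from the others. -/
lemma torsion_ind_quotPrime_eq_zero {F G : Finset (Fin n)} (h : F ⊆ G) (a : Deg n)
    (y : (quotPrime k G).obj a) (hy : y ∈ (torsion {ind F} (quotPrime k G)).comp a) : y = 0 :=
  (injective_iff_map_eq_zero _).1 (mulMap_quotPrime_injective (le_add_ind a F) fun i hi => by
    have : i ∉ F := fun h' => hi (h h')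
    simp [deg_add_apply, ind_apply, this]) y (hy _ rfl _)

lemma mem_torsion_ind_quotPrime {F G : Finset (Fin n)} (h : ¬ F ⊆ G) (a : Deg n)
    (y : (quotPrime k G).obj a) : y ∈ (torsion {ind F} (quotPrime k G)).comp a := by
  rintro _ rfl h'
  obtain ⟨i, hiF, hiG⟩ := Finset.not_subset.1 h
  by_cases ha : 0 ≤ a
  · refine mulMap_quotPrime_eq_zero _ _ fun hb => ?_
    have h1 := hb.2 i hiG
    have h2 : (0 : ℤ) ≤ a i := ha i
    rw [deg_add_apply, ind_apply, if_pos hiF] at h1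
    omega
  · rw [quotPrime_eq_zero y fun hb => ha hb.1, map_zero]

/-- A single `x_j` with `j ∈ G \ F` is already a nonzerodivisor on `S/P_G`. Hence, among the faces
`G ⊇ F`, torsion with respect to the variables outside `F` singles out `G = F`. -/
lemma torsion_unitDeg_quotPrime_eq_zero {F G : Finset (Fin n)} (h : ¬ G ⊆ F) (a : Deg n)
    (y : (quotPrime k G).obj a)
    (hy : y ∈ (torsion {e | ∃ j ∉ F, e = unitDeg j} (quotPrime k G)).comp a) : y = 0 := by
  obtain ⟨j, hjG, hjF⟩ := Finset.not_subset.1 h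
  refine (injective_iff_map_eq_zero _).1
    (mulMap_quotPrime_injective (le_add_unitDeg a j) fun i hi => ?_) y (hy _ ⟨j, hjF, rfl⟩ _)
  have : i ≠ j := fun h' => hi (h' ▸ hjG)
  simp [deg_add_apply, unitDeg_apply, this]

lemma mem_torsion_unitDeg_quotPrime (F : Finset (Fin n)) (a : Deg n)
    (y : (quotPrime k F).obj a) :
    y ∈ (torsion {e | ∃ j ∉ F, e = unitDeg j} (quotPrime k F)).comp a := by
  rintro _ ⟨j, hj, rfl⟩ h'
  by_cases ha : 0 ≤ a
  · refine mulMap_quotPrime_eq_zero _ _ fun hb => ?_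
    have h1 := hb.2 j hj
    have h2 : (0 : ℤ) ≤ a j := ha j
    rw [deg_add_apply, unitDeg_apply, if_pos rfl] at h1
    omega
  · rw [quotPrime_eq_zero y fun hb => ha hb.1, map_zero]

/-! ### Socles of squarefree modules -/

/-- The element `y` is killed by `x_j`, `j ∉ F`. -/
def KilledOutside {M : GrMod k n} (F : Finset (Fin n)) {a : Deg n} (y : M.obj a) : Prop :=
  ∀ j ∉ F, mulMap M (le_add_unitDeg a j) y = 0

lemma IsSquarefree.eq_zero_of_not_nonneg {M : GrMod k n} (hM : IsSquarefree M) {a : Deg n}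
    (ha : ¬ 0 ≤ a) (y : M.obj a) : y = 0 :=
  have := hM.subsingleton a ha
  Subsingleton.elim _ _

lemma posSupp_add_unitDeg {b : Deg n} (hb : 0 ≤ b) (j : Fin n) :
    posSupp (b + unitDeg j) = insert j (posSupp b) := by
  ext i
  have h0 : (0 : ℤ) ≤ b i := hb i
  rw [mem_posSupp, Finset.mem_insert, mem_posSupp, deg_add_apply, unitDeg_apply]
  split_ifs with h
  · simp only [h, true_or, iff_true]
    rw [h] at h0
    omega
  · simp [h]

lemma IsSquarefree.mulMap_unitDeg_injective {M : GrMod k n} (hM : IsSquarefree M) {b : Deg n}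
    (hb : 0 ≤ b) {j : Fin n} (hj : j ∈ posSupp b) :
    Function.Injective (mulMap M (le_add_unitDeg b j)) :=
  (hM.bijective _ _ _ hb (by rw [posSupp_add_unitDeg hb, Finset.insert_eq_of_mem hj])).1

/-- In a squarefree module, elements killed by `x_j`, `j ∉ F`, come from such elements of
degree `F`. -/
lemma IsSquarefree.exists_socle {M : GrMod k n} (hM : IsSquarefree M) {F : Finset (Fin n)}
    {b : Deg n} (hb : ind F ≤ b) (z : M.obj b) (hz : KilledOutside F z) :
    ∃ z' : M.obj (ind F), KilledOutside F z' ∧ mulMap M hb z' = z := by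
  have h0 : 0 ≤ b := (ind_nonneg F).trans hb
  have hF : F ⊆ posSupp b := by
    have := posSupp_mono hb
    rwa [posSupp_ind] at this
  by_cases h : posSupp b = F
  · have hbij := hM.bijective _ _ hb (ind_nonneg F) (by rw [h, posSupp_ind])
    obtain ⟨z', rfl⟩ := hbij.2 z
    refine ⟨z', fun j hj => ?_, rfl⟩
    have h1 := hz j hj
    rw [mulMap_mulMap] at h1
    have h2 : ind F + unitDeg j ≤ b + unitDeg j := add_le_add_left hb _
    rw [← mulMap_mulMap M (le_add_unitDeg _ j) h2] at h1
    exact (injective_iff_map_eq_zero _).1 (hM.bijective _ _ h2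
      ((ind_nonneg F).trans (le_add_unitDeg _ j))
      (by rw [posSupp_add_unitDeg h0, posSupp_add_unitDeg (ind_nonneg F), h, posSupp_ind])).1 _ h1
  -- If the support of `b` is larger than `F`, then for some `j ∉ F` in it `x_j` is injective in
  -- degree `b` and kills `z`, so `z = 0`.
  · obtain ⟨j, hj, hjF⟩ := Finset.exists_of_ssubset (hF.ssubset_of_ne (Ne.symm h))
    have hz0 : z = 0 := (injective_iff_map_eq_zero _).1 (hM.mulMap_unitDeg_injective h0 hj) z
      (hz j hjF)
    exact ⟨0, fun j _ => map_zero _, by rw [map_zero, hz0]⟩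

/-- The morphism vanishes on the socles of the module: it kills the elements of degree `F` that are
killed by `x_j`, `j ∉ F`. -/
def KillsSocle {M N : GrMod k n} (f : M ⟶ N) : Prop :=
  ∀ (F : Finset (Fin n)) (y : M.obj (ind F)), KilledOutside F y → ev f _ y = 0

lemma IsSquarefree.ev_eq_zero_of_killsSocle {M N : GrMod k n} (hM : IsSquarefree M) {f : M ⟶ N}
    (hf : KillsSocle f) {F : Finset (Fin n)} {b : Deg n} (hb : ind F ≤ b) (z : M.obj b)
    (hz : KilledOutside F z) : ev f b z = 0 := by
  obtain ⟨z', hz', rfl⟩ := hM.exists_socle hb z hz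
  rw [ev_mulMap, hf F z' hz', map_zero]

/-! ### Cohomological ranks of minimal complexes -/

section Minimal

variable {r : CochainComplex (GrMod k n) ℤ → ℤ → Cardinal.{w}}

/-- A graded module in a single degree. -/
abbrev singleAt (t : ℤ) (M : GrMod k n) : CochainComplex (GrMod k n) ℤ :=
  (HomologicalComplex.single (GrMod k n) (ComplexShape.up ℤ) t).obj M

lemma rank_single_of_iso (hr : IsCohomologicalRank r) {M N : GrMod k n} (e : Nonempty (M ≅ N))
    (t m : ℤ) : r (singleAt t M) m = r (singleAt t N) m :=
  hr.of_iso ((HomologicalComplex.single (GrMod k n) (ComplexShape.up ℤ) t).mapIso e.some) m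

lemma rank_single_of_isZero (hr : IsCohomologicalRank r) {M : GrMod k n} (h : IsZero M)
    (t m : ℤ) : r (singleAt t M) m = 0 :=
  hr.of_isZero ((HomologicalComplex.single (GrMod k n) (ComplexShape.up ℤ) t).map_isZero h) m

lemma rank_single_sum (hr : IsCohomologicalRank r) (Ψ : GrMod k n ⥤ GrMod k n) [Ψ.Additive]
    {J : Type} [Fintype J] (Y : J → GrMod k n) {M : GrMod k n} (e : M ≅ ⨁ Y) (t m : ℤ) :
    r (singleAt t (Ψ.obj M)) m = ∑ j, r (singleAt t (Ψ.obj (Y j))) m := by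
  classical
  refine hr.single_sum _ _ (fun j => Ψ.map (biproduct.ι Y j ≫ e.inv))
    (fun j => Ψ.map (e.hom ≫ biproduct.π Y j)) (fun j => ?_) (fun j l hjl => ?_) ?_ t m
  · rw [← Ψ.map_comp, Category.assoc, e.inv_hom_id_assoc, biproduct.ι_π_self, Ψ.map_id]
  · rw [← Ψ.map_comp, Category.assoc, e.inv_hom_id_assoc, biproduct.ι_π_ne _ hjl, Ψ.map_zero]
  · simp only [← Ψ.map_comp]
    rw [← Ψ.map_sum, ← Ψ.map_id, ← e.hom_inv_id]
    congr 1
    calc _ = e.hom ≫ (∑ j, biproduct.π Y j ≫ biproduct.ι Y j) ≫ e.inv := by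
            rw [Preadditive.sum_comp, Preadditive.comp_sum]
            simp
      _ = _ := by rw [biproduct.total, Category.id_comp]

/-- For a bounded complex of direct sums of modules `S/P_G` whose differentials vanish on socles,
a cohomological rank that detects `S/P_F` counts the summands `S/P_F`. -/
theorem rank_eq_of_killsSocle (hr : IsCohomologicalRank r) (F : Finset (Fin n))
    (hsingle : ∀ (G : Finset (Fin n)) (t m : ℤ),
      r (singleAt t (quotPrime k G)) m = if G = F ∧ t = m then 1 else 0)
    (I : CochainComplex (GrMod k n) ℤ) (hb : ∃ N : ℕ, ∀ i : ℤ, (N : ℤ) < |i| → IsZero (I.X i))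
    (hsq : ∀ i, IsSquarefree (I.X i)) (hsoc : ∀ i, KillsSocle (I.d i (i + 1)))
    (μ : ℤ → Finset (Fin n) → ℕ)
    (hμ : ∀ i, Nonempty (I.X i ≅ ⨁ fun p : (G : Finset (Fin n)) × Fin (μ i G) => quotPrime k p.1))
    (m : ℤ) : r I m = μ m F := by
  classical
  obtain ⟨N, hN⟩ := hb
  have hnull : ∀ G, G ≠ F → ∀ t m, r (singleAt t (quotPrime k G)) m = 0 := fun G hG t m => by
    rw [hsingle, if_neg fun h => hG h.1]
  -- Dévissage: an additive functor that makes the rank of every `S/P_G` vanish makes the rank of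
  -- the whole complex vanish.
  have hterms : ∀ (Ψ : GrMod k n ⥤ GrMod k n) [Ψ.Additive],
      (∀ G t m, r (singleAt t (Ψ.obj (quotPrime k G))) m = 0) →
      ∀ m, r ((Ψ.mapHomologicalComplex _).obj I) m = 0 := by
    intro Ψ _ hΨ m
    have hz : ∀ i : ℤ, (N : ℤ) < |i| → IsZero (((Ψ.mapHomologicalComplex _).obj I).X i) :=
      fun i hi => Ψ.map_isZero (hN i hi)
    refine hr.eq_zero_of_terms m (2 * N + 1) _ (-N) (fun i hi => hz i ?_) (fun i hi => hz i ?_) ?_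
    · rw [lt_abs]; right; omega
    · rw [lt_abs]; left; push_cast at hi; omega
    · intro i
      refine (rank_single_sum hr Ψ _ (hμ i).some i m).trans ?_
      simp [hΨ]
  -- Passing to the quotient by `Ea`-torsion keeps the summands with `F ⊆ G`; the `Eb`-torsion of
  -- this quotient is the sum of the copies of `S/P_F`. The discarded pieces involve only `G ≠ F`,
  -- hence have rank zero.
  let Ea : Set (Deg n) := {ind F}
  let Eb : Set (Deg n) := {e | ∃ j ∉ F, e = unitDeg j}
  let Q := quotFunctor k Ea
  have hQ : ∀ G, F ⊆ G → Nonempty (Q.obj (quotPrime k G) ≅ quotPrime k G) := fun G h =>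
    nonempty_quot_iso (torsion_ind_quotPrime_eq_zero h)
  have hQ0 : ∀ G, ¬ F ⊆ G → IsZero (Q.obj (quotPrime k G)) := fun G h =>
    isZero_quot (mem_torsion_ind_quotPrime h)
  have h1 : ∀ m, r I m = r ((Q.mapHomologicalComplex _).obj I) m := by
    refine hr.eq₂₃ _ (torsionSequence_shortExact Ea I) (hterms (torsionFunctor k Ea) ?_)
    intro G t m
    by_cases h : F ⊆ G
    · exact rank_single_of_isZero hr (isZero_torsion (torsion_ind_quotPrime_eq_zero h)) t m
    · rw [rank_single_of_iso hr (nonempty_torsion_iso (mem_torsion_ind_quotPrime h)),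
        hnull G fun e => h e.ge]
  have h2 : ∀ m, r (((torsionFunctor k Eb).mapHomologicalComplex _).obj
      ((Q.mapHomologicalComplex _).obj I)) m = r ((Q.mapHomologicalComplex _).obj I) m := by
    refine hr.eq₁₂ _ (torsionSequence_shortExact Eb ((Q.mapHomologicalComplex _).obj I))
      (hterms (Q ⋙ quotFunctor k Eb) ?_)
    intro G t m
    change r (singleAt t ((quotFunctor k Eb).obj (Q.obj (quotPrime k G)))) m = 0
    by_cases h : F ⊆ G
    · rw [rank_single_of_iso hr ((hQ G h).map (quotFunctor k Eb).mapIso)]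
      by_cases h' : G ⊆ F
      · obtain rfl := h.antisymm h'
        exact rank_single_of_isZero hr (isZero_quot (mem_torsion_unitDeg_quotPrime F)) t m
      · rw [rank_single_of_iso hr (nonempty_quot_iso (torsion_unitDeg_quotPrime_eq_zero h')),
          hnull G fun e => h' e.le]
    · exact rank_single_of_isZero hr ((quotFunctor k Eb).map_isZero (hQ0 G h)) t m
  rw [h1, ← h2]
  let Ψ := Q ⋙ torsionFunctor k Eb
  -- A class in the subquotient is represented by `y` with `x_j x^F y = 0` for `j ∉ F`. Then `x^F y`
  -- is killed outside `F` in a degree above `F`, so the differential kills it; thus `d y` is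
  -- `x^F`-torsion and its class vanishes.
  have hd : ∀ i j, Ψ.map (I.d i j) = 0 := by
    intro i j
    by_cases hij : i + 1 = j
    · subst hij
      refine hom_ext_ev fun a x => Subtype.ext ?_
      obtain ⟨x, hx⟩ := x
      obtain ⟨y, rfl⟩ := Submodule.Quotient.mk_surjective _ x
      refine (Submodule.Quotient.mk_eq_zero _).2 ?_
      rintro _ rfl h'
      rw [← ev_mulMap]
      by_cases ha : 0 ≤ a
      · refine (hsq i).ev_eq_zero_of_killsSocle (hsoc i) (F := F) (le_add_of_nonneg_left ha) _
          fun j hj => ?_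
        have h3 := hx (unitDeg j) ⟨j, hj, rfl⟩ (le_add_unitDeg a j)
        have h4 := (Submodule.Quotient.mk_eq_zero _).1 h3 _ rfl (le_add_ind _ F)
        have h5 : a + unitDeg j + ind F ≤ a + ind F + unitDeg j := by rw [add_right_comm]
        rw [mulMap_mulMap] at h4 ⊢
        exact mulMap_eq_zero_of_le _ _ _ h5 h4
      · rw [(hsq i).eq_zero_of_not_nonneg ha y, map_zero, map_zero]
    · rw [I.shape _ _ hij, Ψ.map_zero]
  -- Including `m` lets the final sum pick out the term of degree `m` even when it lies outside the
  -- bounds.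
  let s : Finset ℤ := insert m (Finset.Icc (-N : ℤ) N)
  have hs : ∀ i ∉ s, IsZero (I.X i) := fun i hi => hN i (by
    rw [Finset.mem_insert, Finset.mem_Icc] at hi
    rw [lt_abs]
    omega)
  refine (hr.eq_sum_of_d_eq_zero ((Ψ.mapHomologicalComplex _).obj I) hd s
    (fun i hi => Ψ.map_isZero (hs i hi)) m).trans ?_
  have h3 : ∀ G t m, r (singleAt t (Ψ.obj (quotPrime k G))) m =
      if G = F ∧ t = m then 1 else 0 := by
    intro G t m
    by_cases h : F ⊆ G
    · refine (rank_single_of_iso hr ((hQ G h).map (torsionFunctor k Eb).mapIso) t m).trans ?_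
      by_cases h' : G ⊆ F
      · obtain rfl := h.antisymm h'
        rw [rank_single_of_iso hr (nonempty_torsion_iso (mem_torsion_unitDeg_quotPrime F)), hsingle]
      · rw [rank_single_of_isZero hr (isZero_torsion (torsion_unitDeg_quotPrime_eq_zero h')),
          if_neg fun e => h' e.1.le]
    · rw [if_neg fun e => h e.1.ge]
      exact rank_single_of_isZero hr ((torsionFunctor k Eb).map_isZero (hQ0 G h)) t m
  have h4 : ∀ i, r (singleAt i (Ψ.obj (I.X i))) m = if i = m then (μ m F : Cardinal) else 0 := by
    intro i
    rw [rank_single_sum hr Ψ _ (hμ i).some i m]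
    simp only [h3]
    by_cases him : i = m
    · subst him
      rw [if_pos rfl, Fintype.sum_sigma, Finset.sum_eq_single F]
      · simp
      · intro G _ hG
        simp [hG]
      · simp
    · simp [him]
  refine (Finset.sum_congr rfl fun i _ => h4 i).trans ?_
  rw [Finset.sum_ite_eq' s m, if_pos (Finset.mem_insert_self _ _)]

end Minimal

/-! ## Morphisms between shifted single complexes -/

section HyperExtSingle

variable {C : Type w} [Category.{v} C] [Abelian C] (R : Type*) [CommRing R] [Linear R C]

/-- `Hom(X[-t], Y[-s][m])` in the derived category is `Hom(X, Y[l])`, for `l = m + t - s`. -/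
lemma nonempty_hyperExt_single_linearEquiv [HasDerivedCategory.{max w v} C] (X Y : C)
    (t s m l : ℤ) (h : l = m + t - s) :
    Nonempty ((DerivedCategory.Q.obj
        ((HomologicalComplex.single C (ComplexShape.up ℤ) t).obj X) ⟶
      (DerivedCategory.Q.obj
        ((HomologicalComplex.single C (ComplexShape.up ℤ) s).obj Y))⟦m⟧) ≃ₗ[R]
      ((DerivedCategory.singleFunctor C 0).obj X ⟶
        ((DerivedCategory.singleFunctor C 0).obj Y)⟦l⟧)) := by
  let A := (DerivedCategory.singleFunctor C t).obj X
  let B := (DerivedCategory.singleFunctor C s).obj Y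
  let S := shiftFunctor (DerivedCategory C) t
  have hbij : Function.Bijective (S.mapLinearMap R (X := A) (Y := B⟦m⟧)) :=
    ⟨S.map_injective, S.map_surjective⟩
  let e₁ : S.obj A ≅ (DerivedCategory.singleFunctor C 0).obj X :=
    ((DerivedCategory.singleFunctors C).shiftIso t 0 t (add_zero t)).app X
  let e₂ : S.obj (B⟦m⟧) ≅ B⟦m + t⟧ := ((shiftFunctorAdd (DerivedCategory C) m t).app B).symm
  let e₃ : B⟦m + t⟧ ≅ (DerivedCategory.singleFunctor C (-l)).obj Y :=
    ((DerivedCategory.singleFunctors C).shiftIso (m + t) (-l) s (by lia)).app Y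
  let e₄ : ((DerivedCategory.singleFunctor C 0).obj Y)⟦l⟧ ≅
      (DerivedCategory.singleFunctor C (-l)).obj Y :=
    ((DerivedCategory.singleFunctors C).shiftIso l (-l) 0 (by lia)).app Y
  exact ⟨((LinearEquiv.ofBijective _ hbij).trans
    (Linear.homCongr R e₁ (e₂ ≪≫ e₃ ≪≫ e₄.symm)) :)⟩

/-- `HyperExt` as a space of morphisms in the derived category. -/
def hyperExtEquiv (K L : CochainComplex C ℤ) (i : ℤ) :
    let _ := HasDerivedCategory.standard C
    HyperExt K L i ≃ₗ[R] (DerivedCategory.Q.obj K ⟶ (DerivedCategory.Q.obj L)⟦i⟧) :=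
  LinearEquiv.refl R _

/-- There are no negative Ext groups between objects of the heart: the source sits in degree 0 and
the target in positive degrees. -/
lemma subsingleton_hyperExt_single_of_neg (X Y : C) (t s m : ℤ) (h : m + t - s < 0) :
    Subsingleton (HyperExt ((HomologicalComplex.single C (ComplexShape.up ℤ) t).obj X)
      ((HomologicalComplex.single C (ComplexShape.up ℤ) s).obj Y) m) := by
  let _ := HasDerivedCategory.standard C
  let e := (nonempty_hyperExt_single_linearEquiv ℤ X Y t s m _ rfl).some
  refine ((hyperExtEquiv ℤ _ _ m).trans e).toEquiv.subsingleton_congr.2 ?_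
  refine subsingleton_of_forall_eq 0 fun f => ?_
  have h1 : (((DerivedCategory.singleFunctor C 0).obj Y)⟦m + t - s⟧).IsGE (-(m + t - s)) :=
    DerivedCategory.TStructure.t.isGE_shift _ 0 (m + t - s) _ (by lia)
  exact DerivedCategory.TStructure.t.zero f 0 (-(m + t - s)) (by lia)

/-- Reduces the values on single modules to `Abelian.Ext`, where projective objects and the
contravariant long exact sequence are at hand. -/
lemma nonempty_hyperExt_single_linearEquiv_ext [HasExt.{max w v} C] (X Y : C) (t s m : ℤ) (l : ℕ)
    (h : (l : ℤ) = m + t - s) :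
    Nonempty (HyperExt ((HomologicalComplex.single C (ComplexShape.up ℤ) t).obj X)
      ((HomologicalComplex.single C (ComplexShape.up ℤ) s).obj Y) m ≃ₗ[R] Abelian.Ext X Y l) := by
  let _ := HasDerivedCategory.standard C
  let e := (nonempty_hyperExt_single_linearEquiv R X Y t s m _ h).some
  exact ⟨(hyperExtEquiv R _ _ m).trans (e.trans Abelian.Ext.homLinearEquiv.symm)⟩

end HyperExtSingle

/-! ## Ext and short exact sequences -/

section ExtLemmas

open Abelian

variable {C : Type w} [Category.{v} C] [Abelian C] [HasExt.{w'} C] {S : ShortComplex C}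

lemma ext_subsingleton₃ (hS : S.ShortExact) (B : C)
    (h₁ : ∀ l, Subsingleton (Ext S.X₁ B l)) (h₂ : ∀ l, Subsingleton (Ext S.X₂ B l)) (l : ℕ) :
    Subsingleton (Ext S.X₃ B l) := by
  refine subsingleton_of_forall_eq 0 fun x => ?_
  cases l with
  | zero =>
    have := hS.epi_g
    exact Ext.precomp_mk₀_injective_of_epi B S.g ((Subsingleton.elim _ _))
  | succ l =>
    obtain ⟨y, rfl⟩ := Ext.contravariant_sequence_exact₃ hS B x (Subsingleton.elim _ _)
      (n₀ := l) (add_comm 1 l)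
    rw [Subsingleton.elim y 0, Ext.comp_zero]

/-- Only degrees 0 and 1 use the map on Hom: its injectivity kills Hom from the third term, and its
surjectivity makes the connecting map to `Ext¹` zero. -/
lemma ext_subsingleton₃_of_bijective (hS : S.ShortExact) (B : C)
    (h₀ : Function.Bijective (fun f : S.X₂ ⟶ B => S.f ≫ f))
    (h₁ : ∀ l, 0 < l → Subsingleton (Ext S.X₁ B l))
    (h₂ : ∀ l, 0 < l → Subsingleton (Ext S.X₂ B l)) (l : ℕ) :
    Subsingleton (Ext S.X₃ B l) := by
  refine subsingleton_of_forall_eq 0 fun x => ?_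
  match l with
  | 0 =>
    obtain ⟨f, rfl⟩ := (Ext.mk₀_bijective _ _).2 x
    have := hS.epi_g
    have h : S.g ≫ f = 0 := h₀.1 (by simp)
    rw [(cancel_epi S.g).1 (h.trans comp_zero.symm), Ext.mk₀_zero]
  | 1 =>
    have := h₂ 1 one_pos
    obtain ⟨y, rfl⟩ := Ext.contravariant_sequence_exact₃ hS B x (Subsingleton.elim _ _)
      (n₀ := 0) (add_comm 1 0)
    obtain ⟨f, rfl⟩ := (Ext.mk₀_bijective _ _).2 y
    obtain ⟨g, rfl⟩ := h₀.2 f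
    rw [← Ext.mk₀_comp_mk₀, ← Ext.comp_assoc_of_second_deg_zero, hS.extClass_comp, Ext.zero_comp]
  | l + 2 =>
    have := h₂ (l + 2) (by lia)
    have := h₁ (l + 1) (by lia)
    obtain ⟨y, rfl⟩ := Ext.contravariant_sequence_exact₃ hS B x (Subsingleton.elim _ _)
      (n₀ := l + 1) (by lia)
    rw [Subsingleton.elim y 0, Ext.comp_zero]

lemma ext_subsingleton₃_of_surjective (hS : S.ShortExact) (B : C)
    (h₀ : Function.Surjective (fun f : S.X₂ ⟶ B => S.f ≫ f))
    (h₁ : ∀ l, 0 < l → Subsingleton (Ext S.X₁ B l))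
    (h₂ : ∀ l, 0 < l → Subsingleton (Ext S.X₂ B l)) (l : ℕ) (hl : 0 < l) :
    Subsingleton (Ext S.X₃ B l) := by
  refine subsingleton_of_forall_eq 0 fun x => ?_
  match l with
  | 0 => exact absurd hl (lt_irrefl _)
  | 1 =>
    have := h₂ 1 one_pos
    obtain ⟨y, rfl⟩ := Ext.contravariant_sequence_exact₃ hS B x (Subsingleton.elim _ _)
      (n₀ := 0) (add_comm 1 0)
    obtain ⟨f, rfl⟩ := (Ext.mk₀_bijective _ _).2 y
    obtain ⟨g, rfl⟩ := h₀ f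
    rw [← Ext.mk₀_comp_mk₀, ← Ext.comp_assoc_of_second_deg_zero, hS.extClass_comp, Ext.zero_comp]
  | l + 2 =>
    have := h₂ (l + 2) (by lia)
    have := h₁ (l + 1) (by lia)
    obtain ⟨y, rfl⟩ := Ext.contravariant_sequence_exact₃ hS B x (Subsingleton.elim _ _)
      (n₀ := l + 1) (by lia)
    rw [Subsingleton.elim y 0, Ext.comp_zero]

/-- Dimension shifting: the connecting map is an isomorphism once the middle term has no Ext. -/
lemma nonempty_ext_linearEquiv_succ (R : Type*) [CommRing R] [Linear R C] (hS : S.ShortExact)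
    (B : C) (h₂ : ∀ l, Subsingleton (Ext S.X₂ B l)) (l : ℕ) :
    Nonempty (Ext S.X₁ B l ≃ₗ[R] Ext S.X₃ B (l + 1)) := by
  refine ⟨LinearEquiv.ofBijective (Ext.precompOfLinear hS.extClass R B (add_comm 1 l))
    ⟨(injective_iff_map_eq_zero _).2 fun x hx => ?_, fun x => ?_⟩⟩
  · obtain ⟨y, rfl⟩ := Ext.contravariant_sequence_exact₁ hS B x (add_comm 1 l) hx
    rw [Subsingleton.elim y 0, Ext.comp_zero]
  · obtain ⟨y, rfl⟩ := Ext.contravariant_sequence_exact₃ hS B x (Subsingleton.elim _ _)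
      (n₀ := l) (add_comm 1 l)
    exact ⟨y, rfl⟩

end ExtLemmas

/-! ## Modules with a monomial basis -/

section Monomial

variable {U V W : Set (Deg n)} (hU : U.OrdConnected) (hV : V.OrdConnected) (hW : W.OrdConnected)

variable (k) in
/-- The coefficient of the basis element in degree `a`. -/
def monomialCoeff (a : Deg n) : (monomialModule k U hU).obj a →ₗ[k] k :=
  Submodule.subtype (only (a ∈ U) k)

/-- The basis element `x^a`. -/
def monomialGen {a : Deg n} (ha : a ∈ U) : (monomialModule k U hU).obj a :=
  ⟨1, fun h => absurd ha h⟩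

lemma monomialModule_eq_zero {a : Deg n} (ha : a ∉ U) (y : (monomialModule k U hU).obj a) :
    y = 0 := Subsingleton.elim (h := ⟨fun x y => Subtype.ext ((x.2 ha).trans (y.2 ha).symm)⟩) _ _

lemma eq_smul_monomialGen {a : Deg n} (ha : a ∈ U) (y : (monomialModule k U hU).obj a) :
    y = (y.1 : k) • monomialGen hU ha := Subtype.ext (mul_one (y.1 : k)).symm

lemma mulMap_monomialGen {a b : Deg n} (ha : a ∈ U) (hb : b ∈ U) (h : a ≤ b) :
    mulMap (monomialModule k U hU) h (monomialGen hU ha) = monomialGen hU hb := by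
  classical
  exact Subtype.ext ((mulMap_coe_monomialModule hU h _).trans (if_pos hb))

/-- A morphism from a monomial module with a generator in degree `b`. -/
def monomialDesc {b : Deg n} (hbU : ∀ a ∈ U, b ≤ a) (N : GrMod k n) (y : N.obj b)
    (hy : ∀ (a : Deg n) (h : b ≤ a), a ∉ U → mulMap N h y = 0) : monomialModule k U hU ⟶ N := by
  classical
  exact homOfLinear
    (fun a => if h : b ≤ a then
      (LinearMap.toSpanSingleton k (N.obj a) (mulMap N h y)).comp (monomialCoeff k hU a) else 0)
    (by
      intro a c h z
      by_cases ha : b ≤ a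
      · have hc := ha.trans h
        rw [dif_pos ha, dif_pos hc]
        have h1 := mulMap_coe_monomialModule hU h z
        change (mulMap (monomialModule k U hU) h z).1 • mulMap N hc y =
          mulMap N h (z.1 • mulMap N ha y)
        rw [map_smul, mulMap_mulMap, h1]
        split_ifs with hcU
        · rfl
        · rw [hy c hc hcU, zero_smul, smul_zero]
      · rw [monomialModule_eq_zero hU (fun h' => ha (hbU a h')) z, map_zero, map_zero, map_zero,
          map_zero])

lemma ev_monomialDesc_gen {b : Deg n} (hbU : ∀ a ∈ U, b ≤ a) (N : GrMod k n) (y : N.obj b)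
    (hy : ∀ (a : Deg n) (h : b ≤ a), a ∉ U → mulMap N h y = 0) {a : Deg n} (ha : a ∈ U) :
    ev (monomialDesc hU hbU N y hy) a (monomialGen hU ha) = mulMap N (hbU a ha) y := by
  classical
  change (if h : b ≤ a then
      (LinearMap.toSpanSingleton k (N.obj a) (mulMap N h y)).comp (monomialCoeff k hU a) else 0)
    (monomialGen hU ha) = _
  rw [dif_pos (hbU a ha)]
  exact one_smul k _

lemma ev_monomialDesc_gen_self {b : Deg n} (hbU : ∀ a ∈ U, b ≤ a) (N : GrMod k n) (y : N.obj b)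
    (hy : ∀ (a : Deg n) (h : b ≤ a), a ∉ U → mulMap N h y = 0) (hb : b ∈ U) :
    ev (monomialDesc hU hbU N y hy) b (monomialGen hU hb) = y := by
  rw [ev_monomialDesc_gen, mulMap_refl, LinearMap.id_apply]

variable {hU} in
lemma monomial_hom_ext_of_forall {N : GrMod k n} {f g : monomialModule k U hU ⟶ N}
    (h : ∀ a (ha : a ∈ U), ev f a (monomialGen hU ha) = ev g a (monomialGen hU ha)) : f = g :=
  hom_ext_ev fun a x => by
    by_cases ha : a ∈ U
    · rw [eq_smul_monomialGen hU ha x, map_smul, map_smul, h]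
    · rw [monomialModule_eq_zero hU ha x, map_zero, map_zero]

variable {hU} in
lemma monomial_hom_ext {b : Deg n} (hbU : ∀ a ∈ U, b ≤ a) (hb : b ∈ U) {N : GrMod k n}
    {f g : monomialModule k U hU ⟶ N}
    (h : ev f b (monomialGen hU hb) = ev g b (monomialGen hU hb)) : f = g :=
  monomial_hom_ext_of_forall fun a ha => by
    rw [← mulMap_monomialGen hU hb ha (hbU a ha), ev_mulMap, ev_mulMap, h]

variable (k) in
/-- The morphism of monomial modules that maps `x^a` to `x^a` if `a ∈ V`, and to `0` otherwise. -/
def monomialMap (h₁ : ∀ a b, a ≤ b → a ∈ U → b ∈ U → b ∈ V → a ∈ V)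
    (h₂ : ∀ a b, a ≤ b → a ∈ U → a ∈ V → b ∈ V → b ∈ U) :
    monomialModule k U hU ⟶ monomialModule k V hV := by
  classical
  exact homOfLinear
    (fun a => LinearMap.codRestrict (only (a ∈ V) k) (if a ∈ V then monomialCoeff k hU a else 0)
        fun y => by
      intro ha
      rw [if_neg ha, LinearMap.zero_apply])
    (by
      intro a b h z
      refine Subtype.ext ?_
      have h1 := mulMap_coe_monomialModule hU h z
      refine Eq.trans ?_ (mulMap_coe_monomialModule hV h _).symm
      change (if b ∈ V then monomialCoeff k hU b else 0) _ =
        if b ∈ V then (if a ∈ V then monomialCoeff k hU a else 0) z else 0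
      by_cases hb : b ∈ V
      · rw [if_pos hb, if_pos hb]
        refine h1.trans ?_
        by_cases haU : a ∈ U
        · by_cases hbU : b ∈ U
          · rw [if_pos hbU, if_pos (h₁ a b h haU hbU hb)]
            rfl
          · rw [if_neg hbU, if_neg fun ha => hbU (h₂ a b h haU ha hb)]
            rfl
        · rw [monomialModule_eq_zero hU haU z, map_zero]
          exact ite_self _
      · rw [if_neg hb, if_neg hb]
        rfl)

lemma coe_ev_monomialMap (h₁ : ∀ a b, a ≤ b → a ∈ U → b ∈ U → b ∈ V → a ∈ V)
    (h₂ : ∀ a b, a ≤ b → a ∈ U → a ∈ V → b ∈ V → b ∈ U) {a : Deg n} (ha : a ∈ V)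
    (y : (monomialModule k U hU).obj a) :
    (ev (monomialMap k hU hV h₁ h₂) a y).1 = y.1 := by
  classical
  change (if a ∈ V then monomialCoeff k hU a else 0) y = y.1
  rw [if_pos ha]
  rfl

/-- The short exact sequence associated to an upper subset `U` of `V`, with complement `W`. -/
lemma monomial_shortExact (hVU : V = U ∪ W)
    (h₁ : ∀ a b, a ≤ b → a ∈ U → b ∈ U → b ∈ V → a ∈ V)
    (h₂ : ∀ a b, a ≤ b → a ∈ U → a ∈ V → b ∈ V → b ∈ U)
    (h₃ : ∀ a b, a ≤ b → a ∈ V → b ∈ V → b ∈ W → a ∈ W)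
    (h₄ : ∀ a b, a ≤ b → a ∈ V → a ∈ W → b ∈ W → b ∈ V)
    (w : monomialMap k hU hV h₁ h₂ ≫ monomialMap k hV hW h₃ h₄ = 0) :
    (ShortComplex.mk _ _ w).ShortExact := by
  have hUV : ∀ a ∈ U, a ∈ V := fun a ha => hVU ▸ Or.inl ha
  have hWV : ∀ a ∈ W, a ∈ V := fun a ha => hVU ▸ Or.inr ha
  refine shortExact_of_ev _ (fun a => (injective_iff_map_eq_zero _).2 fun y hy => ?_)
    (fun a y hy => ?_) (fun a y => ?_)
  · by_cases ha : a ∈ U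
    · exact Subtype.ext ((coe_ev_monomialMap hU hV h₁ h₂ (hUV a ha) y).symm.trans
        (congrArg Subtype.val hy))
    · exact monomialModule_eq_zero hU ha y
  · by_cases ha : a ∈ U
    · refine ⟨⟨y.1, fun h => absurd ha h⟩, Subtype.ext ?_⟩
      exact coe_ev_monomialMap hU hV h₁ h₂ (hUV a ha) _
    · refine ⟨0, ?_⟩
      rw [map_zero]
      by_cases haV : a ∈ V
      · have haW : a ∈ W := (hVU ▸ haV : a ∈ U ∪ W).resolve_left ha
        exact Subtype.ext ((congrArg Subtype.val hy).symm.trans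
          (coe_ev_monomialMap hV hW h₃ h₄ haW y))
      · exact (monomialModule_eq_zero hV haV y).symm
  · by_cases ha : a ∈ W
    · refine ⟨⟨y.1, fun h => absurd (hWV a ha) h⟩, Subtype.ext ?_⟩
      exact coe_ev_monomialMap hV hW h₃ h₄ ha _
    · refine ⟨0, ?_⟩
      rw [map_zero]
      exact (monomialModule_eq_zero hW ha y).symm

lemma monomialMap_comp_eq_zero (hd : Disjoint U W)
    (h₁ : ∀ a b, a ≤ b → a ∈ U → b ∈ U → b ∈ V → a ∈ V)
    (h₂ : ∀ a b, a ≤ b → a ∈ U → a ∈ V → b ∈ V → b ∈ U)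
    (h₃ : ∀ a b, a ≤ b → a ∈ V → b ∈ V → b ∈ W → a ∈ W)
    (h₄ : ∀ a b, a ≤ b → a ∈ V → a ∈ W → b ∈ W → b ∈ V) :
    monomialMap k hU hV h₁ h₂ ≫ monomialMap k hV hW h₃ h₄ = 0 :=
  hom_ext_ev fun a x => by
    by_cases ha : a ∈ W
    · rw [monomialModule_eq_zero hU (fun h => Set.disjoint_left.1 hd h ha) x, map_zero, map_zero]
    · exact monomialModule_eq_zero hW ha _

lemma nonempty_monomialModule_iso (h : U = V) :
    Nonempty (monomialModule k U hU ≅ monomialModule k V hV) := by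
  subst h
  exact ⟨Iso.refl _⟩

lemma nonempty_shift_monomialModule_iso (a : Deg n) (h : V = {b | a + b ∈ U}) :
    Nonempty (shift (monomialModule k U hU) a ≅ monomialModule k V hV) := by
  classical
  subst h
  refine ⟨NatIso.ofComponents (fun b => Iso.refl _) fun {b c} f => ?_⟩
  refine ModuleCat.hom_ext (LinearMap.ext fun y => Subtype.ext ?_)
  exact (mulMap_coe_monomialModule hU (add_le_add_right (leOfHom f) a) y).trans
    (mulMap_coe_monomialModule hV (leOfHom f) y).symm

end Monomial

/-! ## `Ext(S/P_G, ω_S)` -/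

section FaceModules

/-- The degrees `c ≥ b` with `c_j = b_j` for `j ∈ J`. -/
def coneSet (J : Finset (Fin n)) (b : Deg n) : Set (Deg n) :=
  {c | b ≤ c ∧ ∀ j ∈ J, (c j : ℤ) = b j}

lemma coneSet_ordConnected (J : Finset (Fin n)) (b : Deg n) : (coneSet J b).OrdConnected :=
  ⟨fun _ hx _ hy _ hz => ⟨hx.1.trans hz.1, fun j hj =>
    le_antisymm ((hz.2 j).trans (hy.2 j hj).le) ((hx.1.trans hz.1) j)⟩⟩

/-- The module `(S/(x_j | j ∈ J))(-b)`. -/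
abbrev faceModule (k : Type u) [Field k] (J : Finset (Fin n)) (b : Deg n) : GrMod k n :=
  monomialModule k (coneSet J b) (coneSet_ordConnected J b)

lemma self_mem_coneSet (J : Finset (Fin n)) (b : Deg n) : b ∈ coneSet J b :=
  ⟨le_rfl, fun _ _ => rfl⟩

/-- The short exact sequence given by multiplication by `x_j` on `S/(x_i | i ∈ J)`. -/
lemma exists_face_shortExact (J : Finset (Fin n)) (b : Deg n) {j : Fin n} (hj : j ∉ J) :
    ∃ S : ShortComplex (GrMod k n), S.ShortExact ∧ S.X₁ = faceModule k J (b + unitDeg j) ∧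
      S.X₂ = faceModule k J b ∧ S.X₃ = faceModule k (insert j J) b ∧
      (J = ∅ → ∀ B : GrMod k n, Function.Bijective (mulMap B (le_add_unitDeg b j)) →
        Function.Bijective (fun f : S.X₂ ⟶ B => S.f ≫ f)) := by
  have hbj : ∀ i ∈ J, ((b + unitDeg j) i : ℤ) = b i := fun i hi => by
    have : i ≠ j := fun h => hj (h ▸ hi)
    simp [deg_add_apply, unitDeg_apply, this]
  have hbj' : ((b + unitDeg j) j : ℤ) = b j + (1 : ℤ) := by
    simp [deg_add_apply, unitDeg_apply]
  have hle : ∀ c : Deg n, b + unitDeg j ≤ c ↔ b ≤ c ∧ (b j : ℤ) + (1 : ℤ) ≤ c j := by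
    intro c
    constructor
    · intro h
      exact ⟨(le_add_unitDeg b j).trans h, hbj' ▸ h j⟩
    · rintro ⟨h1, h2⟩ i
      by_cases hi : i = j
      · subst hi
        rw [hbj']
        exact h2
      · have : ((b + unitDeg j) i : ℤ) = b i := by simp [deg_add_apply, unitDeg_apply, hi]
        rw [this]
        exact h1 i
  have hVU : coneSet J b = coneSet J (b + unitDeg j) ∪ coneSet (insert j J) b := by
    ext c
    constructor
    · rintro ⟨h1, h2⟩
      by_cases hc : (c j : ℤ) = b j
      · refine Or.inr ⟨h1, fun i hi => ?_⟩
        rcases Finset.mem_insert.1 hi with rfl | hi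
        · exact hc
        · exact h2 i hi
      · refine Or.inl ⟨(hle c).2 ⟨h1, ?_⟩, fun i hi => (h2 i hi).trans (hbj i hi).symm⟩
        have := h1 j
        have h3 : (b j : ℤ) ≤ c j := this
        omega
    · rintro (⟨h1, h2⟩ | ⟨h1, h2⟩)
      · exact ⟨((hle c).1 h1).1, fun i hi => (h2 i hi).trans (hbj i hi)⟩
      · exact ⟨h1, fun i hi => h2 i (Finset.mem_insert_of_mem hi)⟩
  have hd : Disjoint (coneSet J (b + unitDeg j)) (coneSet (insert j J) b) := by
    rw [Set.disjoint_left]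
    rintro c ⟨h1, -⟩ ⟨-, h2⟩
    have h3 := ((hle c).1 h1).2
    have h4 := h2 j (Finset.mem_insert_self _ _)
    omega
  have hup : ∀ a c : Deg n, a ≤ c → a ∈ coneSet J (b + unitDeg j) → c ∈ coneSet J b →
      c ∈ coneSet J (b + unitDeg j) := by
    rintro a c hac ⟨h1, -⟩ ⟨-, h2⟩
    exact ⟨h1.trans hac, fun i hi => (h2 i hi).trans (hbj i hi).symm⟩
  have h₁ : ∀ a c : Deg n, a ≤ c → a ∈ coneSet J (b + unitDeg j) →
      c ∈ coneSet J (b + unitDeg j) → c ∈ coneSet J b → a ∈ coneSet J b :=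
    fun a c _ ha _ _ => hVU ▸ Or.inl ha
  have h₃ : ∀ a c : Deg n, a ≤ c → a ∈ coneSet J b → c ∈ coneSet J b →
      c ∈ coneSet (insert j J) b → a ∈ coneSet (insert j J) b := by
    intro a c hac ha hc hc'
    rw [hVU] at ha
    exact ha.resolve_left fun h => Set.disjoint_left.1 hd (hup a c hac h hc) hc'
  refine ⟨_, monomial_shortExact (coneSet_ordConnected J (b + unitDeg j))
    (coneSet_ordConnected J b) (coneSet_ordConnected (insert j J) b) hVU h₁
    (fun a c h ha _ hc => hup a c h ha hc) h₃ (fun a c _ _ _ hc => hVU ▸ Or.inr hc)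
    (monomialMap_comp_eq_zero _ _ _ hd _ _ _ _), rfl, rfl, rfl, ?_⟩
  rintro rfl B hB
  have hb' : b + unitDeg j ∈ coneSet ∅ b := ⟨le_add_unitDeg b j, by simp⟩
  -- Under `Hom(S(-b), B) = B_b`, precomposition with the inclusion of `S(-b - e_j)` becomes
  -- multiplication by `x_j` on `B`.
  have key : ∀ f : faceModule k ∅ b ⟶ B,
      ev (monomialMap k (coneSet_ordConnected ∅ (b + unitDeg j)) (coneSet_ordConnected ∅ b) h₁
        (fun a c h ha _ hc => hup a c h ha hc) ≫ f) (b + unitDeg j)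
        (monomialGen _ (self_mem_coneSet ∅ (b + unitDeg j))) =
      mulMap B (le_add_unitDeg b j) (ev f b (monomialGen (coneSet_ordConnected ∅ b)
          (self_mem_coneSet ∅ b))) := by
    intro f
    rw [ev_comp, ← ev_mulMap]
    refine congrArg (ev f _) ?_
    refine Eq.trans (Subtype.ext ?_) (mulMap_monomialGen _ (self_mem_coneSet ∅ b) hb' _).symm
    exact coe_ev_monomialMap _ _ _ _ hb' _
  constructor
  · intro f g hfg
    refine monomial_hom_ext (hU := coneSet_ordConnected _ _) (fun a ha => ha.1)
      (self_mem_coneSet ∅ b) (hB.1 ?_)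
    refine (key f).symm.trans (Eq.trans ?_ (key g))
    exact congrArg (fun h => ev h _ _) hfg
  · intro g
    obtain ⟨y, hy⟩ := hB.2 (ev g _ (monomialGen _ (self_mem_coneSet ∅ (b + unitDeg j))))
    refine ⟨monomialDesc (coneSet_ordConnected ∅ b) (fun a ha => ha.1) B y
      fun a ha ha' => absurd ⟨ha, by simp⟩ ha', ?_⟩
    refine monomial_hom_ext (hU := coneSet_ordConnected _ _) (fun a ha => ha.1)
        (self_mem_coneSet ∅ (b + unitDeg j)) ?_
    refine (key _).trans ?_
    rw [ev_monomialDesc_gen_self, hy]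

instance (b : Deg n) : Projective (faceModule k ∅ b) where
  factors {E X} f e he := by
    obtain ⟨y, hy⟩ := (epi_iff_ev e).1 he b (ev f b (monomialGen (coneSet_ordConnected ∅ b)
        (self_mem_coneSet ∅ b)))
    refine ⟨monomialDesc (coneSet_ordConnected ∅ b) (fun a ha => ha.1) E y
      fun a ha ha' => absurd ⟨ha, by simp⟩ ha', ?_⟩
    refine monomial_hom_ext (hU := coneSet_ordConnected _ _) (fun a ha => ha.1)
        (self_mem_coneSet ∅ b) ?_
    rw [ev_comp, ev_monomialDesc_gen_self, hy]

/-- Morphisms from `S(-b)` are elements of degree `b`. -/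
def faceHomEquiv (b : Deg n) (B : GrMod k n) : (faceModule k ∅ b ⟶ B) ≃ₗ[k] B.obj b :=
  LinearEquiv.ofBijective
    { toFun := fun f => ev f b (monomialGen (coneSet_ordConnected ∅ b) (self_mem_coneSet ∅ b))
      map_add' := fun _ _ => rfl
      map_smul' := fun _ _ => rfl }
    ⟨fun f g h => monomial_hom_ext (hU := coneSet_ordConnected _ _) (fun a ha => ha.1)
        (self_mem_coneSet ∅ b) h, fun y =>
      ⟨monomialDesc (coneSet_ordConnected ∅ b) (fun a ha => ha.1) B y
        fun a ha ha' => absurd ⟨ha, by simp⟩ ha', ev_monomialDesc_gen_self _ _ _ _ _ _⟩⟩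

open Abelian

variable [HasExt.{u + 1} (GrMod k n)]

/-- Multiplication by `x_j` on `S(-c)` from degree `b` to `b + e_j` is bijective unless `b_j + 1 =
c_j`, so the exact sequence for `x_j` on `S(-b)` gives vanishing for `J = ∅`. The sequences for the
other variables shift `b` without changing `b_j`, so the induction goes through. -/
lemma subsingleton_ext_faceModule_of_mem (c : Deg n) (J : Finset (Fin n)) (j : Fin n)
    (hj : j ∉ J) : ∀ b : Deg n, ((b j : ℤ) + (1 : ℤ) ≠ c j) → ∀ l,
    Subsingleton (Ext (faceModule k (insert j J) b) (faceModule k ∅ c) l) := by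
  classical
  induction J using Finset.induction_on with
  | empty =>
    intro b hb l
    obtain ⟨S, hS, e₁, e₂, e₃, h⟩ := exists_face_shortExact (k := k) ∅ b hj
    have p : ∀ b', ∀ l, 0 < l → Subsingleton (Ext (faceModule k ∅ b') (faceModule k ∅ c) l) :=
      fun b' l hl => by
        obtain ⟨l, rfl⟩ := Nat.exists_eq_succ_of_ne_zero hl.ne'
        exact Ext.subsingleton_of_projective _ _ _
    rw [← e₃]
    refine ext_subsingleton₃_of_bijective hS _ (h rfl _ ?_) (e₁ ▸ p _) (e₂ ▸ p _) l
    have hiff : b + unitDeg j ∈ coneSet ∅ c ↔ b ∈ coneSet ∅ c := by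
      constructor
      · rintro ⟨h1, -⟩
        refine ⟨fun i => ?_, by simp⟩
        have h2 : (c i : ℤ) ≤ (b + unitDeg j) i := h1 i
        rw [deg_add_apply, unitDeg_apply] at h2
        change (c i : ℤ) ≤ b i
        split_ifs at h2 with hi
        · subst hi
          omega
        · omega
      · rintro ⟨h1, -⟩
        exact ⟨h1.trans (le_add_unitDeg b j), by simp⟩
    by_cases hbc : b ∈ coneSet ∅ c
    · constructor
      · refine (injective_iff_map_eq_zero _).2 fun y hy => Subtype.ext ?_
        have h1 := (mulMap_coe_monomialModule (k := k) (coneSet_ordConnected ∅ c)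
          (le_add_unitDeg b j) y)
        classical
        rw [if_pos (hiff.2 hbc)] at h1
        exact h1.symm.trans (congrArg Subtype.val hy)
      · intro y
        refine ⟨(y.1 : k) • monomialGen _ hbc, ?_⟩
        rw [map_smul]
        refine Eq.trans ?_ (eq_smul_monomialGen _ (hiff.2 hbc) y).symm
        exact congrArg _ (mulMap_monomialGen _ _ _ _)
    · constructor
      · intro x y _
        exact (monomialModule_eq_zero _ hbc x).trans (monomialModule_eq_zero _ hbc y).symm
      · intro y
        exact ⟨0, (map_zero _).trans (monomialModule_eq_zero _ (fun h => hbc (hiff.1 h)) y).symm⟩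
  | insert i J hi ih =>
    intro b hb l
    have hji : j ≠ i := fun h => hj (h ▸ Finset.mem_insert_self _ _)
    have hjJ : j ∉ J := fun h => hj (Finset.mem_insert_of_mem h)
    have hi' : i ∉ insert j J := by simp [hi, hji.symm]
    obtain ⟨S, hS, e₁, e₂, e₃, -⟩ := exists_face_shortExact (k := k) (insert j J) b hi'
    rw [Finset.insert_comm, ← e₃]
    refine ext_subsingleton₃ hS _ (e₁ ▸ ih hjJ _ ?_) (e₂ ▸ ih hjJ _ hb) l
    rw [deg_add_apply, unitDeg_apply, if_neg hji, add_zero]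
    exact hb

/-- `S(-c)` is zero in degrees whose `i`-th coordinate is below `c_i`, and the exact sequences for
variables other than `x_i` never change `b_i`. -/
lemma subsingleton_ext_faceModule_of_notMem (c : Deg n) (i : Fin n) (J : Finset (Fin n))
    (hi : i ∉ J) : ∀ b : Deg n, (b i : ℤ) < c i → ∀ l,
    Subsingleton (Ext (faceModule k J b) (faceModule k ∅ c) l) := by
  classical
  induction J using Finset.induction_on with
  | empty =>
    intro b hb l
    cases l with
    | zero =>
      refine ((Ext.linearEquiv₀ (R := k)).trans
        (faceHomEquiv b (faceModule k ∅ c))).toEquiv.subsingleton_congr.2 ?_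
      refine ⟨fun x y => ?_⟩
      have hbc : b ∉ coneSet ∅ c := fun h => absurd (h.1 i) (not_le.2 hb)
      exact (monomialModule_eq_zero _ hbc x).trans (monomialModule_eq_zero _ hbc y).symm
    | succ l => exact Ext.subsingleton_of_projective _ _ _
  | insert j J hj ih =>
    intro b hb l
    have hij : i ≠ j := fun h => hi (h ▸ Finset.mem_insert_self _ _)
    have hiJ : i ∉ J := fun h => hi (Finset.mem_insert_of_mem h)
    obtain ⟨S, hS, e₁, e₂, e₃, -⟩ := exists_face_shortExact (k := k) J b hj
    rw [← e₃]
    refine ext_subsingleton₃ hS _ (e₁ ▸ ih hiJ _ ?_) (e₂ ▸ ih hiJ _ hb) l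
    rw [deg_add_apply, unitDeg_apply, if_neg hij, add_zero]
    exact hb

/-- For `J = ∅` this is the line `S(-c)_b`. In the exact sequence for a new variable `x_j`, the
middle term has `b_j < c_j` and hence no Ext, so each variable raises the Ext degree by one. -/
lemma rank_ext_faceModule (c : Deg n) (J : Finset (Fin n)) : ∀ b : Deg n,
    (∀ j ∈ J, (b j : ℤ) + (1 : ℤ) = c j) → (∀ i ∉ J, (c i : ℤ) ≤ b i) → ∀ l,
    Module.rank k (Ext (faceModule k J b) (faceModule k ∅ c) l) = if l = J.card then 1 else 0 := by
  classical
  induction J using Finset.induction_on with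
  | empty =>
    intro b _ hb l
    cases l with
    | zero =>
      have hbc : b ∈ coneSet ∅ c := ⟨fun i => hb i (by simp), by simp⟩
      rw [Finset.card_empty, if_pos rfl]
      have e : (faceModule k ∅ c).obj b ≃ₗ[k] k := LinearEquiv.ofBijective
        (monomialCoeff k (coneSet_ordConnected ∅ c) b)
        ⟨Subtype.val_injective, fun y => ⟨⟨y, fun h => absurd hbc h⟩, rfl⟩⟩
      have := (((Ext.linearEquiv₀ (R := k)).trans
        (faceHomEquiv b (faceModule k ∅ c))).trans e).lift_rank_eq
      rw [Module.rank_self] at this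
      simpa using this
    | succ l =>
      have := Ext.subsingleton_of_projective (faceModule k ∅ b) (faceModule k ∅ c) l
      rw [Finset.card_empty, if_neg (Nat.succ_ne_zero l)]
      exact rank_subsingleton' k _
  | insert j J hj ih =>
    intro b h1 h2 l
    obtain ⟨S, hS, e₁, e₂, e₃, -⟩ := exists_face_shortExact (k := k) J b hj
    have hn : ∀ l, Subsingleton (Ext S.X₂ (faceModule k ∅ c) l) := e₂ ▸
      subsingleton_ext_faceModule_of_notMem c j J hj b (by
        have := h1 j (Finset.mem_insert_self _ _)
        omega)
    have h3 : ∀ l, Module.rank k (Ext S.X₁ (faceModule k ∅ c) l) =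
        if l = J.card then 1 else 0 := e₁ ▸ ih (b + unitDeg j) (fun i hi => by
          have hij : i ≠ j := fun h => hj (h ▸ hi)
          rw [deg_add_apply, unitDeg_apply, if_neg hij, add_zero]
          exact h1 i (Finset.mem_insert_of_mem hi)) (fun i hi => by
          rw [deg_add_apply, unitDeg_apply]
          split_ifs with hij
          · subst hij
            exact (h1 i (Finset.mem_insert_self _ _)).ge
          · rw [add_zero]
            exact h2 i (by simp [hij, hi]))
    rw [← e₃, Finset.card_insert_of_notMem hj]
    cases l with
    | zero =>
      rw [if_neg (Nat.succ_ne_zero _).symm]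
      have : Subsingleton (Ext S.X₃ (faceModule k ∅ c) 0) := by
        refine subsingleton_of_forall_eq 0 fun x => ?_
        have := hS.epi_g
        have := hn 0
        exact Ext.precomp_mk₀_injective_of_epi _ S.g (Subsingleton.elim _ _)
      exact rank_subsingleton' k _
    | succ l =>
      rw [← (nonempty_ext_linearEquiv_succ k hS _ hn l).some.rank_eq, h3]
      simp

end FaceModules

/-! ### Ext from the modules S/P_G to shifts of the canonical module -/

section GradedExt

lemma nonempty_quotPrime_iso (G : Finset (Fin n)) :
    Nonempty (quotPrime k G ≅ faceModule k Gᶜ 0) :=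
  nonempty_monomialModule_iso _ _ (by
    ext c
    simp only [coneSet, Set.mem_ofPred_eq, Finset.mem_compl]
    rfl)

/-- The generator moves to degree `(1, …, 1) - F`, the indicator of `Fᶜ`. -/
lemma nonempty_shift_omega_iso (F : Finset (Fin n)) :
    Nonempty (shift (omega k n) (ind F) ≅ faceModule k ∅ (ind Fᶜ)) := by
  obtain ⟨e⟩ := nonempty_shift_monomialModule_iso (k := k) (U := Set.Ici 0) Set.ordConnected_Ici
    (coneSet_ordConnected ∅ (ones n)) (-ones n) (by
      ext c
      simp only [coneSet, Set.mem_ofPred_eq, Finset.notMem_empty, false_imp_iff, implies_true,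
        and_true, Set.mem_Ici]
      refine forall_congr' fun i => ?_
      change (1 : ℤ) ≤ c i ↔ (0 : ℤ) ≤ (-1 : ℤ) + c i
      omega)
  obtain ⟨e'⟩ := nonempty_shift_monomialModule_iso (k := k) (coneSet_ordConnected ∅ (ones n))
    (coneSet_ordConnected ∅ (ind Fᶜ)) (ind F) (by
      ext c
      simp only [coneSet, Set.mem_ofPred_eq, Finset.notMem_empty, false_imp_iff, implies_true,
        and_true]
      refine forall_congr' fun i => ?_
      change (ind Fᶜ i : ℤ) ≤ c i ↔ (1 : ℤ) ≤ (ind F i : ℤ) + c i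
      by_cases hi : i ∈ F <;> simp [ind_apply, hi])
  exact ⟨Functor.isoWhiskerLeft (addFunctor (ind F)) e ≪≫ e'⟩

lemma isCohomologicalRank_hyperExt {C : Type w} [Category.{v} C] [Abelian C] [Linear k C]
    (B : CochainComplex C ℤ) (c : ℤ) :
    IsCohomologicalRank fun X m => Module.rank k (HyperExt X B (c - m)) := by
  let _ := HasDerivedCategory.standard C
  exact isCohomologicalRank_yoneda (R := k) DerivedCategory.Q
    (fun X m => HyperExt X B (c - m))
    (fun S hS => ⟨_, DerivedCategory.triangleOfSES_distinguished hS⟩)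
    (fun f hf => inferInstance) Function.surjective_id
    (DerivedCategory.Q.obj B) c (fun X m => hyperExtEquiv k X B (c - m))

open Abelian in
/-- Isomorphisms induce isomorphisms of Ext modules. -/
def extCongr {C : Type w} [Category.{v} C] [Abelian C] [HasExt.{w'} C] (R : Type*) [CommRing R]
    [Linear R C] {X X' Y Y' : C} (e : X ≅ X') (e' : Y ≅ Y') (l : ℕ) :
    Ext X Y l ≃ₗ[R] Ext X' Y' l :=
  LinearEquiv.ofLinearMap
    (((Ext.mk₀ e'.hom).postcompOfLinear R X' (add_zero l)).comp
      ((Ext.mk₀ e.inv).precompOfLinear R Y (zero_add l)))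
    (((Ext.mk₀ e'.inv).postcompOfLinear R X (add_zero l)).comp
      ((Ext.mk₀ e.hom).precompOfLinear R Y' (zero_add l)))
    (by
      ext x
      simp)
    (by
      ext x
      simp)

open Abelian in
-- The computation for face modules applies with `b = 0`, `c = Fᶜ`, `J = Gᶜ`. If `G ⊊ F`, an index
-- `j ∈ F \ G` has `c_j = 0 ≠ b_j + 1`; if `G ⊄ F`, an index `i ∈ G \ F` has `b_i < c_i`. Either way
-- all Ext vanish, so only `G = F` survives.
lemma rank_ext_quotPrime_omega [HasExt.{u + 1} (GrMod k n)] (F G : Finset (Fin n)) (l : ℕ) :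
    Module.rank k (Ext (quotPrime k G) (shift (omega k n) (ind F)) l) =
      if G = F ∧ l = n - F.card then 1 else 0 := by
  classical
  obtain ⟨e₁⟩ := nonempty_quotPrime_iso (k := k) G
  obtain ⟨e₂⟩ := nonempty_shift_omega_iso (k := k) F
  have e : Ext (quotPrime k G) (shift (omega k n) (ind F)) l ≃ₗ[k]
      Ext (faceModule k Gᶜ 0) (faceModule k ∅ (ind Fᶜ)) l := extCongr k e₁ e₂ l
  rw [e.rank_eq]
  by_cases h : G = F
  · subst h
    rw [rank_ext_faceModule, Finset.card_compl, Fintype.card_fin]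
    · simp
    · intro j hj
      rw [ind_apply, if_pos hj, deg_zero_apply, zero_add]
    · intro j hj
      rw [ind_apply, if_neg hj, deg_zero_apply]
  · rw [if_neg fun h' => h h'.1]
    have : Subsingleton (Ext (faceModule k Gᶜ 0) (faceModule k ∅ (ind Fᶜ)) l) := by
      by_cases hGF : G ⊆ F
      · obtain ⟨j, hjF, hjG⟩ := Finset.not_subset.1 fun h' => h (hGF.antisymm h')
        have hj : j ∈ Gᶜ := Finset.mem_compl.2 hjG
        rw [← Finset.insert_erase hj]
        refine subsingleton_ext_faceModule_of_mem _ _ j (Finset.notMem_erase _ _) _ ?_ l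
        rw [ind_apply, if_neg (by simpa using hjF), deg_zero_apply]
        norm_num
      · obtain ⟨i, hiG, hiF⟩ := Finset.not_subset.1 hGF
        refine subsingleton_ext_faceModule_of_notMem _ i _ (by simpa using hiG) _ ?_ l
        rw [ind_apply, if_pos (by simpa using hiF), deg_zero_apply]
        norm_num
    exact rank_subsingleton' k _

/-- The only Ext group of `S/P_F` has degree `n - |F|`, and placing the module in cohomological
degree `t` lowers this by `t`. The index is normalized so that this happens at `m = t`. -/
lemma rank_hyperExt_singleAt_quotPrime (F G : Finset (Fin n)) (t m : ℤ) :
    Module.rank k (HyperExt (singleAt t (quotPrime k G)) (single (shift (omega k n) (ind F)))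
      ((n : ℤ) - F.card - m)) = if G = F ∧ t = m then 1 else 0 := by
  have hF : F.card ≤ n := (Finset.card_le_univ F).trans (Fintype.card_fin n).le
  by_cases h : (n : ℤ) - F.card - m + t - 0 < 0
  · have := subsingleton_hyperExt_single_of_neg (quotPrime k G) (shift (omega k n) (ind F)) t 0
      ((n : ℤ) - F.card - m) h
    rw [if_neg fun h' => by omega]
    exact @rank_subsingleton' k _ _ _ _ _ this
  · have := HasExt.standard (GrMod k n)
    obtain ⟨l, hl⟩ := Int.eq_ofNat_of_zero_le (not_lt.1 h)
    obtain ⟨e⟩ := nonempty_hyperExt_single_linearEquiv_ext k (quotPrime k G)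
      (shift (omega k n) (ind F)) t 0 _ l hl.symm
    refine e.rank_eq.trans ((rank_ext_quotPrime_omega F G l).trans ?_)
    refine if_congr (and_congr_right fun _ => ?_) rfl rfl
    omega

end GradedExt

/-! ## Ext from quotients by regular sequences -/

section RegularExt

open Abelian

variable {R : Type u} [CommRing R] [HasExt.{w} (ModuleCat.{u} R)] {ι : Type*}

/-- If the elements `x_j` are successively regular on `R`, and `x_j` acts surjectively on the
elements of `E` killed by any of the others, then `Ext^l(R/(x_j), E) = 0` for `l > 0`. -/
lemma subsingleton_ext_quotient_span (x : ι → R) (E : ModuleCat.{u} R) (U : Finset ι)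
    (hreg : ∀ T ⊆ U, ∀ j ∈ U, j ∉ T → ∀ r, x j * r ∈ Ideal.span (x '' (T : Set ι)) →
      r ∈ Ideal.span (x '' (T : Set ι)))
    (hdiv : ∀ T ⊆ U, ∀ j ∈ U, j ∉ T → ∀ e : E, (∀ i ∈ T, x i • e = 0) →
      ∃ e' : E, (∀ i ∈ T, x i • e' = 0) ∧ x j • e' = e)
    (T : Finset ι) (hT : T ⊆ U) (l : ℕ) (hl : 0 < l) :
    Subsingleton (Ext (ModuleCat.of R (R ⧸ Ideal.span (x '' (T : Set ι)))) E l) := by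
  classical
  induction T using Finset.induction_on generalizing l with
  | empty =>
    have : Module.Projective R (R ⧸ Ideal.span (x '' ((∅ : Finset ι) : Set ι))) :=
      Module.Projective.of_equiv (Submodule.quotEquivOfEqBot _ (by simp)).symm
    have : Projective (ModuleCat.of R (R ⧸ Ideal.span (x '' ((∅ : Finset ι) : Set ι)))) :=
      (IsProjective.iff_projective _).1 this
    obtain ⟨l, rfl⟩ := Nat.exists_eq_succ_of_ne_zero hl.ne'
    exact Ext.subsingleton_of_projective _ _ _
  | insert j T hj ih =>
    have hTU : T ⊆ U := (Finset.subset_insert j T).trans hT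
    have hjU : j ∈ U := hT (Finset.mem_insert_self j T)
    let I := Ideal.span (x '' (T : Set ι))
    let J := Ideal.span (x '' ((insert j T : Finset ι) : Set ι))
    have hJ : ∀ r, r ∈ J ↔ ∃ a, ∃ z ∈ I, r = a * x j + z := fun r => by
      simp only [J, I, Finset.coe_insert, Set.image_insert_eq, Ideal.mem_span_insert]
    have hIJ : I ≤ J := Ideal.span_mono (Set.image_mono (by simp))
    let S : ShortComplex (ModuleCat.{u} R) := ShortComplex.mk
      (ModuleCat.ofHom (LinearMap.lsmul R (R ⧸ I) (x j)))
      (ModuleCat.ofHom (Submodule.factor hIJ)) (by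
        refine ModuleCat.hom_ext (LinearMap.ext fun r => ?_)
        obtain ⟨r, rfl⟩ := Submodule.Quotient.mk_surjective _ r
        refine (Submodule.Quotient.mk_eq_zero J).2 ((hJ _).2 ⟨r, 0, I.zero_mem, ?_⟩)
        exact (mul_comm (x j) r).trans (add_zero _).symm)
    have hS : S.ShortExact :=
      { exact := by
          rw [ShortComplex.moduleCat_exact_iff]
          intro r hr
          obtain ⟨r, rfl⟩ := Submodule.Quotient.mk_surjective _ r
          obtain ⟨a, z, hz, h⟩ := (hJ r).1 ((Submodule.Quotient.mk_eq_zero J).1 hr)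
          refine ⟨Submodule.Quotient.mk a, (Submodule.Quotient.eq I).2 ?_⟩
          have h' : x j * a - r = -z := by rw [h]; ring
          change x j * a - r ∈ I
          exact h' ▸ I.neg_mem hz
        mono_f := by
          rw [ModuleCat.mono_iff_injective]
          refine (injective_iff_map_eq_zero _).2 fun r hr => ?_
          obtain ⟨r, rfl⟩ := Submodule.Quotient.mk_surjective _ r
          exact (Submodule.Quotient.mk_eq_zero I).2 (hreg T hTU j hjU hj r
            ((Submodule.Quotient.mk_eq_zero I).1 hr))
        epi_g := by
          rw [ModuleCat.epi_iff_surjective]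
          intro r
          obtain ⟨r, rfl⟩ := Submodule.Quotient.mk_surjective _ r
          exact ⟨Submodule.Quotient.mk r, rfl⟩ }
    refine ext_subsingleton₃_of_surjective hS E (fun g => ?_) (fun l => ih hTU l)
      (fun l => ih hTU l) l hl
    -- A map `R/I ⟶ E` is an element of `E` killed by the `x_i`, `i ∈ T`. Dividing it by `x_j` among
    -- such elements factors `g` through multiplication by `x_j`.
    obtain ⟨e', he', h⟩ := hdiv T hTU j hjU hj (g.hom (Submodule.Quotient.mk 1)) fun i hi => by
      rw [← map_smul, ← Submodule.Quotient.mk_smul]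
      refine (congrArg g.hom ((Submodule.Quotient.mk_eq_zero I).2 ?_)).trans (map_zero _)
      rw [smul_eq_mul, mul_one]
      exact Ideal.subset_span ⟨i, hi, rfl⟩
    have hI : I ≤ LinearMap.ker (LinearMap.toSpanSingleton R E e') := by
      refine Ideal.span_le.2 ?_
      rintro _ ⟨i, hi, rfl⟩
      exact he' i hi
    refine ⟨ModuleCat.ofHom (I.liftQ (LinearMap.toSpanSingleton R E e') hI), ?_⟩
    refine ModuleCat.hom_ext (LinearMap.ext fun r => ?_)
    obtain ⟨r, rfl⟩ := Submodule.Quotient.mk_surjective _ r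
    change (x j • r) • e' = g.hom (Submodule.Quotient.mk r)
    rw [smul_eq_mul, mul_comm, mul_smul, h, ← map_smul, ← Submodule.Quotient.mk_smul, smul_eq_mul,
      mul_one]

omit [HasExt.{w} (ModuleCat.{u} R)] in
/-- If the socle of `E` is generated by a nonzero element, then `Hom(R/𝔪, E) ≅ R/𝔪`. -/
lemma nonempty_hom_quotient_linearEquiv (m : Ideal R) [hm : m.IsMaximal] (E : ModuleCat.{u} R)
    (s : E) (h0 : s ≠ 0) (hs : ∀ r ∈ m, r • s = 0)
    (hgen : ∀ e : E, (∀ r ∈ m, r • e = 0) → ∃ r : R, e = r • s) :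
    Nonempty ((ModuleCat.of R (R ⧸ m) ⟶ E) ≃ₗ[R] R ⧸ m) := by
  let φ : ModuleCat.of R (R ⧸ m) ⟶ E :=
    ModuleCat.ofHom (m.liftQ (LinearMap.toSpanSingleton R E s) hs)
  have hφ : ∀ r : R, φ.hom (Submodule.Quotient.mk r) = r • s := fun r => rfl
  let ψ : R →ₗ[R] (ModuleCat.of R (R ⧸ m) ⟶ E) := LinearMap.toSpanSingleton R _ φ
  have hψ : Function.Surjective ψ := fun g => by
    obtain ⟨r, hr⟩ := hgen (g.hom (Submodule.Quotient.mk 1)) fun r hr => by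
      rw [← map_smul, ← Submodule.Quotient.mk_smul]
      refine (congrArg g.hom ((Submodule.Quotient.mk_eq_zero m).2 ?_)).trans (map_zero _)
      rwa [smul_eq_mul, mul_one]
    refine ⟨r, ModuleCat.hom_ext (LinearMap.ext fun a => ?_)⟩
    obtain ⟨a, rfl⟩ := Submodule.Quotient.mk_surjective _ a
    change r • a • s = g.hom (Submodule.Quotient.mk a)
    rw [smul_comm, ← hr, ← map_smul, ← Submodule.Quotient.mk_smul, smul_eq_mul, mul_one]
  have hker : LinearMap.ker ψ = m := by
    refine (hm.eq_of_le (fun h => h0 ?_) fun r hr => ?_).symm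
    · have h1 : ψ 1 = 0 := (Ideal.eq_top_iff_one _).1 h
      have h2 := congrArg (fun g => g.hom (Submodule.Quotient.mk (1 : R))) h1
      change (1 : R) • (1 : R) • s = 0 at h2
      rwa [one_smul, one_smul] at h2
    · refine ModuleCat.hom_ext (LinearMap.ext fun a => ?_)
      obtain ⟨a, rfl⟩ := Submodule.Quotient.mk_surjective _ a
      change r • a • s = 0
      rw [smul_comm, hs r hr, smul_zero]
  exact ⟨((Submodule.quotEquivOfEq _ _ hker).symm.trans (ψ.quotKerEquivOfSurjective hψ)).symm⟩

/-- If `r` acts bijectively on `E` and as zero on `X`, then `Ext(X, E) = 0`. -/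
lemma subsingleton_ext_of_bijective (r : R) (X E : ModuleCat.{u} R) (hX : ∀ y : X, r • y = 0)
    (hE : Function.Bijective fun e : E => r • e) (l : ℕ) : Subsingleton (Ext X E l) := by
  have h1 : r • 𝟙 X = 0 := ModuleCat.hom_ext (LinearMap.ext hX)
  have : IsIso (r • 𝟙 E) := (ConcreteCategory.isIso_iff_bijective _).2 hE
  refine subsingleton_of_forall_eq 0 fun z => ?_
  -- Multiplication by `r` on Ext can be computed on either argument: it is zero through `X` and
  -- invertible through `E`.
  have h2 : z.comp (Ext.mk₀ (r • 𝟙 E)) (add_zero l) = 0 := by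
    rw [Ext.mk₀_smul, Ext.comp_smul, Ext.comp_mk₀_id, ← Ext.mk₀_id_comp z, ← Ext.smul_comp,
      ← Ext.mk₀_smul, h1, Ext.mk₀_zero, Ext.zero_comp]
  have h3 : (z.comp (Ext.mk₀ (r • 𝟙 E)) (add_zero l)).comp (Ext.mk₀ (inv (r • 𝟙 E)))
      (add_zero l) = z := by
    rw [Ext.comp_assoc_of_third_deg_zero, Ext.mk₀_comp_mk₀, IsIso.hom_inv_id, Ext.comp_mk₀_id]
  rw [← h3, h2, Ext.zero_comp]

end RegularExt

/-! ### Torsion, divisibility and regularity under localization -/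

section Localization

variable {A : Type*} [CommRing A] (P : Submonoid A) {B : Type*} [CommRing B] [Algebra A B]
  [IsLocalization P B] {N E : Type*} [AddCommGroup N] [Module A N] [AddCommGroup E] [Module A E]
  [Module B E] [IsScalarTower A B E] (f : N →ₗ[A] E) [IsLocalizedModule P f] {ι : Type*}

include f in
lemma subsingleton_localized (h : ∀ y : N, ∃ t ∈ P, t • y = 0) : Subsingleton E := by
  refine subsingleton_of_forall_eq 0 fun e => ?_
  obtain ⟨⟨y, s⟩, rfl⟩ := IsLocalizedModule.mk'_surjective P f e
  obtain ⟨t, ht, hy⟩ := h y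
  exact (IsLocalizedModule.mk'_eq_zero' f s).2 ⟨⟨t, ht⟩, hy⟩

include P f in
omit [IsLocalization P B] in
lemma smul_bijective_localized {a : A} (h : Function.Bijective fun y : N => a • y) :
    Function.Bijective fun e : E => algebraMap A B a • e := by
  simp only [algebraMap_smul]
  constructor
  · intro e e' hee
    obtain ⟨⟨y, s⟩, hy⟩ := IsLocalizedModule.mk'_surjective P f (e - e')
    rw [← sub_eq_zero, ← hy]
    have h1 : a • (e - e') = 0 := by rw [smul_sub, sub_eq_zero]; exact hee
    rw [← hy] at h1
    change a • IsLocalizedModule.mk' f y s = 0 at h1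
    rw [← IsLocalizedModule.mk'_smul, IsLocalizedModule.mk'_eq_zero'] at h1
    obtain ⟨t, ht⟩ := h1
    refine (IsLocalizedModule.mk'_eq_zero' f s).2 ⟨t, h.1 ?_⟩
    change a • (t : A) • y = a • 0
    rw [smul_comm, smul_zero]
    exact ht
  · intro e
    obtain ⟨⟨y, s⟩, rfl⟩ := IsLocalizedModule.mk'_surjective P f e
    obtain ⟨y', rfl⟩ := h.2 y
    exact ⟨IsLocalizedModule.mk' f y' s, (IsLocalizedModule.mk'_smul f a y' s).symm⟩

omit [IsScalarTower A B E] in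
/-- An element killed by finitely many elements of the ring is a fraction whose numerator is killed
by these elements. -/
lemma exists_mk_eq_of_smul_eq_zero (x : ι → A) (T : Finset ι) (e : E)
    (he : ∀ i ∈ T, x i • e = 0) :
    ∃ (y : N) (s : P), e = IsLocalizedModule.mk' f y s ∧ ∀ i ∈ T, x i • y = 0 := by
  classical
  induction T using Finset.induction_on with
  | empty =>
    obtain ⟨⟨y, s⟩, rfl⟩ := IsLocalizedModule.mk'_surjective P f e
    exact ⟨y, s, rfl, by simp⟩
  | insert j T hj ih =>
    obtain ⟨y, s, rfl, hy⟩ := ih fun i hi => he i (Finset.mem_insert_of_mem hi)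
    have h1 := he j (Finset.mem_insert_self j T)
    rw [← IsLocalizedModule.mk'_smul, IsLocalizedModule.mk'_eq_zero'] at h1
    obtain ⟨t, ht⟩ := h1
    -- Expanding the fraction by `t` makes the numerator killed by `x_j` itself, and keeps the
    -- earlier relations.
    refine ⟨t • y, t * s, (IsLocalizedModule.mk'_cancel_left f y t s).symm, fun i hi => ?_⟩
    rcases Finset.mem_insert.1 hi with rfl | hi
    · rw [smul_comm]
      exact ht
    · rw [smul_comm, hy i hi, smul_zero]

include P in
/-- Regularity passes to localizations. -/
lemma mem_span_localization (x : ι → A) (T : Set ι) (a : A)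
    (h : ∀ r, a * r ∈ Ideal.span (x '' T) → r ∈ Ideal.span (x '' T)) (r : B)
    (hr : algebraMap A B a * r ∈ Ideal.span ((fun i => algebraMap A B (x i)) '' T)) :
    r ∈ Ideal.span ((fun i => algebraMap A B (x i)) '' T) := by
  have e : Ideal.span ((fun i => algebraMap A B (x i)) '' T) =
      Ideal.map (algebraMap A B) (Ideal.span (x '' T)) := by
    rw [Ideal.map_span, Set.image_image]
  rw [e] at hr ⊢
  obtain ⟨⟨z, s⟩, hz⟩ := (IsLocalization.mem_map_algebraMap_iff P B).1 hr
  obtain ⟨⟨b, t⟩, hb⟩ := IsLocalization.surj P r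
  dsimp only at hz hb
  have h1 : algebraMap A B (a * b * s) = algebraMap A B (z.1 * t) := by
    rw [map_mul, map_mul, map_mul, ← hb, ← hz]
    ring
  obtain ⟨c, hc⟩ := (IsLocalization.eq_iff_exists P B).1 h1
  have h2 : (c * (b * s) : A) ∈ Ideal.span (x '' T) := h _ (by
    have : a * (c * (b * s)) = c * t * z.1 := by linear_combination hc
    rw [this]
    exact Ideal.mul_mem_left _ _ z.2)
  refine (IsLocalization.mem_map_algebraMap_iff P B).2 ⟨⟨⟨_, h2⟩, t * (c * s)⟩, ?_⟩
  simp only [Submonoid.coe_mul, map_mul]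
  rw [← hb]
  ring

end Localization

/-! ## The modules `𝒵(S/P_G)` -/

section HalfModules

/-- The degrees `a` with `a_i ≤ 0` for `i ∉ G`. -/
def halfSet (G : Finset (Fin n)) : Set (Deg n) := {a | ∀ i ∉ G, (a i : ℤ) ≤ (0 : ℤ)}

lemma halfSet_ordConnected (G : Finset (Fin n)) : (halfSet G).OrdConnected :=
  ⟨fun _ _ _ hy _ hz i hi => (hz.2 i).trans (hy i hi)⟩

lemma halfSet_of_le {G : Finset (Fin n)} {a b : Deg n} (h : a ≤ b) (hb : b ∈ halfSet G) :
    a ∈ halfSet G := fun i hi => (h i).trans (hb i hi)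

/-- The module `𝒵(S/P_G)`. -/
abbrev halfModule (k : Type u) [Field k] (G : Finset (Fin n)) : GrMod k n :=
  monomialModule k (halfSet G) (halfSet_ordConnected G)

lemma nonempty_straight_monomialModule_iso {U V : Set (Deg n)} (hU : U.OrdConnected)
    (hV : V.OrdConnected) (h : V = {a | ind (posSupp a) ∈ U}) :
    Nonempty ((straightFunctor k n).obj (monomialModule k U hU) ≅ monomialModule k V hV) := by
  classical
  subst h
  refine ⟨NatIso.ofComponents (fun b => Iso.refl _) fun {b c} f => ?_⟩
  refine ModuleCat.hom_ext (LinearMap.ext fun y => Subtype.ext ?_)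
  exact (mulMap_coe_monomialModule hU (ind_mono (posSupp_mono (leOfHom f))) y).trans
    (mulMap_coe_monomialModule hV (leOfHom f) y).symm

lemma nonempty_straight_quotPrime_iso (G : Finset (Fin n)) :
    Nonempty ((straightFunctor k n).obj (quotPrime k G) ≅ halfModule k G) := by
  refine nonempty_straight_monomialModule_iso _ _ (Set.ext fun a => ?_)
  constructor
  · intro h
    refine ⟨ind_nonneg _, fun i hi => if_neg fun h' => ?_⟩
    exact absurd (mem_posSupp.1 h') (not_lt.2 (h i hi))
  · intro h i hi
    by_contra h'
    have h1 : (ind (posSupp a) i : ℤ) = (0 : ℤ) := h.2 i hi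
    rw [ind_apply, if_pos (mem_posSupp.2 (not_le.1 h'))] at h1
    exact one_ne_zero h1

variable {G : Finset (Fin n)}

open Classical in
variable (k G) in
/-- The element `x^a` in degree `a`, zero if `a` is not in `halfSet G`. -/
def halfElt (a : Deg n) : (halfModule k G).obj a :=
  ⟨if a ∈ halfSet G then 1 else 0, fun h => if_neg h⟩

variable (k G) in
/-- The element `x^a`, zero if `a` is not in `halfSet G`. -/
def halfGen (a : Deg n) : Total (halfModule k G) := totalOf (halfModule k G) a (halfElt k G a)

lemma halfGen_eq_zero {a : Deg n} (ha : a ∉ halfSet G) : halfGen k G a = 0 := by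
  refine (congrArg (totalOf (halfModule k G) a) (Subtype.ext ?_)).trans (map_zero _)
  exact if_neg ha

lemma totalOf_halfModule (a : Deg n) (y : (halfModule k G).obj a) :
    totalOf (halfModule k G) a y = monomialCoeff k (halfSet_ordConnected G) a y • halfGen k G a
        := by
  classical
  rw [halfGen, ← map_smul]
  refine congrArg _ (Subtype.ext ?_)
  change y.1 = y.1 * (if a ∈ halfSet G then 1 else 0)
  by_cases h : a ∈ halfSet G
  · rw [if_pos h, mul_one]
  · rw [if_neg h, mul_zero, y.2 h]

lemma total_halfModule_induction {p : Total (halfModule k G) → Prop} (h0 : p 0)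
    (hadd : ∀ x y, p x → p y → p (x + y)) (hgen : ∀ (c : k) (a : Deg n), a ∈ halfSet G →
      p (c • halfGen k G a)) (x : Total (halfModule k G)) : p x := by
  classical
  refine DirectSum.induction_on (motive := p) x h0 (fun a y => ?_) hadd
  have h1 : p (totalOf (halfModule k G) a y) := by
    rw [totalOf_halfModule]
    by_cases ha : a ∈ halfSet G
    · exact hgen _ a ha
    · rw [halfGen_eq_zero ha, smul_zero]
      exact h0
  exact h1

lemma total_halfModule_ext {V : Type*} [AddCommGroup V] [Module k V]
    {f g : Total (halfModule k G) →ₗ[k] V}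
    (h : ∀ a ∈ halfSet G, f (halfGen k G a) = g (halfGen k G a)) : f = g :=
  LinearMap.ext fun x => total_halfModule_induction (p := fun x => f x = g x)
    (by rw [map_zero, map_zero]) (fun x y hx hy => by rw [map_add, map_add, hx, hy])
    (fun c a ha => by rw [map_smul, map_smul, h a ha]) x

lemma monomial_smul_halfGen (b : Fin n →₀ ℕ) (c : k) (a : Deg n) :
    MvPolynomial.monomial b c • halfGen k G a = c • halfGen k G (a + expDeg b) := by
  classical
  rw [halfGen, monomial_smul_totalOf, map_smul, halfGen]
  refine congrArg _ (congrArg _ ?_)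
  refine Subtype.ext ((mulMap_coe_monomialModule _ _ _).trans ?_)
  change _ = if a + expDeg b ∈ halfSet G then (1 : k) else 0
  by_cases h : a + expDeg b ∈ halfSet G
  · rw [if_pos h, if_pos h]
    exact if_pos (halfSet_of_le (le_add_expDeg a b) h)
  · rw [if_neg h, if_neg h]

lemma expDeg_single (i : Fin n) : expDeg (Finsupp.single i 1) = unitDeg i := by
  funext j
  change ((Finsupp.single i 1 j : ℕ) : ℤ) = if j = i then 1 else 0
  rw [Finsupp.single_apply]
  split_ifs with h1 h2 h2
  · rfl
  · exact absurd h1.symm h2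
  · exact absurd h2.symm h1
  · rfl

lemma X_smul_halfGen (i : Fin n) (a : Deg n) :
    (MvPolynomial.X i : MvPolynomial (Fin n) k) • halfGen k G a = halfGen k G (a + unitDeg i) := by
  rw [MvPolynomial.X, monomial_smul_halfGen, one_smul, expDeg_single]

/-- The action of a polynomial, as a `k`-linear map. -/
def polyAction (M : GrMod k n) (p : MvPolynomial (Fin n) k) : Total M →ₗ[k] Total M :=
  AddMonoidAlgebra.lift k (Module.End k (Total M)) (Fin n →₀ ℕ) (monomialHom M) p

lemma polyAction_apply (M : GrMod k n) (p : MvPolynomial (Fin n) k) (x : Total M) :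
    polyAction M p x = p • x := rfl

lemma poly_smul_smul (M : GrMod k n) (p : MvPolynomial (Fin n) k) (c : k) (x : Total M) :
    p • c • x = c • p • x := map_smul (polyAction M p) c x

variable (k G) in
/-- Division by `x_j`. -/
def divMap (j : Fin n) : Total (halfModule k G) →ₗ[k] Total (halfModule k G) :=
  DirectSum.toModule k (Deg n) _ fun a =>
    (LinearMap.toSpanSingleton k _ (halfGen k G (a - unitDeg j))).comp
      (monomialCoeff k (halfSet_ordConnected G) a)

lemma divMap_halfGen (j : Fin n) {a : Deg n} (ha : a ∈ halfSet G) :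
    divMap k G j (halfGen k G a) = halfGen k G (a - unitDeg j) := by
  classical
  refine (DirectSum.toModule_lof k (φ := fun a =>
    (LinearMap.toSpanSingleton k _ (halfGen k G (a - unitDeg j))).comp
      (monomialCoeff k (halfSet_ordConnected G) a)) a _).trans ?_
  change (if a ∈ halfSet G then (1 : k) else 0) • halfGen k G (a - unitDeg j) = _
  rw [if_pos ha, one_smul]

/-- Lowering an exponent never leaves `halfSet G`, so every variable acts surjectively, with a
canonical section. For `j ∈ G` raising it does not leave the set either, and the section is an
inverse. -/
lemma X_smul_divMap (j : Fin n) (x : Total (halfModule k G)) :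
    (MvPolynomial.X j : MvPolynomial (Fin n) k) • divMap k G j x = x := by
  have : (polyAction _ (MvPolynomial.X j)).comp (divMap k G j) = LinearMap.id :=
    total_halfModule_ext fun a ha => by
      rw [LinearMap.comp_apply, divMap_halfGen j ha, polyAction_apply, X_smul_halfGen,
        sub_add_cancel, LinearMap.id_apply]
  exact LinearMap.congr_fun this x

lemma add_unitDeg_mem_halfSet {j : Fin n} (hj : j ∈ G) {a : Deg n} (ha : a ∈ halfSet G) :
    a + unitDeg j ∈ halfSet G := fun i hi => by
  have : i ≠ j := fun h => hi (h ▸ hj)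
  rw [deg_add_apply, unitDeg_apply, if_neg this, add_zero]
  exact ha i hi

lemma divMap_X_smul {j : Fin n} (hj : j ∈ G) (x : Total (halfModule k G)) :
    divMap k G j ((MvPolynomial.X j : MvPolynomial (Fin n) k) • x) = x := by
  have : (divMap k G j).comp (polyAction _ (MvPolynomial.X j)) = LinearMap.id :=
    total_halfModule_ext fun a ha => by
      rw [LinearMap.comp_apply, polyAction_apply, X_smul_halfGen,
        divMap_halfGen j (add_unitDeg_mem_halfSet hj ha), add_sub_cancel_right, LinearMap.id_apply]
  exact LinearMap.congr_fun this x

lemma X_smul_bijective {j : Fin n} (hj : j ∈ G) : Function.Bijective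
    fun x : Total (halfModule k G) => (MvPolynomial.X j : MvPolynomial (Fin n) k) • x :=
  ⟨Function.LeftInverse.injective (divMap_X_smul hj),
    fun x => ⟨divMap k G j x, X_smul_divMap j x⟩⟩

/-- Needed so that dividing by `x_j` preserves the elements killed by other variables. A product
`x_i x^a` vanishes only because of the `i`-th coordinate, which division by `x_j` does not change.
-/
lemma divMap_X_smul_of_ne {i j : Fin n} (hij : i ≠ j) (x : Total (halfModule k G)) :
    (MvPolynomial.X i : MvPolynomial (Fin n) k) • divMap k G j x =
      divMap k G j ((MvPolynomial.X i : MvPolynomial (Fin n) k) • x) := by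
  have : (polyAction _ (MvPolynomial.X i)).comp (divMap k G j) =
      (divMap k G j).comp (polyAction _ (MvPolynomial.X i)) :=
    total_halfModule_ext fun a ha => by
      rw [LinearMap.comp_apply, LinearMap.comp_apply, polyAction_apply, polyAction_apply,
        divMap_halfGen j ha, X_smul_halfGen, X_smul_halfGen]
      have e : a - unitDeg j + unitDeg i = a + unitDeg i - unitDeg j := sub_add_eq_add_sub _ _ _
      by_cases h : a + unitDeg i ∈ halfSet G
      · rw [divMap_halfGen j h, e]
      · rw [halfGen_eq_zero h, map_zero]
        refine halfGen_eq_zero fun h' => h fun l hl => ?_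
        have h1 := h' l hl
        have h2 := ha l hl
        rw [deg_add_apply, unitDeg_apply]
        split_ifs with hli
        · subst hli
          have h3 : ((a - unitDeg j + unitDeg l) l : ℤ) = (a l : ℤ) + (1 : ℤ) := by
            rw [e]
            change (a l : ℤ) + (unitDeg l l : ℤ) - (unitDeg j l : ℤ) = _
            rw [unitDeg_apply, unitDeg_apply, if_pos rfl, if_neg hij, sub_zero]
          rwa [h3] at h1
        · rwa [add_zero]
  exact LinearMap.congr_fun this x

/-- Induction for the elements killed by the variables in `T`. -/
lemma total_halfModule_induction_of_killed (T : Finset (Fin n)) (hT : Disjoint T G) :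
    ∀ {p : Total (halfModule k G) → Prop} (_ : p 0)
    (_ : ∀ x y, p x → p y → p (x + y)) (_ : ∀ (c : k) (a : Deg n), a ∈ halfSet G →
      (∀ j ∈ T, (a j : ℤ) = (0 : ℤ)) → p (c • halfGen k G a)) (x : Total (halfModule k G))
    (_ : ∀ j ∈ T, (MvPolynomial.X j : MvPolynomial (Fin n) k) • x = 0), p x := by
  classical
  induction T using Finset.induction_on with
  | empty =>
    intro p h0 hadd hgen x _
    exact total_halfModule_induction h0 hadd (fun c a ha => hgen c a ha (by simp)) x
  | insert j T hj ih =>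
    intro p h0 hadd hgen x hx
    have hjG : j ∉ G := Finset.disjoint_left.1 hT (Finset.mem_insert_self j T)
    -- The projector `1 - x_j⁻¹ x_j` onto the kernel of `x_j`: it fixes `x`, and it keeps `x^a` if
    -- `a_j = 0` and kills it if `a_j < 0`.
    let e : Total (halfModule k G) →ₗ[k] Total (halfModule k G) :=
      LinearMap.id - (divMap k G j).comp (polyAction _ (MvPolynomial.X j))
    have he : ∀ y, e y = y - divMap k G j ((MvPolynomial.X j : MvPolynomial (Fin n) k) • y) :=
      fun y => rfl
    have hex : e x = x := by
      rw [he, hx j (Finset.mem_insert_self j T), map_zero, sub_zero]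
    rw [← hex]
    refine ih (hT.mono_left (Finset.subset_insert j T)) (p := fun x => p (e x)) ?_ ?_ ?_ x
      fun i hi => hx i (Finset.mem_insert_of_mem hi)
    · rwa [map_zero]
    · intro y z hy hz
      rw [map_add]
      exact hadd _ _ hy hz
    · intro c a ha haT
      rw [map_smul, he, X_smul_halfGen]
      by_cases hja : (a j : ℤ) = (0 : ℤ)
      · rw [halfGen_eq_zero (a := a + unitDeg j), map_zero, sub_zero]
        · refine hgen c a ha fun i hi => ?_
          rcases Finset.mem_insert.1 hi with rfl | hi
          · exact hja
          · exact haT i hi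
        · intro h
          have := h j hjG
          rw [deg_add_apply, unitDeg_apply, if_pos rfl, hja] at this
          omega
      · rw [divMap_halfGen, add_sub_cancel_right, sub_self, smul_zero]
        · exact h0
        · intro i hi
          have h1 := ha i hi
          rw [deg_add_apply, unitDeg_apply]
          split_ifs with hij
          · subst hij
            omega
          · rwa [add_zero]

variable (k G) in
open Classical in
/-- The coefficient of `x^b`. -/
def halfCoeff (b : Deg n) : Total (halfModule k G) →ₗ[k] k :=
  DirectSum.toModule k (Deg n) _ fun a =>
    if a = b then monomialCoeff k (halfSet_ordConnected G) a else 0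

open Classical in
lemma halfCoeff_halfGen (b : Deg n) {a : Deg n} (ha : a ∈ halfSet G) :
    halfCoeff k G b (halfGen k G a) = if a = b then 1 else 0 := by
  refine (DirectSum.toModule_lof k (φ := fun a =>
    if a = b then monomialCoeff k (halfSet_ordConnected G) a else 0) a (halfElt k G a)).trans ?_
  split_ifs with h
  · exact if_pos ha
  · rfl

lemma expDeg_injective {c d : Fin n →₀ ℕ} (h : expDeg c = expDeg d) : c = d := by
  ext i
  exact Int.ofNat.inj (congrFun h i)

lemma halfCoeff_smul_halfGen (b : Fin n →₀ ℕ) (hb : expDeg b ∈ halfSet G)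
    (p : MvPolynomial (Fin n) k) :
    halfCoeff k G (expDeg b) (p • halfGen k G 0) = p.coeff b := by
  classical
  induction p using MvPolynomial.induction_on' with
  | monomial d c =>
    rw [monomial_smul_halfGen, map_smul, MvPolynomial.coeff_monomial, zero_add]
    by_cases hd : expDeg d ∈ halfSet G
    · rw [halfCoeff_halfGen _ hd, smul_eq_mul, mul_ite, mul_one, mul_zero]
      exact if_congr ⟨expDeg_injective, fun h => h ▸ rfl⟩ rfl rfl
    · rw [halfGen_eq_zero hd, map_zero, smul_zero, if_neg]
      rintro rfl
      exact hd hb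
  | add p q hp hq => rw [add_smul, map_add, hp, hq, MvPolynomial.coeff_add]

lemma notMem_primeIdeal_iff (F : Finset (Fin n)) (p : MvPolynomial (Fin n) k) :
    p ∉ primeIdeal k F ↔ ∃ b ∈ p.support, ∀ i ∉ F, b i = 0 := by
  rw [primeIdeal, MvPolynomial.mem_ideal_span_X_image]
  push Not
  rfl

lemma monomial_notMem_primeIdeal {F : Finset (Fin n)} {b : Fin n →₀ ℕ} (hb : ∀ i ∉ F, b i = 0) :
    MvPolynomial.monomial b (1 : k) ∉ primeIdeal k F := by
  classical
  rw [notMem_primeIdeal_iff]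
  exact ⟨b, by simp [MvPolynomial.support_monomial], hb⟩

/-- Elements of `𝒵(S/P_G)` are torsion with respect to the complement of `P_F` if `F ⊄ G`. -/
lemma exists_smul_eq_zero_of_not_subset {F : Finset (Fin n)} (h : ¬ F ⊆ G)
    (x : Total (halfModule k G)) : ∃ t ∈ (primeIdeal k F).primeCompl, t • x = 0 := by
  obtain ⟨i, hiF, hiG⟩ := Finset.not_subset.1 h
  refine total_halfModule_induction
    (p := fun x => ∃ t ∈ (primeIdeal k F).primeCompl, t • x = 0)
    ⟨1, Submonoid.one_mem _, smul_zero _⟩ ?_ ?_ x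
  · rintro x y ⟨t, ht, hx⟩ ⟨t', ht', hy⟩
    refine ⟨t * t', Submonoid.mul_mem _ ht ht', ?_⟩
    rw [smul_add, mul_comm, mul_smul, hx, smul_zero, mul_comm, mul_smul, hy, smul_zero, add_zero]
  · intro c a _
    -- The exponent `|a_i| + 1` makes the `i`-th coordinate positive, which is not allowed for `i ∉
    -- G`.
    refine ⟨MvPolynomial.monomial (Finsupp.single i ((a i : ℤ).natAbs + 1)) 1,
      monomial_notMem_primeIdeal fun j hj => ?_, ?_⟩
    · exact Finsupp.single_eq_of_ne fun h => hj (h ▸ hiF)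
    · rw [poly_smul_smul, monomial_smul_halfGen, halfGen_eq_zero, smul_zero, smul_zero]
      intro h'
      have h1 := h' i hiG
      have h2 : ((a + expDeg (Finsupp.single i ((a i : ℤ).natAbs + 1))) i : ℤ) =
          (a i : ℤ) + (((a i : ℤ).natAbs + 1 : ℕ) : ℤ) := by
        change (a i : ℤ) + ((Finsupp.single i ((a i : ℤ).natAbs + 1) i : ℕ) : ℤ) = _
        rw [Finsupp.single_eq_same]
      rw [h2] at h1
      omega

/-- Up to elements outside of `P_F`, the elements of `𝒵(S/P_F)` killed by `P_F` are multiples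
of `x^0`. -/
lemma exists_smul_eq_smul_halfGen {F : Finset (Fin n)} (x : Total (halfModule k F))
    (hx : ∀ j ∉ F, (MvPolynomial.X j : MvPolynomial (Fin n) k) • x = 0) :
    ∃ t ∈ (primeIdeal k F).primeCompl, ∃ p : MvPolynomial (Fin n) k,
      t • x = p • halfGen k F 0 := by
  refine total_halfModule_induction_of_killed Fᶜ disjoint_compl_left
    (p := fun x => ∃ t ∈ (primeIdeal k F).primeCompl, ∃ p : MvPolynomial (Fin n) k,
      t • x = p • halfGen k F 0)
    ⟨1, Submonoid.one_mem _, 0, by rw [smul_zero, zero_smul]⟩ ?_ ?_ x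
    fun j hj => hx j (Finset.mem_compl.1 hj)
  · rintro x y ⟨t, ht, p, hx⟩ ⟨t', ht', q, hy⟩
    refine ⟨t * t', Submonoid.mul_mem _ ht ht', t' * p + t * q, ?_⟩
    rw [smul_add, add_smul, mul_smul, mul_smul t' p, ← hx, mul_smul t q, ← hy, smul_comm t' t x]
    simp only [mul_smul]
  · intro c a _ ha
    -- Multiplying `x^a` by its denominator gives its numerator. As `a` vanishes outside `F`, the
    -- denominator involves only variables outside `P_F`.
    refine ⟨MvPolynomial.monomial (Finsupp.equivFunOnFinite.symm fun i => (-(a i : ℤ)).toNat) 1,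
      monomial_notMem_primeIdeal fun i hi => ?_, MvPolynomial.monomial
        (Finsupp.equivFunOnFinite.symm fun i => (a i : ℤ).toNat) c, ?_⟩
    · have := ha i (Finset.mem_compl.2 hi)
      change (-(a i : ℤ)).toNat = 0
      rw [this]
      rfl
    · rw [poly_smul_smul, monomial_smul_halfGen, one_smul, monomial_smul_halfGen]
      congr 2
      funext i
      change (a i : ℤ) + (((-(a i : ℤ)).toNat : ℕ) : ℤ) = 0 + (((a i : ℤ).toNat : ℕ) : ℤ)
      omega

/-- Some monomial of `t` involves only variables indexed by `F`, and its coefficient can be read off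
from `t • x^0`. Hence `x^0` survives in the localization at `P_F`. -/
lemma smul_halfGen_ne_zero {F : Finset (Fin n)} {t : MvPolynomial (Fin n) k}
    (ht : t ∉ primeIdeal k F) : t • halfGen k F 0 ≠ 0 := by
  obtain ⟨b, hb, hbF⟩ := (notMem_primeIdeal_iff F t).1 ht
  intro h
  have h1 := halfCoeff_smul_halfGen (k := k) (G := F) b (fun i hi => by
    change ((b i : ℕ) : ℤ) ≤ 0
    rw [hbF i hi]
    rfl) t
  rw [h, map_zero] at h1
  exact MvPolynomial.mem_support_iff.1 hb h1.symm

lemma X_smul_halfGen_zero {F : Finset (Fin n)} {j : Fin n} (hj : j ∉ F) :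
    (MvPolynomial.X j : MvPolynomial (Fin n) k) • halfGen k F 0 = 0 := by
  rw [X_smul_halfGen]
  refine halfGen_eq_zero fun h => ?_
  have := h j hj
  rw [zero_add, unitDeg_apply, if_pos rfl] at this
  omega

/-- Membership in an ideal generated by variables is tested on the support. This is the regularity
of distinct variables, taken in any order. -/
lemma X_mul_mem_span_X {T : Set (Fin n)} {j : Fin n} (hj : j ∉ T) (p : MvPolynomial (Fin n) k)
    (h : MvPolynomial.X j * p ∈ Ideal.span (MvPolynomial.X '' T)) :
    p ∈ Ideal.span (MvPolynomial.X '' T) := by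
  rw [MvPolynomial.mem_ideal_span_X_image] at h ⊢
  intro b hb
  obtain ⟨i, hi, hb'⟩ := h (Finsupp.single j 1 + b) (by
    rw [MvPolynomial.mem_support_iff, MvPolynomial.coeff_X_mul]
    exact MvPolynomial.mem_support_iff.1 hb)
  refine ⟨i, hi, ?_⟩
  have hij : i ≠ j := fun h => hj (h ▸ hi)
  rwa [Finsupp.add_apply, Finsupp.single_eq_of_ne hij, zero_add] at hb'

end HalfModules

/-! ## Bass numbers of `𝒵(S/P_G)` -/

section BassSingles

open Abelian

variable (F G : Finset (Fin n))

variable (k) in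
/-- The localization of `𝒵(S/P_G)` at `P_F`. -/
abbrev halfStalk : ModuleCat.{u} (Localization.AtPrime (primeIdeal k F)) :=
  ModuleCat.localizedModule ((total k n).obj (halfModule k G)) (primeIdeal k F).primeCompl

variable (k) in
/-- The localization map. -/
abbrev halfStalkMap : Total (halfModule k G) →ₗ[MvPolynomial (Fin n) k] halfStalk k F G :=
  ModuleCat.localizedModuleMkLinearMap ((total k n).obj (halfModule k G))
    (primeIdeal k F).primeCompl

instance : IsLocalizedModule (primeIdeal k F).primeCompl (halfStalkMap k F G) :=
  ModuleCat.localizedModule_isLocalizedModule _ _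

variable (k) in
/-- The residue field at `P_F`, as a module. -/
abbrev residueModule : ModuleCat.{u} (Localization.AtPrime (primeIdeal k F)) :=
  ModuleCat.of _ (IsLocalRing.ResidueField (Localization.AtPrime (primeIdeal k F)))

variable (k) in
/-- The variables in the local ring at `P_F`. -/
abbrev localVar (i : Fin n) : Localization.AtPrime (primeIdeal k F) :=
  algebraMap (MvPolynomial (Fin n) k) _ (MvPolynomial.X i)

variable {F G}

lemma maximalIdeal_eq_span_localVar :
    IsLocalRing.maximalIdeal (Localization.AtPrime (primeIdeal k F)) =
      Ideal.span (localVar k F '' ((Fᶜ : Finset (Fin n)) : Set (Fin n))) := by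
  rw [← Localization.AtPrime.map_eq_maximalIdeal]
  refine (Ideal.map_span _ _).trans (congrArg Ideal.span ?_)
  rw [Set.image_image]
  congr 1
  ext i
  simp

lemma localVar_mem {i : Fin n} (hi : i ∉ F) :
    localVar k F i ∈ IsLocalRing.maximalIdeal (Localization.AtPrime (primeIdeal k F)) := by
  rw [maximalIdeal_eq_span_localVar]
  exact Ideal.subset_span ⟨i, by simpa using hi, rfl⟩

lemma smul_residueModule {r : Localization.AtPrime (primeIdeal k F)}
    (hr : r ∈ IsLocalRing.maximalIdeal (Localization.AtPrime (primeIdeal k F)))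
    (y : residueModule k F) : r • y = 0 := by
  obtain ⟨y, rfl⟩ := IsLocalRing.residue_surjective y
  change IsLocalRing.residue _ (r * y) = 0
  exact Ideal.Quotient.eq_zero_iff_mem.2 (Ideal.mul_mem_right y _ hr)

variable [HasExt.{w} (ModuleCat.{u} (Localization.AtPrime (primeIdeal k F)))]

/-- If `F ⊊ G`, a variable `x_j` with `j ∈ G \ F` kills the residue field and acts bijectively on
`𝒵(S/P_G)`. If `F ⊄ G`, the localization at `P_F` is zero. -/
lemma subsingleton_ext_residueModule_of_ne (h : G ≠ F) (l : ℕ) :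
    Subsingleton (Ext (residueModule k F) (halfStalk k F G) l) := by
  by_cases hFG : F ⊆ G
  · obtain ⟨j, hjG, hjF⟩ := Finset.not_subset.1 fun h' => h (h'.antisymm hFG)
    exact subsingleton_ext_of_bijective (localVar k F j) _ _ (smul_residueModule (localVar_mem hjF))
      (smul_bijective_localized (primeIdeal k F).primeCompl (halfStalkMap k F G)
        (X_smul_bijective hjG)) l
  · have : Subsingleton (halfStalk k F G) :=
      subsingleton_localized (primeIdeal k F).primeCompl (halfStalkMap k F G)
        (exists_smul_eq_zero_of_not_subset hFG)
    have h0 : IsZero (halfStalk k F G) := ModuleCat.isZero_of_subsingleton _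
    refine subsingleton_of_forall_eq 0 fun x => ?_
    rw [← Ext.comp_mk₀_id x, h0.eq_of_src (𝟙 _) 0, Ext.mk₀_zero, Ext.comp_zero]

omit [HasExt.{w} (ModuleCat.{u} (Localization.AtPrime (primeIdeal k F)))] in
lemma exists_localVar_smul_eq (T : Finset (Fin n)) {j : Fin n} (hj : j ∉ T)
    (e : halfStalk k F F) (he : ∀ i ∈ T, localVar k F i • e = 0) :
    ∃ e' : halfStalk k F F, (∀ i ∈ T, localVar k F i • e' = 0) ∧ localVar k F j • e' = e := by
  simp only [localVar, algebraMap_smul] at he ⊢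
  obtain ⟨y, s, rfl, hy⟩ := exists_mk_eq_of_smul_eq_zero (primeIdeal k F).primeCompl
    (halfStalkMap k F F) MvPolynomial.X T e he
  refine ⟨IsLocalizedModule.mk' (halfStalkMap k F F) (divMap k F j y) s, fun i hi => ?_, ?_⟩
  · have hij : i ≠ j := fun h => hj (h ▸ hi)
    rw [← IsLocalizedModule.mk'_smul, divMap_X_smul_of_ne hij, hy i hi, map_zero,
      IsLocalizedModule.mk'_zero]
  · rw [← IsLocalizedModule.mk'_smul, X_smul_divMap]

omit [HasExt.{w} (ModuleCat.{u} (Localization.AtPrime (primeIdeal k F)))] in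
lemma residueModule_iso : Nonempty (residueModule k F ≅ ModuleCat.of _
    (Localization.AtPrime (primeIdeal k F) ⧸
      Ideal.span (localVar k F '' ((Fᶜ : Finset (Fin n)) : Set (Fin n))))) :=
  ⟨(Submodule.quotEquivOfEq _ _ maximalIdeal_eq_span_localVar).toModuleIso⟩

/-- The variables outside `F` generate the maximal ideal, are regular in any order, and divide
elements of the localization while respecting annihilation by the others. -/
lemma subsingleton_ext_residueModule_self (l : ℕ) (hl : 0 < l) :
    Subsingleton (Ext (residueModule k F) (halfStalk k F F) l) := by
  have h1 := subsingleton_ext_quotient_span (localVar k F) (halfStalk k F F) Fᶜ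
    (fun T _ j _ hj r hr => mem_span_localization (primeIdeal k F).primeCompl MvPolynomial.X T
      (MvPolynomial.X j) (X_mul_mem_span_X (by simpa using hj)) r hr)
    (fun T _ j _ hj e he => exists_localVar_smul_eq T hj e he) Fᶜ subset_rfl l hl
  exact (extCongr ℤ (residueModule_iso (k := k) (F := F)).some
    (Iso.refl _) l).toEquiv.subsingleton_congr.2 h1

omit [HasExt.{w} (ModuleCat.{u} (Localization.AtPrime (primeIdeal k F)))] in
lemma nonempty_hom_residueModule_linearEquiv :
    Nonempty ((residueModule k F ⟶ halfStalk k F F) ≃ₗ[Localization.AtPrime (primeIdeal k F)]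
      IsLocalRing.ResidueField (Localization.AtPrime (primeIdeal k F))) := by
  refine nonempty_hom_quotient_linearEquiv
    (IsLocalRing.maximalIdeal (Localization.AtPrime (primeIdeal k F))) (halfStalk k F F)
    (halfStalkMap k F F (halfGen k F 0)) ?_ ?_ ?_
  · intro h
    obtain ⟨⟨t, ht⟩, h'⟩ := (IsLocalizedModule.eq_zero_iff (primeIdeal k F).primeCompl _).1 h
    exact smul_halfGen_ne_zero ht h'
  · intro r hr
    rw [maximalIdeal_eq_span_localVar] at hr
    refine Submodule.span_induction ?_ (zero_smul _ _) (fun x y _ _ hx hy => ?_)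
      (fun a x _ hx => ?_) hr
    · rintro _ ⟨i, hi, rfl⟩
      rw [algebraMap_smul, ← map_smul, X_smul_halfGen_zero (by simpa using hi), map_zero]
    · rw [add_smul, hx, hy, add_zero]
    · rw [smul_assoc, hx, smul_zero]
  · intro e he
    obtain ⟨y, s, rfl, hy⟩ := exists_mk_eq_of_smul_eq_zero (primeIdeal k F).primeCompl
      (halfStalkMap k F F) MvPolynomial.X Fᶜ e fun i hi => by
        have := he _ (localVar_mem (by simpa using hi : i ∉ F))
        rwa [localVar, algebraMap_smul] at this
    -- From `t y = p x^0` with `t ∉ P_F`, the socle element `y/s` is the multiple `p/(s t)` of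
    -- `x^0`.
    obtain ⟨t, ht, p, hp⟩ := exists_smul_eq_smul_halfGen y fun j hj => hy j (by simpa using hj)
    refine ⟨IsLocalization.mk' (M := (primeIdeal k F).primeCompl) _ p (s * ⟨t, ht⟩), ?_⟩
    let g := halfStalkMap k F F (halfGen k F 0)
    let t' : (primeIdeal k F).primeCompl := ⟨t, ht⟩
    rw [IsLocalizedModule.mk'_eq_iff]
    apply IsLocalizedModule.smul_injective (halfStalkMap k F F) t'
    change t • halfStalkMap k F F y = t • (s : MvPolynomial (Fin n) k) • (_ • g)
    rw [← map_smul, hp, map_smul, ← mul_smul, ← algebraMap_smul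
      (Localization.AtPrime (primeIdeal k F)) (t * s), ← mul_smul]
    have h1 := IsLocalization.mk'_spec' (Localization.AtPrime (primeIdeal k F)) p (s * t')
    rw [Submonoid.coe_mul, mul_comm (s : MvPolynomial (Fin n) k)] at h1
    rw [h1, algebraMap_smul]

end BassSingles

/-! ### Bass numbers as a cohomological rank -/

section Bass

/-- `Ext(K, L)` is functorial in `L`. -/
lemma nonempty_hyperExt_congr {C : Type w} [Category.{v} C] [Abelian C] (R : Type*) [CommRing R]
    [Linear R C] (K : CochainComplex C ℤ) {L L' : CochainComplex C ℤ} (e : L ≅ L') (i : ℤ) :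
    Nonempty (HyperExt K L i ≃ₗ[R] HyperExt K L' i) := by
  let _ := HasDerivedCategory.standard C
  let e' := (shiftFunctor (DerivedCategory C) i).mapIso (DerivedCategory.Q.mapIso e)
  let E : (DerivedCategory.Q.obj K ⟶ (DerivedCategory.Q.obj L)⟦i⟧) ≃ₗ[R]
      (DerivedCategory.Q.obj K ⟶ (DerivedCategory.Q.obj L')⟦i⟧) :=
    LinearEquiv.ofLinearMap (Linear.rightComp R _ e'.hom) (Linear.rightComp R _ e'.inv)
      (LinearMap.ext fun f => by simp) (LinearMap.ext fun f => by simp)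
  exact ⟨(hyperExtEquiv R K L i).trans (E.trans (hyperExtEquiv R K L' i).symm)⟩

variable (k) in
/-- The complexes of `S`-modules underlying `𝒵(M)`. -/
abbrev straightTotal : CochainComplex (GrMod k n) ℤ ⥤
    CochainComplex (ModuleCat.{u} (MvPolynomial (Fin n) k)) ℤ :=
  (straightFunctor k n ⋙ total k n).mapHomologicalComplex (ComplexShape.up ℤ)

instance (P : Ideal (MvPolynomial (Fin n) k)) [P.IsPrime] (X) (i : ℤ) :
    IsScalarTower (Localization.AtPrime P) (IsLocalRing.ResidueField (Localization.AtPrime P))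
      (BassExt P X i) := (bassExt_torsion P X i).isScalarTower

lemma totalMap_eq_lmap {M N : GrMod k n} (f : M ⟶ N) :
    totalMapAux f = DirectSum.lmap fun a => ev f a := by
  refine total_ext fun a y => ?_
  rw [totalMapAux_totalOf]
  exact (DirectSum.lmap_lof (fun a => ev f a) a y).symm

lemma shortExact_total_map (S : ShortComplex (GrMod k n)) (hS : S.ShortExact) :
    (S.map (total k n)).ShortExact where
  exact := by
    rw [ShortComplex.moduleCat_exact_iff]
    intro x hx
    have h1 : x ∈ LinearMap.ker (DirectSum.lmap fun a => ev S.g a) := by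
      rw [← totalMap_eq_lmap]
      exact hx
    have h2 : x ∈ LinearMap.range (DirectSum.lmap fun a => ev S.f a) := by
      rw [DirectSum.ker_lmap] at h1
      rw [DirectSum.range_lmap]
      intro a ha
      exact (exact_iff_ev S).1 hS.exact a _ (h1 a ha)
    rw [← totalMap_eq_lmap] at h2
    exact h2
  mono_f := by
    rw [ModuleCat.mono_iff_injective]
    change Function.Injective (totalMapAux S.f)
    rw [totalMap_eq_lmap]
    refine (DirectSum.lmap_injective _).2 ?_
    exact (mono_iff_ev S.f).1 hS.mono_f
  epi_g := by
    rw [ModuleCat.epi_iff_surjective]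
    change Function.Surjective (totalMapAux S.g)
    rw [totalMap_eq_lmap]
    refine (DirectSum.lmap_surjective _).2 ?_
    exact (epi_iff_ev S.g).1 hS.epi_g

lemma preservesFinite_total_map : PreservesFiniteLimits (total k n) ∧
    PreservesFiniteColimits (total k n) := by
  have := ((Functor.exact_tfae (total k n)).out 0 3).1 shortExact_total_map
  exact this

instance : PreservesFiniteLimits (total k n) := preservesFinite_total_map.1

instance : PreservesFiniteColimits (total k n) := preservesFinite_total_map.2
lemma shortExact_straight_map (S : ShortComplex (GrMod k n)) (hS : S.ShortExact) :
    (S.map (straightFunctor k n)).ShortExact :=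
  shortExact_of_ev _ (fun _ => (mono_iff_ev S.f).1 hS.mono_f _)
    (fun _ => (exact_iff_ev S).1 hS.exact _) (fun _ => (epi_iff_ev S.g).1 hS.epi_g _)

lemma preservesFinite_straight_map : PreservesFiniteLimits (straightFunctor k n) ∧
    PreservesFiniteColimits (straightFunctor k n) := by
  have := ((Functor.exact_tfae (straightFunctor k n)).out 0 3).1 shortExact_straight_map
  exact this

instance : PreservesFiniteLimits (straightFunctor k n) := preservesFinite_straight_map.1

instance : PreservesFiniteColimits (straightFunctor k n) := preservesFinite_straight_map.2
lemma shortExact_mapHomologicalComplex {C D : Type*} [Category* C] [Abelian C] [Category* D]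
    [Abelian D] (Ψ : C ⥤ D) [Ψ.Additive] [PreservesFiniteLimits Ψ] [PreservesFiniteColimits Ψ]
    {S : ShortComplex (CochainComplex C ℤ)} (hS : S.ShortExact) :
    (S.map (Ψ.mapHomologicalComplex (ComplexShape.up ℤ))).ShortExact :=
  HomologicalComplex.shortExact_of_degreewise_shortExact _ fun i =>
    (hS.map_of_exact (HomologicalComplex.eval C (ComplexShape.up ℤ) i)).map_of_exact Ψ

lemma nonempty_straightTotal_single_iso (F G : Finset (Fin n)) (t : ℤ) :
    Nonempty (localizedComplex (primeIdeal k F) ((straightTotal k).obj (singleAt t (quotPrime k G)))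
      ≅ (HomologicalComplex.single _ (ComplexShape.up ℤ) t).obj (halfStalk k F G)) := by
  obtain ⟨e⟩ := nonempty_straight_quotPrime_iso (k := k) G
  let L := ModuleCat.localizedModuleFunctor.{u} (primeIdeal k F).primeCompl
  exact ⟨(L.mapHomologicalComplex _).mapIso
    ((HomologicalComplex.singleMapHomologicalComplex (straightFunctor k n ⋙ total k n)
      (ComplexShape.up ℤ) t).app (quotPrime k G)) ≪≫
    (HomologicalComplex.singleMapHomologicalComplex L (ComplexShape.up ℤ) t).app _ ≪≫
    (HomologicalComplex.single _ (ComplexShape.up ℤ) t).mapIso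
      (L.mapIso ((total k n).mapIso e))⟩

/-- `𝒵`, forgetting the grading and localizing are all exact, so their composite sends short exact
sequences to distinguished triangles and quasi-isomorphisms to isomorphisms. The Hom groups are
linear over the local ring, the dimensions are over its residue field. -/
lemma isCohomologicalRank_bassNumber (P : Ideal (MvPolynomial (Fin n) k)) [P.IsPrime] :
    IsCohomologicalRank fun X : CochainComplex (GrMod k n) ℤ =>
      bassNumber P ((straightTotal k).obj X) := by
  let _ := HasDerivedCategory.standard (ModuleCat.{u} (Localization.AtPrime P))
  let L := ModuleCat.localizedModuleFunctor.{u} P.primeCompl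
  let Θ := straightTotal (n := n) k ⋙ L.mapHomologicalComplex (ComplexShape.up ℤ)
  exact isCohomologicalRank_coyoneda (R := Localization.AtPrime P)
    (K := IsLocalRing.ResidueField (Localization.AtPrime P)) (Θ ⋙ DerivedCategory.Q)
    (fun X m => BassExt P ((straightTotal k).obj X) m)
    (fun S hS => ⟨_, DerivedCategory.triangleOfSES_distinguished
      (shortExact_mapHomologicalComplex L
        (shortExact_mapHomologicalComplex (straightFunctor k n ⋙ total k n) hS))⟩)
    (fun {X Y} f hf => by
      have h1 : QuasiIso ((straightTotal k).map f) := inferInstance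
      have h2 : QuasiIso ((L.mapHomologicalComplex (ComplexShape.up ℤ)).map
        ((straightTotal k).map f)) := inferInstance
      exact (DerivedCategory.isIso_Q_map_iff_quasiIso _ _).2 h2)
    IsLocalRing.residue_surjective (DerivedCategory.Q.obj (residueComplex P))
    (fun X m => hyperExtEquiv (Localization.AtPrime P) (residueComplex P) _ m)

lemma bassNumber_single (F G : Finset (Fin n)) (t m : ℤ) :
    bassNumber (primeIdeal k F) ((straightTotal k).obj (singleAt t (quotPrime k G))) m =
      if G = F ∧ t = m then 1 else 0 := by
  obtain ⟨e₁⟩ := nonempty_straightTotal_single_iso F G t (k := k)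
  obtain ⟨e₂⟩ := nonempty_hyperExt_congr (Localization.AtPrime (primeIdeal k F))
    (residueComplex (primeIdeal k F)) e₁ m
  by_cases h : m + 0 - t < 0
  · have h1 := subsingleton_hyperExt_single_of_neg (residueModule k F) (halfStalk k F G) 0 t m h
    have h2 := e₂.toEquiv.subsingleton_congr.2 h1
    rw [if_neg fun h' => by omega]
    exact @rank_subsingleton' _ _ _ _ _ _ h2
  · have := HasExt.standard (ModuleCat.{u} (Localization.AtPrime (primeIdeal k F)))
    obtain ⟨l, hl⟩ := Int.eq_ofNat_of_zero_le (not_lt.1 h)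
    obtain ⟨e₃⟩ := nonempty_hyperExt_single_linearEquiv_ext
      (Localization.AtPrime (primeIdeal k F)) (residueModule k F)
      (halfStalk k F G) 0 t m l hl.symm
    have e := e₂.trans e₃
    split_ifs with h'
    · obtain ⟨rfl, rfl⟩ := h'
      obtain rfl : l = 0 := by omega
      have e' := (e.trans Abelian.Ext.linearEquiv₀).trans
        (nonempty_hom_residueModule_linearEquiv (k := k) (F := G)).some
      have := (LinearEquiv.extendScalarsOfSurjective
        (S := IsLocalRing.ResidueField (Localization.AtPrime (primeIdeal k G)))
        (by exact IsLocalRing.residue_surjective) e').lift_rank_eq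
      rw [Module.rank_self, Cardinal.lift_one, Cardinal.lift_eq_one] at this
      exact this
    · have h1 : Subsingleton (Abelian.Ext (residueModule k F) (halfStalk k F G) l) := by
        by_cases hG : G = F
        · subst hG
          exact subsingleton_ext_residueModule_self l (Nat.pos_of_ne_zero
              fun h0 => h' ⟨rfl, by omega⟩)
        · exact subsingleton_ext_residueModule_of_ne hG l
      exact @rank_subsingleton' _ _ _ _ _ _ (e.toEquiv.subsingleton_congr.2 h1)

end Bass

/-! ## Essential kernels and socles -/

section Essential

variable {M N : GrMod k n}

open Classical in
/-- The graded submodule generated by a homogeneous element. -/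
def GrSubmodule.principal {a : Deg n} (y : M.obj a) : GrSubmodule M where
  comp b := if h : a ≤ b then Submodule.span k {mulMap M h y} else ⊥
  mul_mem b c h z hz := by
    by_cases hb : a ≤ b
    · rw [dif_pos hb, Submodule.mem_span_singleton] at hz
      obtain ⟨r, rfl⟩ := hz
      rw [dif_pos (hb.trans h), map_smul, mulMap_mulMap]
      exact Submodule.smul_mem _ _ (Submodule.mem_span_singleton_self _)
    · rw [dif_neg hb, Submodule.mem_bot] at hz
      rw [hz, map_zero]
      exact Submodule.zero_mem _

lemma KilledOutside.mulMap_eq_zero {F : Finset (Fin n)} {a b : Deg n} {y : M.obj a}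
    (hy : KilledOutside F y) (h : a ≤ b) {j : Fin n} (hj : j ∉ F) (hab : (a j : ℤ) < b j) :
    mulMap M h y = 0 := by
  have h' : a + unitDeg j ≤ b := fun i => by
    have h1 : (a i : ℤ) ≤ b i := h i
    change ((a + unitDeg j) i : ℤ) ≤ b i
    rw [deg_add_apply, unitDeg_apply]
    split_ifs with hij
    · subst hij
      exact hab
    · rwa [add_zero]
  exact mulMap_eq_zero_of_le M (le_add_unitDeg a j) h h' (hy j hj)

/-- If the kernel of a map of squarefree modules meets all nonzero graded submodules, then the
map vanishes on socles. -/
lemma killsSocle_of_essential (hN : IsSquarefree N) (f : M ⟶ N)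
    (h : ∀ L : GrSubmodule M, (∃ a, L.comp a ≠ ⊥) →
      ∃ a, L.comp a ⊓ LinearMap.ker (ev f a) ≠ ⊥) : KillsSocle f := by
  classical
  intro F y hy
  by_contra hfy
  have hy0 : y ≠ 0 := fun h0 => hfy (by rw [h0, map_zero])
  obtain ⟨a, ha⟩ := h (GrSubmodule.principal y) ⟨ind F, fun h0 => hy0 (by
    have h1 : y ∈ (GrSubmodule.principal y).comp (ind F) := by
      change y ∈ dite (ind F ≤ ind F) _ _
      rw [dif_pos le_rfl, mulMap_refl]
      exact Submodule.mem_span_singleton_self _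
    rwa [h0, Submodule.mem_bot] at h1)⟩
  obtain ⟨z, ⟨hz, hfz⟩, hz0⟩ := Submodule.exists_mem_ne_zero_of_ne_bot ha
  have hz' := hz
  simp only [GrSubmodule.principal, SetLike.mem_coe] at hz'
  by_cases hFa : ind F ≤ a
  · rw [dif_pos hFa, Submodule.mem_span_singleton] at hz'
    obtain ⟨r, rfl⟩ := hz'
    have hr : r ≠ 0 := fun h0 => hz0 (by rw [h0, zero_smul])
    have hya : mulMap M hFa y ≠ 0 := fun h0 => hz0 (by rw [h0, smul_zero])
    -- A nonzero monomial multiple of `y` involves only variables in `F`, as `y` is killed by the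
    -- others. Between the two degrees, multiplication on `N` is then injective, so the vanishing of
    -- `f` descends to `y`.
    have hs : posSupp a = posSupp (ind F) := by
      refine Finset.Subset.antisymm (fun j hj => ?_) (posSupp_mono hFa)
      rw [posSupp_ind]
      by_contra hjF
      exact hya (hy.mulMap_eq_zero hFa hjF (by
        rw [ind_apply, if_neg hjF]
        exact mem_posSupp.1 hj))
    have h1 : ev f a (r • mulMap M hFa y) = 0 := hfz
    rw [map_smul, smul_eq_zero_iff_right hr, ev_mulMap] at h1
    exact hfy ((injective_iff_map_eq_zero _).1 (hN.bijective _ _ hFa (ind_nonneg F) hs).1 _ h1)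
  · rw [dif_neg hFa, Submodule.mem_bot] at hz'
    exact hz0 hz'

/-- A nonzero graded submodule of a squarefree module contains a nonzero socle element. -/
lemma IsSquarefree.exists_killedOutside_mem (hM : IsSquarefree M) (L : GrSubmodule M)
    (hL : ∃ a, L.comp a ≠ ⊥) : ∃ (a : Deg n) (z : M.obj a), 0 ≤ a ∧ z ≠ 0 ∧ z ∈ L.comp a ∧
      KilledOutside (posSupp a) z := by
  have h1 : ∃ (a : Deg n) (z : M.obj a), 0 ≤ a ∧ z ≠ 0 ∧ z ∈ L.comp a := by
    obtain ⟨a, ha⟩ := hL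
    obtain ⟨z, hz, hz0⟩ := Submodule.exists_mem_ne_zero_of_ne_bot ha
    exact ⟨a, z, by_contra fun h => hz0 (hM.eq_zero_of_not_nonneg h z), hz0, hz⟩
  obtain ⟨a, z, ha, hz0, hz⟩ := h1
  induction hm : (posSupp a)ᶜ.card using Nat.strong_induction_on generalizing a with
  | _ m ih =>
    by_cases hk : KilledOutside (posSupp a) z
    · exact ⟨a, z, ha, hz0, hz, hk⟩
    · unfold KilledOutside at hk
      push Not at hk
      obtain ⟨j, hj, hjz⟩ := hk
      -- A variable outside the support that does not kill `z` enlarges the support, so the process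
      -- terminates.
      refine ih _ ?_ (a + unitDeg j) (mulMap M (le_add_unitDeg a j) z)
        (ha.trans (le_add_unitDeg a j)) hjz (L.mul_mem _ _ _ _ hz) rfl
      rw [← hm, posSupp_add_unitDeg ha]
      refine Finset.card_lt_card ⟨Finset.compl_subset_compl.2 (Finset.subset_insert _ _),
          fun h => ?_⟩
      exact Finset.mem_compl.1 (h (Finset.mem_compl.2 hj)) (Finset.mem_insert_self _ _)

/-- If a map of squarefree modules vanishes on socles, then its kernel meets all nonzero graded
submodules. -/
lemma essential_of_killsSocle (hM : IsSquarefree M) {f : M ⟶ N} (hf : KillsSocle f)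
    (L : GrSubmodule M) (hL : ∃ a, L.comp a ≠ ⊥) :
    ∃ a, L.comp a ⊓ LinearMap.ker (ev f a) ≠ ⊥ := by
  obtain ⟨a, z, ha, hz0, hz, hk⟩ := hM.exists_killedOutside_mem L hL
  refine ⟨a, fun h => hz0 ?_⟩
  have : z ∈ L.comp a ⊓ LinearMap.ker (ev f a) :=
    ⟨hz, hM.ev_eq_zero_of_killsSocle hf (ind_posSupp_le ha) z hk⟩
  rwa [h, Submodule.mem_bot] at this

end Essential

/-! ### The formulas for the squarefree Bass numbers -/

section Formula

/-- The numbers of summands in a minimal injective resolution are computed by any cohomological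
rank that detects the modules `S/P_F`. -/
lemma rank_eq_of_isSquarefreeBassNumbers {r : CochainComplex (GrMod k n) ℤ → ℤ → Cardinal.{w'}}
    (hr : IsCohomologicalRank r) (F : Finset (Fin n))
    (hsingle : ∀ (G : Finset (Fin n)) (t m : ℤ),
      r (singleAt t (quotPrime k G)) m = if G = F ∧ t = m then 1 else 0)
    {M : CochainComplex (Sq k n) ℤ} {μ : ℤ → Finset (Fin n) → ℕ} (hμ : IsSquarefreeBassNumbers M μ)
    (i : ℤ) : r ((inclComplex k n).obj M) i = μ i F := by
  obtain ⟨I, f, hf, e⟩ := hμ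
  rw [hr.quasiIso _ hf.quasiIso]
  obtain ⟨N, hN⟩ := hf.bounded
  exact rank_eq_of_killsSocle hr F hsingle _ ⟨N, fun i hi => (incl k n).map_isZero (hN i hi)⟩
    (fun i => (I.X i).property)
    (fun i => killsSocle_of_essential (I.X (i + 1)).property _ (hf.essential i)) μ e i

theorem bassNumber_eq {M : CochainComplex (Sq k n) ℤ} {μ : ℤ → Finset (Fin n) → ℕ}
    (hμ : IsSquarefreeBassNumbers M μ) (i : ℤ) (F : Finset (Fin n)) :
    (μ i F : Cardinal.{u + 1}) = bassNumber (primeIdeal k F) (straightComplex M) i :=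
  (rank_eq_of_isSquarefreeBassNumbers (isCohomologicalRank_bassNumber (primeIdeal k F)) F
    (fun G t m => bassNumber_single F G t m) hμ i).symm

theorem rank_gradedExt_eq {M : CochainComplex (Sq k n) ℤ} {μ : ℤ → Finset (Fin n) → ℕ}
    (hμ : IsSquarefreeBassNumbers M μ) (i : ℤ) (F : Finset (Fin n)) :
    (μ i F : Cardinal.{u + 1}) = Module.rank k (gradedExt M (omega k n)
      ((n : ℤ) - (F.card : ℤ) - i) (ind F)) :=
  (rank_eq_of_isSquarefreeBassNumbers
    (isCohomologicalRank_hyperExt (single (shift (omega k n) (ind F))) ((n : ℤ) - (F.card : ℤ))) F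
    (fun G t m => rank_hyperExt_singleAt_quotPrime F G t m) hμ i).symm

end Formula

/-! ## Coinduced modules and injective objects -/

section Coinduced

/-- The degrees of `S/P_G`. -/
def faceSet (G : Finset (Fin n)) : Set (Deg n) := {a | 0 ≤ a ∧ ∀ i ∉ G, (a i : ℤ) = (0 : ℤ)}

lemma ind_mem_faceSet_iff {F G : Finset (Fin n)} : ind F ∈ faceSet G ↔ F ⊆ G := by
  constructor
  · intro h i hi
    by_contra hiG
    have := h.2 i hiG
    rw [ind_apply, if_pos hi] at this
    exact one_ne_zero this
  · intro h
    exact ⟨ind_nonneg F, fun i hi => if_neg fun h' => hi (h h')⟩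

lemma mem_faceSet_of_le {G : Finset (Fin n)} {a b : Deg n} (ha : 0 ≤ a) (h : a ≤ b)
    (hb : b ∈ faceSet G) : a ∈ faceSet G :=
  ⟨ha, fun i hi => le_antisymm ((h i).trans (hb.2 i hi).le) (ha i)⟩

lemma mem_faceSet_iff_posSupp {G : Finset (Fin n)} {a : Deg n} (ha : 0 ≤ a) :
    a ∈ faceSet G ↔ posSupp a ⊆ G := by
  constructor
  · intro h i hi
    by_contra hiG
    exact absurd (mem_posSupp.1 hi) (by rw [h.2 i hiG]; exact lt_irrefl _)
  · intro h
    refine ⟨ha, fun i hi => le_antisymm ?_ (ha i)⟩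
    by_contra h'
    exact hi (h (mem_posSupp.2 (not_le.1 h')))

lemma posSupp_add_ind {G : Finset (Fin n)} {a : Deg n} (ha : a ∈ faceSet G) :
    posSupp (a + ind G) = posSupp (ind G) := by
  ext i
  have h0 : (0 : ℤ) ≤ a i := ha.1 i
  rw [mem_posSupp, mem_posSupp, deg_add_apply]
  by_cases hi : i ∈ G
  · rw [ind_apply, if_pos hi]
    constructor <;> intro <;> omega
  · rw [ha.2 i hi, zero_add]

lemma ind_le_add {G : Finset (Fin n)} {a : Deg n} (ha : 0 ≤ a) : ind G ≤ a + ind G :=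
  le_add_of_nonneg_left ha

variable {X Y : GrMod k n} (hX : IsSquarefree X) (hY : IsSquarefree Y)

/-- For `a` with support in `G`, multiplication from degree `a` to degree `G` of a squarefree
module. -/
def toTop {G : Finset (Fin n)} {a : Deg n} (ha : a ∈ faceSet G) : X.obj a →ₗ[k] X.obj (ind G) :=
  (LinearEquiv.ofBijective _ (hX.bijective _ _ (ind_le_add ha.1) (ind_nonneg G)
    (posSupp_add_ind ha))).symm.toLinearMap.comp (mulMap X (le_add_ind a G))

lemma mulMap_toTop {G : Finset (Fin n)} {a : Deg n} (ha : a ∈ faceSet G) (x : X.obj a) :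
    mulMap X (ind_le_add ha.1) (toTop hX ha x) = mulMap X (le_add_ind a G) x :=
  LinearEquiv.apply_symm_apply (LinearEquiv.ofBijective _ (hX.bijective _ _ (ind_le_add ha.1)
    (ind_nonneg G) (posSupp_add_ind ha))) _

lemma toTop_eq_iff {G : Finset (Fin n)} {a : Deg n} (ha : a ∈ faceSet G) (x : X.obj a)
    (y : X.obj (ind G)) :
    toTop hX ha x = y ↔ mulMap X (ind_le_add ha.1) y = mulMap X (le_add_ind a G) x := by
  rw [← mulMap_toTop hX ha]
  exact ⟨fun h => h ▸ rfl, fun h => ((hX.bijective _ _ (ind_le_add ha.1) (ind_nonneg G)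
    (posSupp_add_ind ha)).1 h).symm⟩

lemma toTop_mulMap {G : Finset (Fin n)} {a b : Deg n} (ha : a ∈ faceSet G) (hb : b ∈ faceSet G)
    (h : a ≤ b) (x : X.obj a) : toTop hX hb (mulMap X h x) = toTop hX ha x := by
  have h1 : a + ind G ≤ b + ind G := add_le_add_left h _
  rw [toTop_eq_iff, ← mulMap_mulMap X (ind_le_add ha.1) h1, mulMap_toTop, mulMap_mulMap,
    mulMap_mulMap]

lemma toTop_self {G : Finset (Fin n)} (h : ind G ∈ faceSet G) (x : X.obj (ind G)) :
    toTop hX h x = x := (toTop_eq_iff hX h x x).2 rfl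

lemma ev_toTop (f : X ⟶ Y) {G : Finset (Fin n)} {a : Deg n} (ha : a ∈ faceSet G) (x : X.obj a) :
    ev f _ (toTop hX ha x) = toTop hY ha (ev f a x) := by
  refine ((toTop_eq_iff hY ha _ _).2 ?_).symm
  rw [← ev_mulMap, mulMap_toTop, ev_mulMap]

lemma toTop_injective {a : Deg n} (h0 : 0 ≤ a) (ha : a ∈ faceSet (posSupp a)) :
    Function.Injective (toTop hX ha) := by
  refine (injective_iff_map_eq_zero _).2 fun x hx => ?_
  rw [toTop_eq_iff, map_zero] at hx
  exact (injective_iff_map_eq_zero _).1 (hX.bijective _ _ (le_add_ind a _) h0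
    (by rw [posSupp_add_ind ha, posSupp_ind])).1 x hx.symm

open Classical in
/-- The morphism to `S/P_G` given by a functional on the component of degree `G`. -/
def toQuotPrime {G : Finset (Fin n)} (ℓ : X.obj (ind G) →ₗ[k] k) : X ⟶ quotPrime k G :=
  homOfLinear
    (fun a => LinearMap.codRestrict (only (a ∈ faceSet G) k)
      (if h : a ∈ faceSet G then ℓ.comp (toTop hX h) else 0) fun y ha => by
        rw [dif_neg ha, LinearMap.zero_apply])
    (by
      intro a b h y
      refine Subtype.ext (Eq.trans ?_ (mulMap_coe_monomialModule _ h _).symm)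
      by_cases hb : b ∈ faceSet G
      · refine Eq.trans ?_ (if_pos hb).symm
        change (if h : b ∈ faceSet G then ℓ.comp (toTop hX h) else 0) (mulMap X h y) =
          (if h : a ∈ faceSet G then ℓ.comp (toTop hX h) else 0) y
        rw [dif_pos hb]
        by_cases ha : 0 ≤ a
        · rw [dif_pos (mem_faceSet_of_le ha h hb), LinearMap.comp_apply,
            toTop_mulMap hX (mem_faceSet_of_le ha h hb), LinearMap.comp_apply]
        · rw [hX.eq_zero_of_not_nonneg ha y, map_zero, map_zero, map_zero]
      · refine Eq.trans ?_ (if_neg hb).symm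
        change (if h : b ∈ faceSet G then ℓ.comp (toTop hX h) else 0) (mulMap X h y) = 0
        rw [dif_neg hb, LinearMap.zero_apply])

lemma coe_ev_toQuotPrime {G : Finset (Fin n)} (ℓ : X.obj (ind G) →ₗ[k] k) {a : Deg n}
    (ha : a ∈ faceSet G) (x : X.obj a) : (ev (toQuotPrime hX ℓ) a x).1 = ℓ (toTop hX ha x) := by
  classical
  change (if h : a ∈ faceSet G then ℓ.comp (toTop hX h) else 0) x = _
  rw [dif_pos ha, LinearMap.comp_apply]

lemma coe_ev_toQuotPrime_self {G : Finset (Fin n)} (ℓ : X.obj (ind G) →ₗ[k] k)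
    (x : X.obj (ind G)) : (ev (toQuotPrime hX ℓ) _ x).1 = ℓ x := by
  rw [coe_ev_toQuotPrime hX ℓ (ind_mem_faceSet_iff.2 subset_rfl), toTop_self]

variable (V W : Finset (Fin n) → Type u) [∀ G, AddCommGroup (V G)] [∀ G, Module k (V G)]
  [∀ G, AddCommGroup (W G)] [∀ G, Module k (W G)]

/-- The components of a coinduced module. -/
def coindComp (a : Deg n) : Submodule k (∀ G, V G) where
  carrier := {x | ∀ G, a ∉ faceSet G → x G = 0}
  add_mem' := fun hx hy G h => by rw [Pi.add_apply, hx G h, hy G h, add_zero]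
  zero_mem' := fun _ _ => rfl
  smul_mem' := fun c _ hx G h => by rw [Pi.smul_apply, hx G h, smul_zero]

open Classical in
/-- Multiplication on a coinduced module. -/
def coindMul (b : Deg n) : (∀ G, V G) →ₗ[k] coindComp (k := k) V b where
  toFun x := ⟨fun G => if b ∈ faceSet G then x G else 0, fun _ h => if_neg h⟩
  map_add' x y := Subtype.ext (funext fun G => by
    change (if b ∈ faceSet G then x G + y G else 0) =
      (if b ∈ faceSet G then x G else 0) + (if b ∈ faceSet G then y G else 0)
    split_ifs
    · rfl
    · rw [add_zero])
  map_smul' r x := Subtype.ext (funext fun G => by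
    change (if b ∈ faceSet G then r • x G else 0) = r • (if b ∈ faceSet G then x G else 0)
    split_ifs
    · rfl
    · rw [smul_zero])

lemma coindMul_apply {b : Deg n} (x : ∀ G, V G) {G : Finset (Fin n)} (h : b ∈ faceSet G) :
    (coindMul (k := k) V b x).1 G = x G := if_pos h

variable (k) in
/-- The module `⨁_G V_G ⊗ S/P_G`. -/
def coind : GrMod k n where
  obj a := ModuleCat.of k (coindComp (k := k) V a)
  map {_ b} _ := ModuleCat.ofHom ((coindMul V b).comp (Submodule.subtype _))
  map_id a := by
    refine ModuleCat.hom_ext (LinearMap.ext fun x => Subtype.ext (funext fun G => ?_))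
    by_cases h : a ∈ faceSet G
    · exact coindMul_apply (k := k) V _ h
    · exact (Subtype.property (coindMul (k := k) V a x.1) G h).trans (x.2 G h).symm
  map_comp {a b c} f g := by
    refine ModuleCat.hom_ext (LinearMap.ext fun x => Subtype.ext (funext fun G => ?_))
    by_cases hc : c ∈ faceSet G
    · refine (coindMul_apply (k := k) V _ hc).trans (Eq.trans ?_ (coindMul_apply
        (k := k) V _ hc).symm)
      by_cases hb : b ∈ faceSet G
      · exact (coindMul_apply (k := k) V _ hb).symm
      · have ha : a ∉ faceSet G := fun ha => hb
          (mem_faceSet_of_le (ha.1.trans (leOfHom f)) (leOfHom g) hc)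
        exact (x.2 G ha).trans (Subtype.property (coindMul (k := k) V b x.1) G hb).symm
    · exact (Subtype.property (coindMul (k := k) V c x.1) G hc).trans
        (Subtype.property (coindMul (k := k) V c _) G hc).symm

variable {V W}

lemma coe_mulMap_coind {a b : Deg n} (h : a ≤ b) (x : (coind k V).obj a) {G : Finset (Fin n)}
    (hb : b ∈ faceSet G) : (mulMap (coind k V) h x).1 G = x.1 G := coindMul_apply V x.1 hb

lemma coind_ext {a : Deg n} {x y : (coind k V).obj a} (h : ∀ G, a ∈ faceSet G → x.1 G = y.1 G) :
    x = y := Subtype.ext (funext fun G => by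
  by_cases hG : a ∈ faceSet G
  · exact h G hG
  · exact (x.2 G hG).trans (y.2 G hG).symm)

lemma isSquarefree_coind [∀ G, Module.Finite k (V G)] : IsSquarefree (coind k V) where
  subsingleton a ha := ⟨fun x y => coind_ext fun G h => absurd h.1 ha⟩
  finite a := inferInstanceAs (Module.Finite k (coindComp (k := k) V a))
  bijective a b h ha hs := by
    have hab : ∀ G, a ∈ faceSet G ↔ b ∈ faceSet G := fun G => by
      rw [mem_faceSet_iff_posSupp ha, mem_faceSet_iff_posSupp (ha.trans h), hs]
    constructor
    · intro x y hxy
      refine coind_ext fun G hG => ?_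
      rw [← coe_mulMap_coind h x ((hab G).1 hG), hxy, coe_mulMap_coind h y ((hab G).1 hG)]
    · intro y
      exact ⟨⟨y.1, fun G hG => y.2 G fun h => hG ((hab G).2 h)⟩,
        coind_ext fun G hG => coe_mulMap_coind h _ hG⟩

open Classical in
/-- The morphism to a coinduced module given by linear maps on the squarefree components. -/
def coindDesc (g : ∀ G, X.obj (ind G) →ₗ[k] V G) : X ⟶ coind k V :=
  homOfLinear
    (fun a => LinearMap.codRestrict (coindComp V a)
      (LinearMap.pi fun G => if h : a ∈ faceSet G then (g G).comp (toTop hX h) else 0)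
      fun y G hG => by
        change (if h : a ∈ faceSet G then (g G).comp (toTop hX h) else 0) y = 0
        rw [dif_neg hG, LinearMap.zero_apply])
    (by
      intro a b h y
      refine coind_ext fun G hb => Eq.trans ?_ (coe_mulMap_coind h _ hb).symm
      change (if h : b ∈ faceSet G then (g G).comp (toTop hX h) else 0) (mulMap X h y) =
        (if h : a ∈ faceSet G then (g G).comp (toTop hX h) else 0) y
      rw [dif_pos hb]
      by_cases ha : 0 ≤ a
      · rw [dif_pos (mem_faceSet_of_le ha h hb), LinearMap.comp_apply,
          toTop_mulMap hX (mem_faceSet_of_le ha h hb), LinearMap.comp_apply]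
      · rw [hX.eq_zero_of_not_nonneg ha y, map_zero, map_zero, map_zero])

lemma coe_ev_coindDesc (g : ∀ G, X.obj (ind G) →ₗ[k] V G) {a : Deg n} (x : X.obj a)
    {G : Finset (Fin n)} (ha : a ∈ faceSet G) :
    (ev (coindDesc hX g) a x).1 G = g G (toTop hX ha x) := by
  classical
  change (if h : a ∈ faceSet G then (g G).comp (toTop hX h) else 0) x = _
  rw [dif_pos ha, LinearMap.comp_apply]

-- Multiplication on the `G`-component of a coinduced module is the identity between degrees of the
-- face. Comparing `x` and its transport to degree `G` in the common degree `a + G` shows that a map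
-- is determined by its squarefree components.
include hX in
lemma coe_ev_coind (f : X ⟶ coind k V) {a : Deg n} (x : X.obj a) {G : Finset (Fin n)}
    (ha : a ∈ faceSet G) : (ev f a x).1 G = (ev f _ (toTop hX ha x)).1 G := by
  have h1 : a + ind G ∈ faceSet G := (mem_faceSet_iff_posSupp
    (ha.1.trans (le_add_ind a G))).2 (by rw [posSupp_add_ind ha, posSupp_ind])
  rw [← coe_mulMap_coind (le_add_ind a G) _ h1, ← ev_mulMap, ← mulMap_toTop hX ha, ev_mulMap,
    coe_mulMap_coind _ _ h1]

/-- Injectivity among squarefree modules. -/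
def SqInjective (N : GrMod k n) : Prop :=
  ∀ ⦃X Y : GrMod k n⦄ (_ : IsSquarefree X) (_ : IsSquarefree Y) (f : X ⟶ Y)
    (_ : ∀ a, Function.Injective (ev f a)) (g : X ⟶ N), ∃ h : Y ⟶ N, f ≫ h = g

variable (V) in
/-- Coinduced modules are injective. -/
lemma sqInjective_coind : SqInjective (coind k V) := by
  intro X Y hX hY f hf g
  let p (G : Finset (Fin n)) : X.obj (ind G) →ₗ[k] V G :=
    ((LinearMap.proj G).comp (Submodule.subtype (coindComp V (ind G)))).comp (ev g (ind G))
  -- Over a field each `X_G ⟶ Y_G` has a retraction. These may be chosen independently, because a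
  -- map to a coinduced module is an arbitrary family of linear maps on squarefree components.
  have h1 : ∀ G, ∃ q : Y.obj (ind G) →ₗ[k] X.obj (ind G), q.comp (ev f (ind G)) = LinearMap.id :=
    fun G => LinearMap.exists_leftInverse_of_injective _ (LinearMap.ker_eq_bot.2 (hf _))
  choose q hq using h1
  refine ⟨coindDesc hY fun G => (p G).comp (q G), hom_ext_ev fun a x => coind_ext fun G ha => ?_⟩
  rw [ev_comp, coe_ev_coindDesc hY _ _ ha, coe_ev_coind hX g x ha, ← ev_toTop hX hY,
    LinearMap.comp_apply]
  exact congrArg (p G) (LinearMap.congr_fun (hq G) (toTop hX ha x))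

lemma SqInjective.of_retract {N N' : GrMod k n} (hN : SqInjective N) (s : N' ⟶ N) (p : N ⟶ N')
    (h : s ≫ p = 𝟙 _) : SqInjective N' := by
  intro X Y hX hY f hf g
  obtain ⟨q, hq⟩ := hN hX hY f hf (g ≫ s)
  exact ⟨q ≫ p, by rw [← Category.assoc, hq, Category.assoc, h, Category.comp_id]⟩

lemma SqInjective.of_sum {N N₁ N₂ : GrMod k n} (h₁ : SqInjective N₁) (h₂ : SqInjective N₂)
    (i₁ : N₁ ⟶ N) (p₁ : N ⟶ N₁) (i₂ : N₂ ⟶ N) (p₂ : N ⟶ N₂) (h : p₁ ≫ i₁ + p₂ ≫ i₂ = 𝟙 N) :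
    SqInjective N := by
  intro X Y hX hY f hf g
  obtain ⟨q₁, hq₁⟩ := h₁ hX hY f hf (g ≫ p₁)
  obtain ⟨q₂, hq₂⟩ := h₂ hX hY f hf (g ≫ p₂)
  refine ⟨q₁ ≫ i₁ + q₂ ≫ i₂, ?_⟩
  rw [Preadditive.comp_add, ← Category.assoc, hq₁, ← Category.assoc, hq₂, Category.assoc,
    Category.assoc, ← Preadditive.comp_add, h, Category.comp_id]

/-- The functor `N ↦ ⨁_G N_G ⊗ S/P_G`. -/
def coindFunctor (k : Type u) [Field k] (n : ℕ) : GrMod k n ⥤ GrMod k n where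
  obj N := coind k fun G => N.obj (ind G)
  map {M N} f := homOfLinear
    (fun a => LinearMap.restrict (LinearMap.pi fun G => (ev f (ind G)).comp (LinearMap.proj G))
      fun x hx G hG => (congrArg (ev f (ind G)) (hx G hG)).trans (map_zero _))
    (by
      intro a b h y
      refine coind_ext fun G hb => ?_
      rw [coe_mulMap_coind h _ hb]
      exact congrArg (ev f (ind G)) (coe_mulMap_coind h y hb))
  map_id _ := rfl
  map_comp _ _ := rfl

lemma coe_ev_coindFunctor_map {M N : GrMod k n} (f : M ⟶ N) (a : Deg n)
    (x : ((coindFunctor k n).obj M).obj a) (G : Finset (Fin n)) :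
    (ev ((coindFunctor k n).map f) a x).1 G = ev f (ind G) (x.1 G) := rfl

instance : (coindFunctor k n).Additive where
  map_add := rfl

include hX in
lemma isSquarefree_coindFunctor : IsSquarefree ((coindFunctor k n).obj X) :=
  have := fun G => hX.finite (ind G)
  isSquarefree_coind

/-- The embedding of a squarefree module into a coinduced module. -/
def coindUnit : X ⟶ (coindFunctor k n).obj X := coindDesc hX fun _ => LinearMap.id

lemma coe_ev_coindUnit {a : Deg n} (x : X.obj a) {G : Finset (Fin n)} (ha : a ∈ faceSet G) :
    (ev (coindUnit hX) a x).1 G = toTop hX ha x := coe_ev_coindDesc hX _ x ha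

lemma coindUnit_naturality (f : X ⟶ Y) :
    f ≫ coindUnit hY = coindUnit hX ≫ (coindFunctor k n).map f :=
  hom_ext_ev fun a x => coind_ext fun G ha => by
    rw [ev_comp, ev_comp, coe_ev_coindUnit hY _ ha, coe_ev_coindFunctor_map,
      coe_ev_coindUnit hX _ ha, ev_toTop hX hY]

/-- In degree `a ≥ 0`, the component for `G = supp₊ a` is already injective. -/
lemma coindUnit_injective (a : Deg n) : Function.Injective (ev (coindUnit hX) a) := by
  refine (injective_iff_map_eq_zero _).2 fun x hx => ?_
  by_cases h0 : 0 ≤ a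
  · have ha : a ∈ faceSet (posSupp a) := (mem_faceSet_iff_posSupp h0).2 subset_rfl
    refine (injective_iff_map_eq_zero _).1 (toTop_injective hX h0 ha) x ?_
    rw [← coe_ev_coindUnit hX x ha, hx]
    rfl
  · exact hX.eq_zero_of_not_nonneg h0 x

/-- `N ⟶ ⨁_G N_G ⊗ S/P_G` is surjective in degrees `F` such that `N_G = 0` for `G ⊋ F`. -/
lemma coindUnit_surjective {F : Finset (Fin n)} (h : ∀ G, F ⊂ G → Subsingleton (X.obj (ind G))) :
    Function.Surjective (ev (coindUnit hX) (ind F)) := by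
  intro y
  refine ⟨y.1 F, coind_ext fun G hG => ?_⟩
  by_cases hFG : F = G
  · subst hFG
    rw [coe_ev_coindUnit hX _ hG, toTop_self]
  · have := h G ((ind_mem_faceSet_iff.1 hG).ssubset_of_ne hFG)
    exact Subsingleton.elim _ _

end Coinduced

/-! ## Injective resolutions of complexes of squarefree modules -/

section Closure

/-- Direct summands of finite sums of squarefree modules are squarefree. -/
lemma IsSquarefree.of_sum {J : Type*} [Fintype J] {N : GrMod k n} (A : J → GrMod k n)
    (hA : ∀ j, IsSquarefree (A j)) (s : ∀ j, A j ⟶ N) (p : ∀ j, N ⟶ A j)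
    (h : ∑ j, p j ≫ s j = 𝟙 N) : IsSquarefree N := by
  have key : ∀ a (x : N.obj a), ∑ j, ev (s j) a (ev (p j) a x) = x := fun a x => by
    have h1 := congrArg (fun f => ev f a x) h
    simp only [ev_sum, ev_id, ev_comp] at h1
    exact h1
  have inj : ∀ a (x : N.obj a), (∀ j, ev (p j) a x = 0) → x = 0 := fun a x hx => by
    rw [← key a x]
    exact Finset.sum_eq_zero fun j _ => by rw [hx, map_zero]
  refine ⟨fun a ha => ⟨fun x y => ?_⟩, fun a => ?_, fun a b hab ha hs => ⟨?_, fun y => ?_⟩⟩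
  · rw [← sub_eq_zero]
    exact inj a _ fun j => (hA j).eq_zero_of_not_nonneg ha _
  · have := fun j => (hA j).finite a
    refine Module.Finite.of_injective (LinearMap.pi fun j => ev (p j) a)
      ((injective_iff_map_eq_zero _).2 fun x hx => inj a x fun j => congrFun hx j)
  · refine (injective_iff_map_eq_zero _).2 fun x hx => inj a x fun j => ?_
    refine (injective_iff_map_eq_zero _).1 ((hA j).bijective a b hab ha hs).1 _ ?_
    rw [← ev_mulMap, hx, map_zero]
  · choose z hz using fun j => ((hA j).bijective a b hab ha hs).2 (ev (p j) b y)
    refine ⟨∑ j, ev (s j) a (z j), ?_⟩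
    rw [map_sum, ← key b y]
    exact Finset.sum_congr rfl fun j _ => by rw [← ev_mulMap, hz]

lemma IsSquarefree.of_sum₂ {N A B : GrMod k n} (hA : IsSquarefree A) (hB : IsSquarefree B)
    (i₁ : A ⟶ N) (p₁ : N ⟶ A) (i₂ : B ⟶ N) (p₂ : N ⟶ B) (h : p₁ ≫ i₁ + p₂ ≫ i₂ = 𝟙 N) :
    IsSquarefree N := by
  refine IsSquarefree.of_sum (J := Bool) (fun b => bif b then A else B) (fun b => ?_)
    (fun b => match b with | true => i₁ | false => i₂)
    (fun b => match b with | true => p₁ | false => p₂) ?_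
  · cases b
    · exact hB
    · exact hA
  · rw [Fintype.sum_bool]
    exact h

lemma IsSquarefree.of_retract {N A : GrMod k n} (hA : IsSquarefree A) (s : N ⟶ A) (p : A ⟶ N)
    (h : s ≫ p = 𝟙 N) : IsSquarefree N :=
  IsSquarefree.of_sum (J := Unit) (fun _ => A) (fun _ => hA) (fun _ => p) (fun _ => s) (by
    rw [Fintype.sum_unique]
    exact h)

/-- Cokernels of maps of squarefree modules are squarefree. -/
lemma IsSquarefree.of_exact {X Y Z : GrMod k n} (hX : IsSquarefree X) (hY : IsSquarefree Y)
    (f : X ⟶ Y) (g : Y ⟶ Z) (hg : ∀ a, Function.Surjective (ev g a))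
    (h : ∀ a y, ev g a y = 0 ↔ ∃ x, ev f a x = y) : IsSquarefree Z := by
  refine ⟨fun a ha => ⟨fun x y => ?_⟩, fun a => ?_, fun a b hab ha hs => ⟨?_, fun z => ?_⟩⟩
  · obtain ⟨x, rfl⟩ := hg a x
    obtain ⟨y, rfl⟩ := hg a y
    rw [hY.eq_zero_of_not_nonneg ha x, hY.eq_zero_of_not_nonneg ha y]
  · have := hY.finite a
    exact Module.Finite.of_surjective _ (hg a)
  · refine (injective_iff_map_eq_zero _).2 fun z hz => ?_
    obtain ⟨y, rfl⟩ := hg a z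
    rw [← ev_mulMap, h] at hz
    obtain ⟨u, hu⟩ := hz
    obtain ⟨v, rfl⟩ := (hX.bijective a b hab ha hs).2 u
    rw [h]
    refine ⟨v, (hY.bijective a b hab ha hs).1 ?_⟩
    rw [← ev_mulMap, hu]
  · obtain ⟨y, rfl⟩ := hg b z
    obtain ⟨v, rfl⟩ := (hY.bijective a b hab ha hs).2 y
    exact ⟨ev g a v, (ev_mulMap g hab v).symm⟩

/-- A squarefree module vanishes if its squarefree components do. -/
lemma IsSquarefree.isZero {X : GrMod k n} (hX : IsSquarefree X)
    (h : ∀ G, Subsingleton (X.obj (ind G))) : IsZero X := by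
  rw [isZero_iff_eq_zero]
  intro a y
  by_cases h0 : 0 ≤ a
  · have ha : a ∈ faceSet (posSupp a) := (mem_faceSet_iff_posSupp h0).2 subset_rfl
    have := h (posSupp a)
    exact toTop_injective hX h0 ha (Subsingleton.elim _ _)
  · exact hX.eq_zero_of_not_nonneg h0 y

lemma SqInjective.of_isZero {X : GrMod k n} (hX : IsZero X) : SqInjective X :=
  fun _ _ _ _ _ _ _ => ⟨0, hX.eq_of_tgt _ _⟩

/-- The image of a morphism. -/
def GrSubmodule.range {M N : GrMod k n} (f : M ⟶ N) : GrSubmodule N where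
  comp a := LinearMap.range (ev f a)
  mul_mem a b h y := by
    rintro ⟨x, rfl⟩
    exact ⟨mulMap M h x, ev_mulMap f h x⟩

end Closure

/-! ### Quotients of complexes by graded subcomplexes -/

section QuotComplex

variable (J : CochainComplex (GrMod k n) ℤ) (L : ∀ j, GrSubmodule (J.X j))
  (hL : ∀ i j a y, y ∈ (L i).comp a → ev (J.d i j) a y ∈ (L j).comp a)

/-- The quotient of a complex by a graded subcomplex. -/
def quotComplex : CochainComplex (GrMod k n) ℤ where
  X j := (L j).quot
  d i j := GrSubmodule.mapQuot _ _ (J.d i j) (hL i j)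
  shape i j h := hom_ext_ev fun a x => by
    obtain ⟨x, rfl⟩ := Submodule.Quotient.mk_surjective _ x
    change Submodule.Quotient.mk (ev (J.d i j) a x) = 0
    rw [J.shape i j h, ev_zero]
    rfl
  d_comp_d' i j l _ _ := hom_ext_ev fun a x => by
    obtain ⟨x, rfl⟩ := Submodule.Quotient.mk_surjective _ x
    change Submodule.Quotient.mk (ev (J.d j l) a (ev (J.d i j) a x)) = 0
    rw [ev_d_d]
    rfl

/-- The projection to the quotient complex. -/
def quotComplexπ : J ⟶ quotComplex J L hL where
  f j := (L j).π
  comm' _ _ _ := rfl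

lemma ev_quotComplexπ_surjective (j : ℤ) (a : Deg n) :
    Function.Surjective (ev ((quotComplexπ J L hL).f j) a) := Submodule.mkQ_surjective _

lemma ev_quotComplexπ_eq_zero_iff (j : ℤ) (a : Deg n) (y : (J.X j).obj a) :
    ev ((quotComplexπ J L hL).f j) a y = 0 ↔ y ∈ (L j).comp a := Submodule.Quotient.mk_eq_zero _

end QuotComplex

/-! ### Splicing resolutions by mapping cocones -/

section Cocone

open CochainComplex HomComplex

/-- The identity of the cocone is the cochain lifting the pair `(fst, snd)`. That it is a cocycle
gives the formula after composition with `inr`, which is cancelled by composing with `snd`. -/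
lemma δ_mappingCocone_snd {K L : CochainComplex (GrMod k n) ℤ} (φ : K ⟶ L) :
    δ (-1) 0 (mappingCocone.snd φ) = -Cochain.ofHom (mappingCocone.fst φ ≫ φ) := by
  have h1 : mappingCocone.liftCochain φ (Cochain.ofHom (mappingCocone.fst φ)) (mappingCocone.snd φ)
      (by simp) = Cochain.ofHom (𝟙 (mappingCocone φ)) := by
    ext p
    rw [← Category.comp_id (Cochain.v _ p p _), ← mappingCocone.id_X φ p (p + -1) rfl,
      Preadditive.comp_add, mappingCocone.liftCochain_v_fst_f_assoc,
      mappingCocone.liftCochain_v_snd_v_assoc φ _ _ _ p p (p + -1) _ rfl, Cochain.ofHom_v,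
      Cochain.ofHom_v, HomologicalComplex.id_f, ← mappingCocone.id_X φ p (p + -1) rfl]
  have h2 := mappingCocone.δ_liftCochain φ (Cochain.ofHom (mappingCocone.fst φ))
    (mappingCocone.snd φ) (by simp) 1 rfl
  rw [h1, δ_ofHom, δ_ofHom, Cochain.zero_comp, zero_sub, eq_comm, neg_eq_zero,
    ← Cochain.ofHom_comp] at h2
  rw [eq_neg_iff_add_eq_zero]
  ext p
  have h3 := Cochain.congr_v h2 p (p + 1) rfl
  rw [Cochain.comp_v _ _ _ p p (p + 1) (add_zero p) rfl] at h3
  have h4 := congrArg (fun f => f ≫ (mappingCocone.snd φ).v (p + 1) p (by lia)) h3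
  simp only [Category.assoc, Cochain.zero_v, zero_comp] at h4
  rw [mappingCocone.inr_v_snd_v, Category.comp_id] at h4
  rw [h4, Cochain.zero_v]

/-- The mapping cocone, with terms `K^j ⊕ L^(j-1)`, presented by its projections `p`, `s`, its
inclusions `u`, `v` and the `L`-component of its differential, which is what the element computation
below needs. -/
lemma exists_cocone {M K L : CochainComplex (GrMod k n) ℤ} (φ : K ⟶ L) (η : M ⟶ K)
    (h : η ≫ φ = 0) :
    ∃ (C : CochainComplex (GrMod k n) ℤ) (e : M ⟶ C) (p : C ⟶ K)
      (s : ∀ i j : ℤ, i + 1 = j → (C.X j ⟶ L.X i)) (u : ∀ j, K.X j ⟶ C.X j)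
      (v : ∀ i j : ℤ, i + 1 = j → (L.X i ⟶ C.X j)),
      (∀ j, e.f j ≫ p.f j = η.f j) ∧ (∀ i j hij, e.f j ≫ s i j hij = 0) ∧
      (∀ j, u j ≫ p.f j = 𝟙 _) ∧ (∀ i j hij, u j ≫ s i j hij = 0) ∧
      (∀ i j hij, v i j hij ≫ p.f j = 0) ∧ (∀ i j hij, v i j hij ≫ s i j hij = 𝟙 _) ∧
      (∀ i j hij, p.f j ≫ u j + s i j hij ≫ v i j hij = 𝟙 _) ∧
      (∀ h i j hhi hij, C.d i j ≫ s i j hij = -(p.f i ≫ φ.f i) - s h i hhi ≫ L.d h i) := by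
  refine ⟨mappingCocone φ, mappingCocone.lift φ η 0 (by simp [h]), mappingCocone.fst φ,
    fun i j hij => (mappingCocone.snd φ).v j i (by lia),
    fun j => (mappingCocone.inl φ).v j j (add_zero j),
    fun i j hij => (mappingCocone.inr φ).1.v i j hij, fun j => by simp,
    fun i j hij => by simp, fun j => by simp, fun i j hij => by simp, fun i j hij => by simp,
    fun i j hij => by simp, fun i j hij => mappingCocone.id_X φ j i (by lia),
    fun h i j hhi hij => ?_⟩
  have h1 := Cochain.congr_v (δ_mappingCocone_snd φ) i i (add_zero i)
  rw [δ_v (-1) 0 (by lia) _ i i (add_zero i) h j (by lia) (by lia)] at h1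
  simp only [Int.negOnePow_zero, one_smul, Cochain.neg_v, Cochain.ofHom_v,
    HomologicalComplex.comp_f] at h1
  rw [← h1]
  abel

/-- Extending a resolution of a cokernel. -/
lemma exists_quasiIso_cocone {M E Q J : CochainComplex (GrMod k n) ℤ} (η : M ⟶ E) (π : E ⟶ Q)
    (g : Q ⟶ J) (hg : QuasiIso g) (hη : ∀ j a, Function.Injective (ev (η.f j) a))
    (hπ : ∀ j a, Function.Surjective (ev (π.f j) a))
    (hex : ∀ j a y, ev (π.f j) a y = 0 ↔ ∃ x, ev (η.f j) a x = y) :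
    ∃ (C : CochainComplex (GrMod k n) ℤ) (e : M ⟶ C) (p : ∀ j, C.X j ⟶ E.X j)
      (s : ∀ i j : ℤ, i + 1 = j → (C.X j ⟶ J.X i)) (u : ∀ j, E.X j ⟶ C.X j)
      (v : ∀ i j : ℤ, i + 1 = j → (J.X i ⟶ C.X j)), QuasiIso e ∧
      (∀ i j hij, p j ≫ u j + s i j hij ≫ v i j hij = 𝟙 _) := by
  have h0 : η ≫ π ≫ g = 0 := by
    rw [← Category.assoc]
    ext j : 1
    have : η.f j ≫ π.f j = 0 := hom_ext_ev fun a x => by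
      rw [ev_comp, ev_zero, hex]
      exact ⟨x, rfl⟩
    rw [HomologicalComplex.comp_f, HomologicalComplex.comp_f, this, zero_comp,
      HomologicalComplex.zero_f]
  obtain ⟨C, e, p, s, u, v, h1, h2, h3, h4, h5, h6, h7, h8⟩ := exists_cocone (π ≫ g) η h0
  have E1 : ∀ j a x, ev (p.f j) a (ev (e.f j) a x) = ev (η.f j) a x := fun j a x => by
    rw [← ev_comp, h1]
  have E2 : ∀ i j hij a x, ev (s i j hij) a (ev (e.f j) a x) = 0 := fun i j hij a x => by
    rw [← ev_comp, h2, ev_zero]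
  have E3 : ∀ j a x, ev (p.f j) a (ev (u j) a x) = x := fun j a x => by
    rw [← ev_comp, h3, ev_id]
  have E4 : ∀ i j hij a x, ev (s i j hij) a (ev (u j) a x) = 0 := fun i j hij a x => by
    rw [← ev_comp, h4, ev_zero]
  have E5 : ∀ i j hij a x, ev (p.f j) a (ev (v i j hij) a x) = 0 := fun i j hij a x => by
    rw [← ev_comp, h5, ev_zero]
  have E6 : ∀ i j hij a x, ev (s i j hij) a (ev (v i j hij) a x) = x := fun i j hij a x => by
    rw [← ev_comp, h6, ev_id]
  have E7 : ∀ i j (hij : i + 1 = j) a (x : (C.X j).obj a), ev (p.f j) a x = 0 →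
      ev (s i j hij) a x = 0 → x = 0 := fun i j hij a x hp hs => by
    have := congrArg (fun f => ev f a x) (h7 i j hij)
    simp only [ev_add, ev_comp, hp, hs, map_zero, add_zero, ev_id] at this
    exact this.symm
  have E8 : ∀ h i j hhi hij a x, ev (s i j hij) a (ev (C.d i j) a x) =
      -ev (g.f i) a (ev (π.f i) a (ev (p.f i) a x)) - ev (J.d h i) a (ev (s h i hhi) a x) :=
    fun h i j hhi hij a x => by
      have := congrArg (fun f => ev f a x) (h8 h i j hhi hij)
      simpa only [ev_sub, ev_neg, ev_comp, HomologicalComplex.comp_f] using this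
  refine ⟨C, e, fun j => p.f j, s, u, v, (quasiIso_iff_exists e).2 ?_, h7⟩
  intro h i j l hhi hij hjl a z w hz hzw
  obtain ⟨h', hh'⟩ : ∃ h', h' + 1 = h := ⟨h - 1, by lia⟩
  have A1 : ev (η.f j) a z = ev (E.d i j) a (ev (p.f i) a w) := by
    rw [← E1, hzw, ev_comm]
  have A2 : ev (g.f i) a (ev (π.f i) a (ev (p.f i) a w)) =
      ev (J.d h i) a (-ev (s h i hhi) a w) := by
    have := E2 i j hij a z
    rw [hzw, E8 h i j hhi hij] at this
    rw [map_neg]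
    rw [sub_eq_zero] at this
    rw [← this, neg_neg]
  have A3 : ev (Q.d i j) a (ev (π.f i) a (ev (p.f i) a w)) = 0 := by
    rw [← ev_comm, ← A1, hex]
    exact ⟨z, rfl⟩
  -- The pair formed by the `E`-component of `w`, projected to `Q`, and minus its `J`-component is a
  -- cocycle of the cone of `g`, hence bounds. Lifting `y` to `E` corrects the `E`-component of `w`
  -- to an element of `ker π`, which comes from `M`.
  obtain ⟨y, q, hy, hq⟩ := (quasiIso_iff_exists g).1 hg h' h i j hh' hhi hij a _ _ A3 A2
  obtain ⟨x', rfl⟩ := hπ h a y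
  have A4 : ev (π.f i) a (ev (p.f i) a w - ev (E.d h i) a x') = 0 := by
    rw [map_sub, hy, ev_comm, sub_self]
  obtain ⟨z', hz'⟩ := (hex _ _ _).1 A4
  refine ⟨z', ev (u h) a x' + ev (v h' h hh') a q, hη j a ?_, ?_⟩
  · rw [A1, ev_comm, hz', map_sub, ev_d_d, sub_zero]
  · rw [← sub_eq_zero]
    -- Equality in the cocone is checked on the two components.
    refine E7 h i hhi a _ ?_ ?_
    · rw [map_sub, map_add, E1, ev_comm, map_add, E3, E5, add_zero, hz']
      abel
    · rw [map_sub, map_add, E2, E8 h' h i hh' hhi, map_add (ev (p.f h) a),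
        map_add (ev (s h' h hh') a), E3, E5, E4, E6, add_zero, zero_add, zero_add,
            neg_eq_iff_eq_neg.1 hq]
      abel

end Cocone

/-- A complex of graded modules with only finitely many nonzero terms. -/
def HasBound (M : CochainComplex (GrMod k n) ℤ) : Prop :=
  ∃ N : ℕ, ∀ i : ℤ, (N : ℤ) < |i| → IsZero (M.X i)

lemma isZero_of_surjective {M N : GrMod k n} (f : M ⟶ N) (hf : ∀ a, Function.Surjective (ev f a))
    (h : IsZero M) : IsZero N := by
  rw [isZero_iff_eq_zero] at h ⊢
  intro a y
  obtain ⟨x, rfl⟩ := hf a y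
  rw [h a x, map_zero]

/-- Induction on a bound for the faces supporting `M`. Let `E` be the coinduced complex containing
`M` and `Q` the cokernel. In degrees `G` of the top size allowed, `M_G ⟶ E_G` is onto, since `M`
vanishes on larger faces; so `Q` lives on smaller faces and has a resolution `J`. The cocone of `E ⟶
Q ⟶ J` resolves `M`, with terms `E^i ⊕ J^(i-1)`. -/
lemma exists_injective_resolution_aux (r : ℕ) : ∀ (M : CochainComplex (GrMod k n) ℤ),
    HasBound M → (∀ i, IsSquarefree (M.X i)) →
    (∀ i (G : Finset (Fin n)), r ≤ G.card → Subsingleton ((M.X i).obj (ind G))) →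
    ∃ (J : CochainComplex (GrMod k n) ℤ) (φ : M ⟶ J), QuasiIso φ ∧ HasBound J ∧
      (∀ i, IsSquarefree (J.X i)) ∧ ∀ i, SqInjective (J.X i) := by
  induction r with
  | zero =>
    intro M hb hsq h
    exact ⟨M, 𝟙 M, inferInstance, hb, hsq, fun i => SqInjective.of_isZero
      ((hsq i).isZero fun G => h i G (Nat.zero_le _))⟩
  | succ r ih =>
    intro M hb hsq h
    let E := ((coindFunctor k n).mapHomologicalComplex (ComplexShape.up ℤ)).obj M
    let η : M ⟶ E :=
      { f := fun j => coindUnit (hsq j)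
        comm' := fun i j _ => (coindUnit_naturality (hsq i) (hsq j) (M.d i j)).symm }
    let L : ∀ j, GrSubmodule (E.X j) := fun j => GrSubmodule.range (η.f j)
    have hL : ∀ i j a y, y ∈ (L i).comp a → ev (E.d i j) a y ∈ (L j).comp a := by
      rintro i j a _ ⟨x, rfl⟩
      exact ⟨ev (M.d i j) a x, ev_comm η i j a x⟩
    let Q := quotComplex E L hL
    let π : E ⟶ Q := quotComplexπ E L hL
    have hE : ∀ j, IsSquarefree (E.X j) := fun j => isSquarefree_coindFunctor (hsq j)
    have hEz : ∀ j, IsZero (M.X j) → IsZero (E.X j) := fun j hj => (coindFunctor k n).map_isZero hj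
    have hπ : ∀ j a, Function.Surjective (ev (π.f j) a) := ev_quotComplexπ_surjective E L hL
    have hex : ∀ j a y, ev (π.f j) a y = 0 ↔ ∃ x, ev (η.f j) a x = y :=
      ev_quotComplexπ_eq_zero_iff E L hL
    obtain ⟨N, hN⟩ := hb
    obtain ⟨J, g, hg, ⟨N', hN'⟩, hJ, hJinj⟩ := ih Q
      ⟨N, fun i hi => isZero_of_surjective _ (hπ i) (hEz i (hN i hi))⟩
      (fun i => (hsq i).of_exact (hE i) (η.f i) (π.f i) (hπ i) (hex i)) (fun i G hG => ⟨by
        have h1 : ∀ y, ev (π.f i) (ind G) y = 0 := fun y => (hex _ _ _).2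
          (coindUnit_surjective (hsq i) (fun G' hG' => h i G' (hG.trans_lt
            (Finset.card_lt_card hG'))) y)
        intro x y
        obtain ⟨x, rfl⟩ := hπ i _ x
        obtain ⟨y, rfl⟩ := hπ i _ y
        rw [h1, h1]⟩)
    obtain ⟨C, e, p, s, u, v, he, hid⟩ := exists_quasiIso_cocone η π g hg
      (fun j => coindUnit_injective (hsq j)) hπ hex
    refine ⟨C, e, he, ⟨N + N' + 1, fun i hi => ?_⟩, fun i => ?_, fun i => ?_⟩
    · have h1 := (hEz i (hN i (by push_cast at hi; lia)))
      have h2 := hN' (i - 1) (by push_cast at hi; rw [lt_abs] at hi ⊢; lia)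
      rw [IsZero.iff_id_eq_zero, ← hid (i - 1) i (by lia), h1.eq_of_tgt (p i) 0,
        h2.eq_of_tgt (s (i - 1) i (by lia)) 0, zero_comp, zero_comp, add_zero]
    · exact (hE i).of_sum₂ (hJ (i - 1)) _ _ _ _ (hid (i - 1) i (by lia))
    · exact SqInjective.of_sum (sqInjective_coind _) (hJinj (i - 1)) _ _ _ _
        (hid (i - 1) i (by lia))

/-- Bounded complexes of squarefree modules have finite injective resolutions. -/
theorem exists_injective_resolution (M : CochainComplex (GrMod k n) ℤ) (hb : HasBound M)
    (hsq : ∀ i, IsSquarefree (M.X i)) :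
    ∃ (J : CochainComplex (GrMod k n) ℤ) (φ : M ⟶ J), QuasiIso φ ∧ HasBound J ∧
      (∀ i, IsSquarefree (J.X i)) ∧ ∀ i, SqInjective (J.X i) :=
  -- No subset of `[n]` has more than `n` elements, so the vanishing condition is empty.
  exists_injective_resolution_aux (n + 1) M hb hsq fun i G hG => absurd
    ((Finset.card_le_univ G).trans (Fintype.card_fin n).le) (by lia)

/-! ## The structure of injective squarefree modules -/

section Structure

lemma isSquarefree_monomialModule {U : Set (Deg n)} (hU : U.OrdConnected) (h0 : ∀ a ∈ U, 0 ≤ a)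
    (h1 : ∀ a b : Deg n, a ≤ b → 0 ≤ a → posSupp b = posSupp a → (a ∈ U ↔ b ∈ U)) :
    IsSquarefree (monomialModule k U hU) where
  subsingleton a ha := ⟨fun x y => by
    rw [monomialModule_eq_zero hU (fun h => ha (h0 a h)) x,
      monomialModule_eq_zero hU (fun h => ha (h0 a h)) y]⟩
  finite a := inferInstanceAs (Module.Finite k (only (a ∈ U) k : Submodule k k))
  bijective a b h ha hs := by
    classical
    have hab := h1 a b h ha hs
    by_cases hb : b ∈ U
    · constructor
      · intro x y hxy
        refine Subtype.ext ?_
        have hx := (mulMap_coe_monomialModule hU h x).trans (if_pos hb)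
        have hy := (mulMap_coe_monomialModule hU h y).trans (if_pos hb)
        exact hx.symm.trans ((congrArg Subtype.val hxy).trans hy)
      · intro y
        refine ⟨⟨y.1, fun h => absurd (hab.2 hb) h⟩, Subtype.ext ?_⟩
        exact (mulMap_coe_monomialModule hU h _).trans (if_pos hb)
    · constructor
      · intro x y _
        rw [monomialModule_eq_zero hU (fun h => hb (hab.1 h)) x,
          monomialModule_eq_zero hU (fun h => hb (hab.1 h)) y]
      · intro y
        exact ⟨0, by rw [map_zero, monomialModule_eq_zero hU hb y]⟩

lemma isSquarefree_quotPrime (G : Finset (Fin n)) : IsSquarefree (quotPrime k G) :=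
  isSquarefree_monomialModule _ (fun _ ha => ha.1) fun a b h ha hs => by
    change a ∈ faceSet G ↔ b ∈ faceSet G
    rw [mem_faceSet_iff_posSupp ha, mem_faceSet_iff_posSupp (ha.trans h), hs]

variable {J : Type} [Fintype J] (A : J → GrMod k n)

lemma isSquarefree_biproduct (hA : ∀ j, IsSquarefree (A j)) : IsSquarefree (⨁ A) := by
  classical
  exact IsSquarefree.of_sum A hA (biproduct.ι A) (biproduct.π A) biproduct.total

variable {A} in
lemma biproduct_ext {a : Deg n} {x y : (⨁ A).obj a}
    (h : ∀ j, ev (biproduct.π A j) a x = ev (biproduct.π A j) a y) : x = y := by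
  classical
  have key : ∀ x : (⨁ A).obj a, ∑ j, ev (biproduct.ι A j) a (ev (biproduct.π A j) a x) = x :=
    fun x => by
      have h1 := congrArg (fun f => ev f a x) (biproduct.total (f := A))
      simp only [ev_sum, ev_id, ev_comp] at h1
      exact h1
  rw [← key x, ← key y]
  exact Finset.sum_congr rfl fun j _ => by rw [h]

/-- Degreewise kernels. -/
def GrSubmodule.ker {M N : GrMod k n} (f : M ⟶ N) : GrSubmodule M where
  comp a := LinearMap.ker (ev f a)
  mul_mem a b h y hy := by
    rw [LinearMap.mem_ker] at hy ⊢
    rw [ev_mulMap, hy, map_zero]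

/-- A map of squarefree modules that is injective on socles is injective. -/
lemma injective_of_socle {M N : GrMod k n} (hM : IsSquarefree M) (hN : IsSquarefree N) (f : M ⟶ N)
    (h : ∀ F (y : M.obj (ind F)), KilledOutside F y → ev f _ y = 0 → y = 0) (a : Deg n) :
    Function.Injective (ev f a) := by
  refine LinearMap.ker_eq_bot.1 ?_
  by_contra hne
  obtain ⟨b, z, hb, hz0, hz, hk⟩ := hM.exists_killedOutside_mem (GrSubmodule.ker f) ⟨a, hne⟩
  obtain ⟨z', hz', rfl⟩ := hM.exists_socle (ind_posSupp_le hb) z hk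
  have hz : ev f b _ = 0 := hz
  rw [ev_mulMap] at hz
  have := (injective_iff_map_eq_zero _).1 (hN.bijective _ _ (ind_posSupp_le hb) (ind_nonneg _)
    (posSupp_ind _).symm).1 _ hz
  exact hz0 (by rw [h _ z' hz' this, map_zero])

/-- The socle of a module in degree `F`. -/
def socle (M : GrMod k n) (F : Finset (Fin n)) : Submodule k (M.obj (ind F)) where
  carrier := {y | KilledOutside F y}
  add_mem' := fun hx hy j hj => by rw [map_add, hx j hj, hy j hj, add_zero]
  zero_mem' := fun _ _ => map_zero _
  smul_mem' := fun c _ hx j hj => by rw [map_smul, hx j hj, smul_zero]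

lemma KilledOutside.ev {M N : GrMod k n} {F : Finset (Fin n)} {a : Deg n} {y : M.obj a}
    (hy : KilledOutside F y) (f : M ⟶ N) : KilledOutside F (SqfreeMod.ev f a y) := fun j hj => by
  rw [← ev_mulMap, hy j hj, map_zero]

/-- The socle of `S/P_G` sits in degree `G` alone: in degree `F ⊊ G`, a variable `x_j` with `j ∈ G \
F` acts injectively. -/
lemma quotPrime_eq_zero_of_killedOutside {F G : Finset (Fin n)} (h : F ≠ G)
    (y : (quotPrime k G).obj (ind F)) (hy : KilledOutside F y) : y = 0 := by
  by_cases hFG : F ⊆ G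
  · obtain ⟨j, hjG, hjF⟩ := Finset.exists_of_ssubset (hFG.ssubset_of_ne h)
    refine (injective_iff_map_eq_zero _).1 (mulMap_quotPrime_injective (k := k) (G := G)
      (le_add_unitDeg (ind F) j) fun i hi => ?_) y (hy j hjF)
    rw [deg_add_apply, unitDeg_apply, if_neg (fun h' : i = j => hi (h' ▸ hjG)), add_zero]
  · exact quotPrime_eq_zero y fun h' => hFG (ind_mem_faceSet_iff.1 h')

/-- Coordinates on the socles, extended to functionals on the `N_F`, define a map `φ` from `N` to a
sum of modules `S/P_F`; it is injective because it is so on socles. Injectivity of `N` gives a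
retraction `ρ`. The socle of the sum is the image of the socle of `N`, so `ρ` is injective on socles
too, hence an isomorphism. -/
theorem exists_iso_biproduct {N : GrMod k n} (hN : IsSquarefree N) (hinj : SqInjective N) :
    ∃ ν : Finset (Fin n) → ℕ,
      Nonempty (N ≅ ⨁ fun p : (F : Finset (Fin n)) × Fin (ν F) => quotPrime k p.1) := by
  classical
  have := fun F => hN.finite (ind F)
  let ν (F : Finset (Fin n)) : ℕ := Module.finrank k (socle N F)
  let e (F : Finset (Fin n)) : Module.Basis (Fin (ν F)) k (socle N F) := Module.finBasis k _
  have hc : ∀ F (t : Fin (ν F)), ∃ c : N.obj (ind F) →ₗ[k] k, c ∘ₗ (socle N F).subtype =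
      (e F).coord t :=
    fun F t => LinearMap.exists_extend _
  choose c hc using hc
  have hc' : ∀ F t (y : socle N F), c F t y.1 = (e F).repr y t := fun F t y =>
    LinearMap.congr_fun (hc F t) y
  let B : ((F : Finset (Fin n)) × Fin (ν F)) → GrMod k n := fun p => quotPrime k p.1
  have hB : IsSquarefree (⨁ B) := isSquarefree_biproduct B fun p => isSquarefree_quotPrime p.1
  let φ : N ⟶ ⨁ B := biproduct.lift fun p => toQuotPrime hN (c p.1 p.2)
  have hφ : ∀ p a x, ev (biproduct.π B p) a (ev φ a x) = ev (toQuotPrime hN (c p.1 p.2)) a x :=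
    fun p a x => by rw [← ev_comp, biproduct.lift_π]
  have hinjφ : ∀ a, Function.Injective (ev φ a) := injective_of_socle hN hB φ fun F y hy h0 => by
    have h1 : (⟨y, hy⟩ : socle N F) = 0 := by
      refine (e F).repr.injective (Finsupp.ext fun t => ?_)
      rw [← hc', ← coe_ev_toQuotPrime_self hN, ← hφ ⟨F, t⟩, h0, map_zero, map_zero]
      rfl
    exact congrArg Subtype.val h1
  obtain ⟨ρ, hρ⟩ := hinj hN hB φ hinjφ (𝟙 N)
  have hρ' : ∀ a x, ev ρ a (ev φ a x) = x := fun a x => by rw [← ev_comp, hρ, ev_id]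
  have hinjρ : ∀ a, Function.Injective (ev ρ a) := injective_of_socle hB hN ρ fun F y hy h0 => by
    let w : socle N F := ∑ t, (ev (biproduct.π B ⟨F, t⟩) _ y).1 • e F t
    have hw : y = ev φ _ w.1 := by
      refine biproduct_ext fun p => ?_
      obtain ⟨G, t⟩ := p
      by_cases hFG : F = G
      · subst hFG
        refine Subtype.ext ?_
        rw [hφ, coe_ev_toQuotPrime_self hN, hc', Module.Basis.repr_sum_self]
      · rw [quotPrime_eq_zero_of_killedOutside hFG _ (hy.ev _),
          quotPrime_eq_zero_of_killedOutside hFG _ (KilledOutside.ev (KilledOutside.ev w.2 _) _)]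
    rw [hw, hρ'] at h0
    rw [hw, h0, map_zero]
  have : IsIso ρ := (isIso_iff_ev ρ).2 fun a => ⟨hinjρ a, fun x => ⟨_, hρ' a x⟩⟩
  exact ⟨ν, ⟨(asIso ρ).symm⟩⟩

end Structure

/-! ## Minimal injective resolutions -/

section Minimalization

open HomologicalComplex

variable {C : Type*} [Category* C] [Abelian C]

/-- A homotopy `h` with `h ∘ h = 0` and `h ∘ d ∘ h = h` splits off a contractible direct summand. -/
lemma exists_quasiIso_retract (J : CochainComplex C ℤ) (h : ∀ i j, J.X i ⟶ J.X j)
    (h₀ : ∀ i j, j + 1 ≠ i → h i j = 0) (h₁ : ∀ i j l, h i j ≫ h j l = 0)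
    (h₂ : ∀ i j, h i j ≫ J.d j i ≫ h i j = h i j) :
    ∃ (J' : CochainComplex C ℤ) (s : J' ⟶ J) (p : J ⟶ J'), s ≫ p = 𝟙 J' ∧ QuasiIso p ∧
      ∀ i j l, l + 1 = i → i + 1 = j →
        p.f i ≫ s.f i = 𝟙 _ - (J.d i j ≫ h j i + h i l ≫ J.d l i) := by
  -- The hypotheses on `h` make the null-homotopic map `d h + h d` idempotent. The image of the
  -- complementary idempotent is a retract of `J` and homotopy equivalent to it.
  let N : J ⟶ J := Homotopy.nullHomotopicMap h
  have hN : ∀ i j l, l + 1 = i → i + 1 = j → N.f i = J.d i j ≫ h j i + h i l ≫ J.d l i :=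
    fun i j l hl hj => Homotopy.nullHomotopicMap_f hl hj h
  have hNN : N ≫ N = N := by
    ext i
    rw [comp_f, hN i (i + 1) (i - 1) (by lia) rfl]
    have e1 := h₁ (i + 1) i (i - 1)
    have e2 := h₂ (i + 1) i
    have e3 := h₂ i (i - 1)
    simp only [Preadditive.add_comp, Preadditive.comp_add, Category.assoc, J.d_comp_d_assoc,
      zero_comp, comp_zero, reassoc_of% e1, e2, reassoc_of% e3, add_zero, zero_add]
  obtain ⟨J', s, p, h3, h4⟩ := IsIdempotentComplete.idempotents_split J (𝟙 J - N) (by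
    simp [Preadditive.sub_comp, Preadditive.comp_sub, hNN])
  refine ⟨J', s, p, h3, ?_, fun i j l hl hj => ?_⟩
  · have hom : Homotopy (p ≫ s) (𝟙 J) := by
      rw [h4]
      exact (Homotopy.equivSubZero.symm ((Homotopy.ofEq (sub_sub_cancel _ _)).trans
        (Homotopy.nullHomotopy h fun i j hij => h₀ i j hij))).symm
    exact (HomotopyEquiv.mk p s hom (Homotopy.ofEq h3)).quasiIso_hom
  · rw [← comp_f, h4, sub_f_apply, id_f, hN i j l hl hj]

/-- If `ι ≫ d ≫ r = 𝟙` then the complex `Q ⟶ Q` can be split off. -/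
lemma exists_quasiIso_split (J : CochainComplex C ℤ) {Q : C} (i₀ i₁ : ℤ) (hi : i₀ + 1 = i₁)
    (ι : Q ⟶ J.X i₀) (r : J.X i₁ ⟶ Q) (hr : ι ≫ J.d i₀ i₁ ≫ r = 𝟙 Q) :
    ∃ (J' : CochainComplex C ℤ) (s : J' ⟶ J) (p : J ⟶ J'), s ≫ p = 𝟙 J' ∧ QuasiIso p ∧
      p.f i₀ ≫ s.f i₀ = 𝟙 _ - J.d i₀ i₁ ≫ r ≫ ι := by
  classical
  -- The homotopy has a single nonzero component, `r ≫ ι` from degree `i₁` to `i₀`; the isomorphisms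
  -- only transport along equalities of indices.
  let h (i j : ℤ) : J.X i ⟶ J.X j := if H : i = i₁ ∧ i₀ = j then
    (J.XIsoOfEq H.1).hom ≫ r ≫ ι ≫ (J.XIsoOfEq H.2).hom else 0
  have hne : ∀ i j, ¬ (i = i₁ ∧ i₀ = j) → h i j = 0 := fun i j H => dif_neg H
  have heq : h i₁ i₀ = r ≫ ι := (dif_pos ⟨rfl, rfl⟩).trans (by simp)
  obtain ⟨J', s, p, h1, h2, h3⟩ := exists_quasiIso_retract J h (fun i j hij => hne i j (by lia))
    (fun i j l => by
      by_cases H : i = i₁ ∧ i₀ = j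
      · rw [hne j l (by lia), comp_zero]
      · rw [hne i j H, zero_comp])
    (fun i j => by
      by_cases H : i = i₁ ∧ i₀ = j
      · obtain ⟨rfl, rfl⟩ := H
        rw [heq, Category.assoc, reassoc_of% hr]
      · rw [hne i j H, zero_comp])
  refine ⟨J', s, p, h1, h2, ?_⟩
  rw [h3 i₀ i₁ (i₀ - 1) (by lia) hi, heq, hne i₀ (i₀ - 1) (by lia), zero_comp, add_zero]

end Minimalization

/-! ### Minimal injective resolutions by splitting off contractible summands -/

section Minimal

/-- This is `(S/P_F)(-F)`, with basis the monomials of support exactly `F`. It represents the socle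
elements of degree `F`, which makes it the test object for injectivity and for monomorphisms. -/
lemma isSquarefree_faceModule_compl (F : Finset (Fin n)) : IsSquarefree (faceModule k Fᶜ (ind F)) :=
  isSquarefree_monomialModule _ (fun _ ha => (ind_nonneg F).trans ha.1) fun a b h ha hs => by
    have key : ∀ c : Deg n, 0 ≤ c → (c ∈ coneSet Fᶜ (ind F) ↔ posSupp c = F) := fun c hc => by
      constructor
      · intro h
        ext i
        rw [mem_posSupp]
        by_cases hi : i ∈ F
        · have h1 : (ind F i : ℤ) ≤ c i := h.1 i
          rw [ind_apply, if_pos hi] at h1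
          simp only [hi, iff_true]
          lia
        · rw [h.2 i (Finset.mem_compl.2 hi), ind_apply, if_neg hi]
          simp [hi]
      · rintro rfl
        refine ⟨ind_posSupp_le hc, fun i hi => ?_⟩
        have h1 : (0 : ℤ) ≤ c i := hc i
        rw [Finset.mem_compl, mem_posSupp] at hi
        rw [ind_apply, if_neg (fun h => hi (mem_posSupp.1 h))]
        lia
    rw [key a ha, key b (ha.trans h), hs]

lemma ind_mem_faceSet_self (F : Finset (Fin n)) : ind F ∈ faceSet F := ind_mem_faceSet_iff.2
    subset_rfl

variable (k) in
/-- The element `x^F` of `S/P_F`. -/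
def topGen (F : Finset (Fin n)) : (quotPrime k F).obj (ind F) :=
  monomialGen (U := faceSet F) _ (ind_mem_faceSet_self F)

lemma topGen_ne_zero (F : Finset (Fin n)) : topGen k F ≠ 0 :=
  fun h => one_ne_zero (congrArg Subtype.val h)

/-- A socle element of degree `F` of an injective module is the image of `x^F` under a map from
`S/P_F`. -/
lemma SqInjective.exists_hom_quotPrime {N : GrMod k n} (hN : SqInjective N) {F : Finset (Fin n)}
    (y : N.obj (ind F)) (hy : KilledOutside F y) :
    ∃ f : quotPrime k F ⟶ N, ev f _ (topGen k F) = y := by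
  have hU := coneSet_ordConnected Fᶜ (ind F)
  have kill : ∀ {N : GrMod k n} (y : N.obj (ind F)), KilledOutside F y → ∀ (a : Deg n)
      (h : ind F ≤ a), a ∉ coneSet Fᶜ (ind F) → mulMap N h y = 0 := fun {N} y hy a h ha => by
    have : ∃ j ∉ F, (ind F j : ℤ) < a j := by
      by_contra! H
      exact ha ⟨h, fun j hj => le_antisymm (H j (Finset.mem_compl.1 hj)) (h j)⟩
    obtain ⟨j, hj, hlt⟩ := this
    exact hy.mulMap_eq_zero h hj hlt
  have hg : KilledOutside F (topGen k F) := fun j hj => quotPrime_eq_zero _ fun h => by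
    have := h.2 j hj
    rw [deg_add_apply, unitDeg_apply, if_pos rfl] at this
    have h0 : (0 : ℤ) ≤ ind F j := ind_nonneg F j
    lia
  -- `i` identifies `(S/P_F)(-F)` with the submodule of `S/P_F` generated by `x^F`, and `g` sends
  -- the generator to `y`; injectivity of `N` extends `g` along `i`.
  let i : faceModule k Fᶜ (ind F) ⟶ quotPrime k F :=
    monomialDesc hU (fun a ha => ha.1) _ (topGen k F) (kill _ hg)
  let g : faceModule k Fᶜ (ind F) ⟶ N := monomialDesc hU (fun a ha => ha.1) _ y (kill y hy)
  have hi : ∀ a, Function.Injective (ev i a) := fun a => by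
    refine (injective_iff_map_eq_zero _).2 fun x hx => ?_
    by_cases ha : a ∈ coneSet Fᶜ (ind F)
    · rw [eq_smul_monomialGen hU ha x, map_smul, ev_monomialDesc_gen, smul_eq_zero] at hx
      rcases hx with hx | hx
      · exact Subtype.ext hx
      · refine absurd ((injective_iff_map_eq_zero _).1 (mulMap_quotPrime_injective (k := k) (G := F)
          ha.1 fun j hj => (ha.2 j (Finset.mem_compl.2 hj)).symm) _ hx) (topGen_ne_zero F)
    · exact monomialModule_eq_zero hU ha x
  obtain ⟨f, hf⟩ := hN (isSquarefree_faceModule_compl F) (isSquarefree_quotPrime F) i hi g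
  refine ⟨f, ?_⟩
  have h1 : ev i _ (monomialGen hU (self_mem_coneSet Fᶜ (ind F))) = topGen k F :=
    ev_monomialDesc_gen_self ..
  rw [← h1, ← ev_comp, hf]
  exact ev_monomialDesc_gen_self ..

/-- An endomorphism is determined by the image of `x^0`, and multiplication from degree 0 to degree
`F` is injective, so its value on `x^F` determines it as well. -/
lemma quotPrime_end_eq_id {F : Finset (Fin n)} (g : quotPrime k F ⟶ quotPrime k F)
    (hg : ev g _ (topGen k F) = topGen k F) : g = 𝟙 _ := by
  have h0 : (0 : Deg n) ∈ faceSet F := ⟨le_rfl, fun _ _ => rfl⟩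
  refine monomial_hom_ext (U := faceSet F) (fun a ha => ha.1) h0 ?_
  refine mulMap_quotPrime_injective (k := k) (G := F) (ind_nonneg F) (fun i hi => ?_) ?_
  · rw [ind_apply, if_neg hi]
    rfl
  · have : mulMap (quotPrime k F) (ind_nonneg F) (monomialGen (U := faceSet F) _ h0) = topGen k F :=
      mulMap_monomialGen _ h0 (ind_mem_faceSet_self F) _
    exact (ev_mulMap g _ _).symm.trans ((congrArg (ev g _) this).trans (hg.trans this.symm))

/-- The sum of the dimensions of the squarefree components of a graded module. -/
def totalDim (X : GrMod k n) : ℕ := ∑ G, Module.finrank k (X.obj (ind G))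

lemma totalDim_le {X Y : GrMod k n} (hY : IsSquarefree Y) (f : X ⟶ Y)
    (hf : ∀ a, Function.Injective (ev f a)) : totalDim X ≤ totalDim Y :=
  have := fun G => hY.finite (ind G)
  Finset.sum_le_sum fun G _ => LinearMap.finrank_le_finrank_of_injective (hf (ind G))

lemma totalDim_lt {X Y : GrMod k n} (hY : IsSquarefree Y) (f : X ⟶ Y)
    (hf : ∀ a, Function.Injective (ev f a)) {F : Finset (Fin n)} {y : Y.obj (ind F)}
    (hy : ∀ x, ev f _ x ≠ y) : totalDim X < totalDim Y := by
  have := fun G => hY.finite (ind G)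
  refine Finset.sum_lt_sum (fun G _ => LinearMap.finrank_le_finrank_of_injective (hf (ind G)))
    ⟨F, Finset.mem_univ _, ?_⟩
  rw [← LinearMap.finrank_range_of_inj (hf (ind F))]
  refine Submodule.finrank_lt fun h => ?_
  have : y ∈ LinearMap.range (ev f (ind F)) := h ▸ Submodule.mem_top
  obtain ⟨x, hx⟩ := this
  exact hy x hx

/-- Induction on the total dimension. If `d y ≠ 0` for a socle element `y` of degree `F`, there are
`ι : S/P_F ⟶ J^i` with `x^F ↦ y` and, from a functional with value 1 on `d y`, a map `r : J^(i+1) ⟶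
S/P_F`. Their composite through `d` is the identity, so a contractible complex splits off. -/
lemma exists_minimal_injective_aux (N : ℕ) (t : ℕ) : ∀ (J : CochainComplex (GrMod k n) ℤ),
    (∀ i : ℤ, (N : ℤ) < |i| → IsZero (J.X i)) → (∀ i, IsSquarefree (J.X i)) →
    (∀ i, SqInjective (J.X i)) → ∑ i ∈ Finset.Icc (-N : ℤ) N, totalDim (J.X i) = t →
    ∃ (J' : CochainComplex (GrMod k n) ℤ) (π : J ⟶ J'), QuasiIso π ∧
      (∀ i : ℤ, (N : ℤ) < |i| → IsZero (J'.X i)) ∧ (∀ i, IsSquarefree (J'.X i)) ∧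
      (∀ i, SqInjective (J'.X i)) ∧ ∀ i, KillsSocle (J'.d i (i + 1)) := by
  induction t using Nat.strong_induction_on with
  | _ t ih =>
    intro J hb hsq hinj ht
    by_cases hk : ∀ i, KillsSocle (J.d i (i + 1))
    · exact ⟨J, 𝟙 J, inferInstance, hb, hsq, hinj, hk⟩
    · unfold KillsSocle at hk
      push Not at hk
      obtain ⟨i, F, y, hy, hdy⟩ := hk
      obtain ⟨ι, hι⟩ := (hinj i).exists_hom_quotPrime y hy
      obtain ⟨ℓ, hℓ⟩ : ∃ ℓ : (J.X (i + 1)).obj (ind F) →ₗ[k] k, ℓ (ev (J.d i (i + 1)) _ y) = 1 := by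
        obtain ⟨ℓ, hℓ⟩ := not_forall.1 fun h => hdy ((Module.forall_dual_apply_eq_zero_iff k _).1 h)
        exact ⟨(ℓ (ev (J.d i (i + 1)) _ y))⁻¹ • ℓ, inv_mul_cancel₀ hℓ⟩
      let r : J.X (i + 1) ⟶ quotPrime k F := toQuotPrime (hsq (i + 1)) ℓ
      have hr : ev r _ (ev (J.d i (i + 1)) _ y) = topGen k F :=
        Subtype.ext ((coe_ev_toQuotPrime_self _ _ _).trans hℓ)
      obtain ⟨J', s, p, hsp, hp, hps⟩ := exists_quasiIso_split J i (i + 1) rfl ι r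
        (quotPrime_end_eq_id _ (by rw [ev_comp, ev_comp, hι, hr]))
      have hsp' : ∀ j, s.f j ≫ p.f j = 𝟙 _ := fun j => by
        rw [← HomologicalComplex.comp_f, hsp, HomologicalComplex.id_f]
      have hs : ∀ j a, Function.Injective (ev (s.f j) a) := fun j a x x' hx => by
        have := congrArg (ev (p.f j) a) hx
        rwa [← ev_comp, ← ev_comp, hsp', ev_id, ev_id] at this
      have hsq' : ∀ j, IsSquarefree (J'.X j) := fun j => (hsq j).of_retract _ _ (hsp' j)
      have hy0 : y ≠ 0 := fun h => hdy (by rw [h, map_zero])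
      have hiN : i ∈ Finset.Icc (-N : ℤ) N := by
        rw [Finset.mem_Icc, ← abs_le]
        by_contra h
        exact hy0 ((isZero_iff_eq_zero _).1 (hb i (not_le.1 h)) _ y)
      have hlt : ∑ i ∈ Finset.Icc (-N : ℤ) N, totalDim (J'.X i) < t := by
        rw [← ht]
        refine Finset.sum_lt_sum (fun j _ => totalDim_le (hsq j) (s.f j) (hs j)) ⟨i, hiN,
          totalDim_lt (hsq i) (s.f i) (hs i) (F := F) (y := y) fun z hz => hy0 ?_⟩
        -- The projector onto the remaining complex kills `y ≠ 0`, so `y` is not in the image of `s`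
        -- and the dimension drops strictly.
        have h1 : ev (p.f i ≫ s.f i) _ y = 0 := by
          rw [hps, ev_sub, ev_id, ev_comp, ev_comp, hr, hι, sub_self]
        rw [← hz, ev_comp, ← ev_comp (s.f i) (p.f i), hsp', ev_id] at h1
        rw [← hz, h1]
      obtain ⟨J'', π, hπ, hJ''⟩ := ih _ hlt J'
        (fun j hj => isZero_of_surjective (p.f j) (fun a x => ⟨ev (s.f j) a x, by
          rw [← ev_comp, hsp', ev_id]⟩) (hb j hj)) hsq'
        (fun j => (hinj j).of_retract _ _ (hsp' j)) rfl
      exact ⟨J'', p ≫ π, inferInstance, hJ''⟩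

/-- Bounded complexes of squarefree modules have minimal injective resolutions, among graded
modules. -/
theorem exists_minimal_injective_resolution (M : CochainComplex (GrMod k n) ℤ) (hb : HasBound M)
    (hsq : ∀ i, IsSquarefree (M.X i)) :
    ∃ (J : CochainComplex (GrMod k n) ℤ) (φ : M ⟶ J), QuasiIso φ ∧ HasBound J ∧
      (∀ i, IsSquarefree (J.X i)) ∧ (∀ i, SqInjective (J.X i)) ∧
      ∀ i, KillsSocle (J.d i (i + 1)) := by
  obtain ⟨J, φ, hφ, ⟨N, hN⟩, h1, h2⟩ := exists_injective_resolution M hb hsq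
  obtain ⟨J', π, hπ, hN', hJ'⟩ := exists_minimal_injective_aux N _ J hN h1 h2 rfl
  exact ⟨J', φ ≫ π, inferInstance, ⟨N, hN'⟩, hJ'⟩

end Minimal

/-! ## Existence of the squarefree Bass numbers -/

section Existence

lemma isZero_incl_iff (X : Sq k n) : IsZero X ↔ IsZero X.obj :=
  ⟨fun h => (incl k n).map_isZero h, fun h => by
    rw [IsZero.iff_id_eq_zero]
    exact (incl k n).map_injective (h.eq_of_src _ _)⟩

/-- A complex of squarefree modules as an object of `Com(Sq)`. -/
def toSqComplex (J : CochainComplex (GrMod k n) ℤ) (hJ : ∀ i, IsSquarefree (J.X i)) :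
    CochainComplex (Sq k n) ℤ where
  X i := ⟨J.X i, hJ i⟩
  d i j := ObjectProperty.homMk (J.d i j)
  shape i j h := (incl k n).map_injective (J.shape i j h)
  d_comp_d' i j l _ _ := (incl k n).map_injective (J.d_comp_d i j l)

/-- A morphism of complexes of squarefree modules as a morphism of `Com(Sq)`. -/
def toSqComplexHom {M N : CochainComplex (Sq k n) ℤ}
    (φ : (inclComplex k n).obj M ⟶ (inclComplex k n).obj N) : M ⟶ N where
  f i := ObjectProperty.homMk (φ.f i)
  comm' i j _ := (incl k n).map_injective (φ.comm i j)

lemma HasBound.inclComplex {M : CochainComplex (Sq k n) ℤ} (hM : IsBounded M) :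
    HasBound ((inclComplex k n).obj M) := by
  obtain ⟨N, hN⟩ := hM
  exact ⟨N, fun i hi => (incl k n).map_isZero (hN i hi)⟩

/-- Testing against `(S/P_F)(-F)`, which lies in `Sq`, shows injectivity on socles, and this
suffices. -/
lemma injective_ev_of_mono {X Y : Sq k n} (f : X ⟶ Y) [Mono f] (a : Deg n) :
    Function.Injective (ev f.hom a) := by
  refine injective_of_socle X.property Y.property f.hom (fun F y hy h0 => ?_) a
  let Z : Sq k n := ⟨faceModule k Fᶜ (ind F), isSquarefree_faceModule_compl F⟩
  let g : faceModule k Fᶜ (ind F) ⟶ X.obj := monomialDesc (coneSet_ordConnected Fᶜ (ind F))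
    (fun a ha => ha.1) _ y fun a h ha => by
      obtain ⟨j, hj, hlt⟩ : ∃ j ∉ F, (ind F j : ℤ) < a j := by
        by_contra! H
        exact ha ⟨h, fun j hj => le_antisymm (H j (Finset.mem_compl.1 hj)) (h j)⟩
      exact hy.mulMap_eq_zero h hj hlt
  have hgy : ev g _ (monomialGen _ (self_mem_coneSet Fᶜ (ind F))) = y :=
    ev_monomialDesc_gen_self ..
  have hg : g ≫ f.hom = 0 := by
    refine monomial_hom_ext (fun a ha => ha.1) (self_mem_coneSet Fᶜ (ind F)) ?_
    rw [ev_comp, hgy, h0, ev_zero]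
  have h1 : (ObjectProperty.homMk g : Z ⟶ X) = 0 := by
    rw [← cancel_mono f, zero_comp]
    exact (incl k n).map_injective hg
  rw [← hgy]
  exact congrArg (fun φ : Z ⟶ X => ev φ.hom _ _) h1

/-- The degreewise cokernel is again squarefree, so an epimorphism in `Sq` has zero cokernel among
graded modules. -/
lemma surjective_ev_of_epi {X Y : Sq k n} (f : X ⟶ Y) [Epi f] (a : Deg n) :
    Function.Surjective (ev f.hom a) := by
  let L := GrSubmodule.range f.hom
  let Z : Sq k n := ⟨L.quot, X.property.of_exact Y.property f.hom L.π
    (fun a => Submodule.mkQ_surjective _) fun a y => Submodule.Quotient.mk_eq_zero _⟩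
  have h1 : (ObjectProperty.homMk L.π : Y ⟶ Z) = 0 := by
    rw [← cancel_epi f, comp_zero]
    refine (incl k n).map_injective (hom_ext_ev fun a x => ?_)
    exact (Submodule.Quotient.mk_eq_zero _).2 ⟨x, rfl⟩
  intro y
  exact (Submodule.Quotient.mk_eq_zero _).1 (congrArg (fun φ : Y ⟶ Z => ev φ.hom a y) h1)

lemma SqInjective.injective {X : Sq k n} (hX : SqInjective X.obj) : Injective X where
  factors {A B} g f _ := by
    obtain ⟨h, hh⟩ := hX A.property B.property f.hom (injective_ev_of_mono f) g.hom
    exact ⟨ObjectProperty.homMk h, (incl k n).map_injective hh⟩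

lemma projective_of_projective_obj {X : Sq k n} [Projective X.obj] : Projective X where
  factors {A B} f e _ := by
    have : Epi e.hom := (epi_iff_ev e.hom).2 (surjective_ev_of_epi e)
    exact ⟨ObjectProperty.homMk (Projective.factorThru f.hom e.hom),
      (incl k n).map_injective (Projective.factorThru_comp _ _)⟩

/-- Minimal injective resolutions exist, and their terms are direct sums of modules `S/P_F`. -/
theorem exists_isSquarefreeBassNumbers (M : CochainComplex (Sq k n) ℤ) (hM : IsBounded M) :
    ∃ μ : ℤ → Finset (Fin n) → ℕ, IsSquarefreeBassNumbers M μ := by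
  obtain ⟨J, φ, hφ, ⟨N, hN⟩, hsq, hinj, hsoc⟩ := exists_minimal_injective_resolution
    ((inclComplex k n).obj M) (HasBound.inclComplex hM) fun i => (M.X i).property
  choose ν hν using fun i => exists_iso_biproduct (hsq i) (hinj i)
  exact ⟨ν, toSqComplex J hsq, toSqComplexHom (N := toSqComplex J hsq) φ,
    ⟨⟨N, fun i hi => (isZero_incl_iff _).2 (hN i hi)⟩, fun i => SqInjective.injective (hinj i),
      hφ, fun i L hL => essential_of_killsSocle (hsq i) (hsoc i) L hL⟩, hν⟩

end Existence

/-! ## Alexander duality -/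

section Alexander

lemma ind_posSupp_compl_le {a : Deg n} {j : Fin n} : ind (posSupp (a - unitDeg j))ᶜ ≤
    ind (posSupp a)ᶜ + unitDeg j := fun i => by
  change (ind (posSupp (a - unitDeg j))ᶜ i : ℤ) ≤ (ind (posSupp a)ᶜ i : ℤ) + (unitDeg j i : ℤ)
  have h1 : ((a - unitDeg j) i : ℤ) = (a i : ℤ) - (unitDeg j i : ℤ) := rfl
  simp only [ind_apply, unitDeg_apply, Finset.mem_compl, mem_posSupp, h1]
  split_ifs <;> lia

/-- An element of `𝐀(M)` in a nonnegative degree, given by a functional. -/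
def alexanderMk {M : GrMod k n} {a : Deg n} (ha : 0 ≤ a)
    (φ : Module.Dual k (M.obj (ind (posSupp a)ᶜ))) : (alexanderObj M).obj a :=
  ⟨φ, fun h => absurd ha h⟩

lemma alexander_ext {M : GrMod k n} {a : Deg n} {φ ψ : (alexanderObj M).obj a}
    (h : ∀ y, φ.1 y = ψ.1 y) : φ = ψ := Subtype.ext (LinearMap.ext h)

lemma alexander_eq_zero {M : GrMod k n} {a : Deg n} (ha : ¬ 0 ≤ a) (φ : (alexanderObj M).obj a) :
    φ = 0 := Subtype.ext (φ.2 ha)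

lemma ev_alexanderMap {M N : GrMod k n} (f : M ⟶ N) {a : Deg n} (φ : (alexanderObj N).obj a)
    (y : M.obj (ind (posSupp a)ᶜ)) : (ev (alexanderMap f) a φ).1 y = φ.1 (ev f _ y) := rfl

lemma alexanderMap_id (M : GrMod k n) : alexanderMap (𝟙 M) = 𝟙 _ := rfl

lemma alexanderMap_comp {L M N : GrMod k n} (f : L ⟶ M) (g : M ⟶ N) :
    alexanderMap (f ≫ g) = alexanderMap g ≫ alexanderMap f := rfl

/-- The elements of `𝐀(M)` as functionals. -/
def alexanderEval {M : GrMod k n} {a : Deg n} (y : M.obj (ind (posSupp a)ᶜ)) :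
    (alexanderObj M).obj a →ₗ[k] k :=
  (LinearMap.applyₗ y).comp (Submodule.subtype (only (0 ≤ a) (Module.Dual k _)))

lemma alexander_sum_apply {M : GrMod k n} {a : Deg n} {J : Type*} (s : Finset J)
    (φ : J → (alexanderObj M).obj a) (y : M.obj (ind (posSupp a)ᶜ)) :
    (∑ j ∈ s, φ j).1 y = ∑ j ∈ s, (φ j).1 y := map_sum (alexanderEval y) φ s

lemma alexanderMap_sum {J : Type*} [Fintype J] {M N : GrMod k n} (f : J → (M ⟶ N)) :
    alexanderMap (∑ j, f j) = ∑ j, alexanderMap (f j) :=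
  hom_ext_ev fun a φ => by
    rw [ev_sum]
    refine alexander_ext fun y => ?_
    rw [ev_alexanderMap, ev_sum, map_sum, alexander_sum_apply]
    rfl

lemma isZero_alexanderObj {M : GrMod k n} (h : IsZero M) : IsZero (alexanderObj M) := by
  rw [IsZero.iff_id_eq_zero] at h ⊢
  rw [← alexanderMap_id, h, alexanderMap_zero]

/-- A finite direct sum decomposition. -/
def isoBiproduct {J : Type} [Fintype J] [DecidableEq J] {N : GrMod k n} (A : J → GrMod k n)
    (s : ∀ j, A j ⟶ N) (p : ∀ j, N ⟶ A j) (h₁ : ∀ j, s j ≫ p j = 𝟙 _)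
    (h₂ : ∀ j l, j ≠ l → s j ≫ p l = 0) (h : ∑ j, p j ≫ s j = 𝟙 N) : N ≅ ⨁ A where
  hom := biproduct.lift p
  inv := biproduct.desc s
  hom_inv_id := by rw [biproduct.lift_desc, h]
  inv_hom_id := by
    refine biproduct.hom_ext' _ _ fun j => biproduct.hom_ext _ _ fun l => ?_
    by_cases hjl : j = l
    · subst hjl
      simp [h₁]
    · simp [h₂ j l hjl, biproduct.ι_π_ne _ hjl]

lemma nonempty_alexander_biproduct_iso {J : Type} [Fintype J] (A : J → GrMod k n) :
    Nonempty (alexanderObj (⨁ A) ≅ ⨁ fun j => alexanderObj (A j)) := by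
  classical
  refine ⟨isoBiproduct _ (fun j => alexanderMap (biproduct.π A j))
    (fun j => alexanderMap (biproduct.ι A j)) (fun j => ?_) (fun j l hjl => ?_) ?_⟩
  · rw [← alexanderMap_comp, biproduct.ι_π_self, alexanderMap_id]
  · rw [← alexanderMap_comp, biproduct.ι_π_ne _ hjl.symm, alexanderMap_zero]
  · simp only [← alexanderMap_comp]
    rw [← alexanderMap_sum, biproduct.total, alexanderMap_id]

/-- Alexander duality on isomorphisms. -/
def alexanderIso {M N : GrMod k n} (e : M ≅ N) : alexanderObj N ≅ alexanderObj M where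
  hom := alexanderMap e.hom
  inv := alexanderMap e.inv
  hom_inv_id := by rw [← alexanderMap_comp, e.inv_hom_id, alexanderMap_id]
  inv_hom_id := by rw [← alexanderMap_comp, e.hom_inv_id, alexanderMap_id]

lemma nonempty_alexander_monomialModule_iso {U V : Set (Deg n)} (hU : U.OrdConnected)
    (hV : V.OrdConnected) (h : ∀ a, a ∈ V ↔ 0 ≤ a ∧ ind (posSupp a)ᶜ ∈ U) :
    Nonempty (alexanderObj (monomialModule k U hU) ≅ monomialModule k V hV) := by
  classical
  -- The basis element where there is one, zero elsewhere; evaluating functionals at it identifies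
  -- the dual components with subspaces of `k`.
  let e (c : Deg n) : (monomialModule k U hU).obj c :=
    if hc : c ∈ U then monomialGen hU hc else 0
  have e_pos : ∀ c (hc : c ∈ U), e c = monomialGen hU hc := fun c hc => dif_pos hc
  have e_neg : ∀ c, c ∉ U → e c = 0 := fun c hc => dif_neg hc
  have eq_smul : ∀ c (y : (monomialModule k U hU).obj c), y = (y.1 : k) • e c := fun c y => by
    by_cases hc : c ∈ U
    · rw [e_pos c hc]
      exact eq_smul_monomialGen hU hc y
    · rw [monomialModule_eq_zero hU hc y, monomialModule_eq_zero hU hc (e c), smul_zero]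
  let f : alexanderObj (monomialModule k U hU) ⟶ monomialModule k V hV := homOfLinear
    (fun a => LinearMap.codRestrict (only (a ∈ V) k)
      ((LinearMap.applyₗ (e (ind (posSupp a)ᶜ))).comp
        (Submodule.subtype (only (0 ≤ a) (Module.Dual k _)))) fun φ ha => by
        by_cases h0 : 0 ≤ a
        · have : ind (posSupp a)ᶜ ∉ U := fun h' => ha ((h a).2 ⟨h0, h'⟩)
          change φ.1 (e _) = 0
          rw [e_neg _ this, map_zero]
        · rw [alexander_eq_zero h0 φ, map_zero])
    (by
      intro a b hab φ
      refine Subtype.ext (Eq.trans ?_ (mulMap_coe_monomialModule hV hab _).symm)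
      change φ.1 (mulMap _ (compl_posSupp_le hab) (e _)) = if b ∈ V then φ.1 (e _) else 0
      by_cases hb : b ∈ V
      · rw [if_pos hb, e_pos _ ((h b).1 hb).2]
        by_cases hc : ind (posSupp a)ᶜ ∈ U
        · rw [e_pos _ hc, mulMap_monomialGen hU ((h b).1 hb).2 hc]
        · rw [monomialModule_eq_zero hU hc (mulMap _ _ _), monomialModule_eq_zero hU hc (e _)]
      · rw [if_neg hb]
        by_cases h0 : 0 ≤ a
        · rw [e_neg _ fun h' => hb ((h b).2 ⟨h0.trans hab, h'⟩), map_zero, map_zero]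
        · rw [alexander_eq_zero h0 φ]
          rfl)
  have hf : ∀ a (φ : (alexanderObj (monomialModule k U hU)).obj a),
      (ev f a φ).1 = φ.1 (e (ind (posSupp a)ᶜ)) := fun a φ => rfl
  have : IsIso f := (isIso_iff_ev f).2 fun a => by
    constructor
    · refine (injective_iff_map_eq_zero _).2 fun φ hφ => alexander_ext fun y => ?_
      have h0 : φ.1 (e (ind (posSupp a)ᶜ)) = 0 := (hf a φ).symm.trans (congrArg Subtype.val hφ)
      rw [eq_smul _ y, map_smul, h0, smul_zero]
      rfl
    · intro y
      by_cases ha : a ∈ V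
      · obtain ⟨h0, hc⟩ := (h a).1 ha
        refine ⟨alexanderMk h0 ((y.1 : k) • monomialCoeff k hU _), Subtype.ext ?_⟩
        rw [hf, e_pos _ hc]
        exact mul_one (y.1 : k)
      · exact ⟨0, by rw [map_zero, monomialModule_eq_zero hV ha y]⟩
  exact ⟨asIso f⟩

lemma nonempty_freeModule_iso (F : Finset (Fin n)) :
    Nonempty (freeModule k F ≅ faceModule k ∅ (ind F)) :=
  nonempty_shift_monomialModule_iso _ _ _ (Set.ext fun b => by
    constructor
    · rintro ⟨h, -⟩
      change 0 ≤ -ind F + b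
      rw [neg_add_eq_sub]
      exact sub_nonneg.2 h
    · intro h
      have h : 0 ≤ -ind F + b := h
      rw [neg_add_eq_sub] at h
      exact ⟨sub_nonneg.1 h, fun j hj => absurd hj (Finset.notMem_empty j)⟩)

lemma mem_coneSet_empty_iff (F : Finset (Fin n)) (a : Deg n) :
    a ∈ coneSet ∅ (ind F) ↔ 0 ≤ a ∧ F ⊆ posSupp a := by
  constructor
  · rintro ⟨h, -⟩
    refine ⟨(ind_nonneg F).trans h, ?_⟩
    have := posSupp_mono h
    rwa [posSupp_ind] at this
  · rintro ⟨h0, h⟩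
    exact ⟨(ind_mono h).trans (ind_posSupp_le h0), fun j hj => absurd hj (Finset.notMem_empty j)⟩

/-- `S(-F)` has basis the monomials whose support contains `F`, and the complement of `supp₊ a`
contains `F` exactly when `supp₊ a ⊆ Fᶜ`. -/
lemma nonempty_alexander_freeModule_iso (F : Finset (Fin n)) :
    Nonempty (alexanderObj (freeModule k F) ≅ quotPrime k Fᶜ) := by
  obtain ⟨e⟩ := nonempty_freeModule_iso (k := k) F
  obtain ⟨e'⟩ := nonempty_alexander_monomialModule_iso (k := k) (U := coneSet ∅ (ind F))
    (V := faceSet Fᶜ) (coneSet_ordConnected ∅ (ind F)) ⟨fun _ ha _ hb _ hc =>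
      mem_faceSet_of_le (ha.1.trans hc.1) hc.2 hb⟩ (fun a => by
      rw [mem_coneSet_empty_iff, posSupp_ind]
      constructor
      · intro h
        exact ⟨h.1, ind_nonneg _, Finset.subset_compl_comm.1 ((mem_faceSet_iff_posSupp h.1).1 h)⟩
      · rintro ⟨h0, -, h⟩
        exact (mem_faceSet_iff_posSupp h0).2 (Finset.subset_compl_comm.1 h))
  exact ⟨(alexanderIso e).symm ≪≫ e'⟩

lemma nonempty_alexander_quotPrime_iso (F : Finset (Fin n)) :
    Nonempty (alexanderObj (quotPrime k F) ≅ freeModule k Fᶜ) := by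
  obtain ⟨e⟩ := nonempty_freeModule_iso (k := k) Fᶜ
  obtain ⟨e'⟩ := nonempty_alexander_monomialModule_iso (k := k) (U := faceSet F)
    (V := coneSet ∅ (ind Fᶜ)) ⟨fun _ ha _ hb _ hc => mem_faceSet_of_le (ha.1.trans hc.1) hc.2 hb⟩
    (coneSet_ordConnected ∅ (ind Fᶜ)) (fun a => by
      rw [mem_coneSet_empty_iff, ind_mem_faceSet_iff]
      exact and_congr_right fun _ => compl_le_iff_compl_le)
  exact ⟨e' ≪≫ e.symm⟩

end Alexander

/-! ### Biduality -/

section DoubleDual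

variable {X Y : GrMod k n} (hX : IsSquarefree X) (hY : IsSquarefree Y)

include hX in
lemma mulMap_toTop_of_le {G G' : Finset (Fin n)} {a b : Deg n} (ha : a ∈ faceSet G)
    (hb : b ∈ faceSet G') (hab : a ≤ b) (hG : ind G ≤ ind G') (x : X.obj a) :
    mulMap X hG (toTop hX ha x) = toTop hX hb (mulMap X hab x) := by
  refine ((toTop_eq_iff hX hb _ _).2 ?_).symm
  have h1 : a + ind G ≤ b + ind G' := add_le_add hab hG
  rw [mulMap_mulMap, ← mulMap_mulMap X (ind_le_add ha.1) h1, mulMap_toTop, mulMap_mulMap,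
    mulMap_mulMap]

/-- The support of `a`, as it appears in the double Alexander dual. -/
def biSupp (a : Deg n) : Finset (Fin n) := (posSupp (ind (posSupp a)ᶜ))ᶜ

lemma biSupp_eq (a : Deg n) : biSupp a = posSupp a := by
  rw [biSupp, posSupp_ind, compl_compl]

lemma mem_faceSet_biSupp {a : Deg n} (ha : 0 ≤ a) : a ∈ faceSet (biSupp a) :=
  (mem_faceSet_iff_posSupp ha).2 (biSupp_eq a).ge

lemma toTop_bijective {a : Deg n} (h0 : 0 ≤ a) {G : Finset (Fin n)} (hG : G = posSupp a)
    (ha : a ∈ faceSet G) : Function.Bijective (toTop hX ha) := by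
  refine (LinearEquiv.ofBijective _ (hX.bijective _ _ (ind_le_add ha.1) (ind_nonneg G)
    (posSupp_add_ind ha))).symm.bijective.comp (hX.bijective _ _ (le_add_ind a _) h0 ?_)
  rw [posSupp_add_ind ha, posSupp_ind, hG]

/-- The map to the double Alexander dual in a nonnegative degree. -/
def bidualityAux {a : Deg n} (ha : 0 ≤ a) : X.obj a →ₗ[k] (alexanderObj
    (alexanderObj X)).obj a where
  toFun x := alexanderMk ha
    { toFun := fun φ => φ.1 (toTop hX (mem_faceSet_biSupp ha) x)
      map_add' := fun _ _ => rfl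
      map_smul' := fun _ _ => rfl }
  map_add' x y := alexander_ext fun φ =>
    (congrArg φ.1 (map_add (toTop hX (mem_faceSet_biSupp ha)) x y)).trans (map_add φ.1 _ _)
  map_smul' c x := alexander_ext fun φ =>
    (congrArg φ.1 (map_smul (toTop hX (mem_faceSet_biSupp ha)) c x)).trans (map_smul φ.1 _ _)

open Classical in
/-- The map to the double Alexander dual. -/
def biduality : X ⟶ alexanderObj (alexanderObj X) :=
  homOfLinear (fun a => if h : 0 ≤ a then bidualityAux hX h else 0)
    (by
      intro a b hab x
      by_cases ha : 0 ≤ a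
      · have hb := ha.trans hab
        rw [dif_pos ha, dif_pos hb]
        refine alexander_ext fun φ => ?_
        change φ.1 (toTop hX (mem_faceSet_biSupp hb) (mulMap X hab x)) =
          φ.1 (mulMap X _ (toTop hX (mem_faceSet_biSupp ha) x))
        exact congrArg φ.1 (mulMap_toTop_of_le hX (mem_faceSet_biSupp ha) (mem_faceSet_biSupp hb)
          hab _ x).symm
      · rw [hX.eq_zero_of_not_nonneg ha x, map_zero, map_zero, map_zero, map_zero])

lemma ev_biduality {a : Deg n} (ha : 0 ≤ a) (x : X.obj a)
    (φ : (alexanderObj X).obj (ind (posSupp a)ᶜ)) :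
    (ev (biduality hX) a x).1 φ = φ.1 (toTop hX (mem_faceSet_biSupp ha) x) := by
  classical
  change ((if h : 0 ≤ a then bidualityAux hX h else 0) x).1 φ = _
  rw [dif_pos ha]
  rfl

lemma biduality_naturality (f : X ⟶ Y) :
    f ≫ biduality hY = biduality hX ≫ alexanderMap (alexanderMap f) :=
  hom_ext_ev fun a x => by
    by_cases ha : 0 ≤ a
    · refine alexander_ext fun φ => ?_
      rw [ev_comp, ev_comp, ev_biduality hY ha, ev_alexanderMap, ev_biduality hX ha,
        ← ev_toTop hX hY]
      rfl
    · rw [hX.eq_zero_of_not_nonneg ha x, map_zero, map_zero]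

/-- In a nonnegative degree this is the map of a finite-dimensional space to its double dual,
composed with the isomorphism from degree `a` to its support. -/
lemma isIso_biduality : IsIso (biduality hX) := (isIso_iff_ev _).2 fun a => by
  by_cases ha : 0 ≤ a
  · have hb := toTop_bijective hX ha (biSupp_eq a) (mem_faceSet_biSupp ha)
    constructor
    · refine (injective_iff_map_eq_zero _).2 fun x hx => ?_
      refine (injective_iff_map_eq_zero _).1 hb.1 x ?_
      refine (Module.forall_dual_apply_eq_zero_iff k _).1 fun ψ => ?_
      refine (ev_biduality hX ha x (alexanderMk (ind_nonneg _) ψ)).symm.trans ?_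
      rw [hx]
      rfl
    · intro Ψ
      have := hX.finite (ind (biSupp a))
      -- The component of `𝐀(X)` in a squarefree degree is the whole dual space, so `Ψ` is a genuine
      -- element of the double dual.
      let Ψ' : Module.Dual k (Module.Dual k (X.obj (ind (biSupp a)))) :=
        Ψ.1.comp (LinearMap.codRestrict (only (0 ≤ ind (posSupp a)ᶜ) _) LinearMap.id
          fun _ h => absurd (ind_nonneg _) h)
      obtain ⟨y, hy⟩ := (Module.evalEquiv k (X.obj (ind (biSupp a)))).surjective Ψ'
      obtain ⟨x, rfl⟩ := hb.2 y
      refine ⟨x, alexander_ext fun φ => ?_⟩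
      rw [ev_biduality hX ha]
      exact LinearMap.congr_fun hy φ.1
  · refine ⟨fun x y _ => ?_, fun y => ⟨0, ?_⟩⟩
    · rw [hX.eq_zero_of_not_nonneg ha x, hX.eq_zero_of_not_nonneg ha y]
    · rw [map_zero, alexander_eq_zero ha y]

end DoubleDual

/-! ## Alexander duality on complexes -/

section AlexanderComplex

/-- A functional that vanishes on the kernel of a linear map factors through it. -/
lemma exists_dual_comp_eq {V W : Type*} [AddCommGroup V] [Module k V] [AddCommGroup W] [Module k W]
    (B : V →ₗ[k] W) (ψ : Module.Dual k V) (h : ∀ v, B v = 0 → ψ v = 0) :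
    ∃ χ : Module.Dual k W, ∀ v, χ (B v) = ψ v := by
  have h1 : ψ ∈ LinearMap.range B.dualMap := by
    rw [LinearMap.range_dualMap_eq_dualAnnihilator_ker, Submodule.mem_dualAnnihilator]
    exact fun v hv => h v hv
  obtain ⟨χ, rfl⟩ := h1
  exact ⟨χ, fun v => rfl⟩

lemma exists_dual_sum_eq {J V : Type*} [Fintype J] {W : J → Type*} [AddCommGroup V] [Module k V]
    [∀ j, AddCommGroup (W j)] [∀ j, Module k (W j)] (g : ∀ j, V →ₗ[k] W j) (ψ : Module.Dual k V)
    (h : ∀ v, (∀ j, g j v = 0) → ψ v = 0) :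
    ∃ χ : ∀ j, Module.Dual k (W j), ∀ v, ψ v = ∑ j, χ j (g j v) := by
  classical
  obtain ⟨χ, hχ⟩ := exists_dual_comp_eq (LinearMap.pi g) ψ fun v hv => h v (congrFun hv)
  refine ⟨fun j => χ.comp (LinearMap.single k W j), fun v => ?_⟩
  rw [← hχ, ← Finset.univ_sum_single (LinearMap.pi g v), map_sum]
  rfl

/-- The hypothesis says that the functional `(z, -w)` vanishes on the kernel of `(x, y) ↦ (f y - d
x, d' y)`, hence factors through this map. The two components of the factorization, with sign
changed, are `χ₁` and `χ₂`. This is the dual of exactness for mapping cones. -/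
lemma exists_dual_of_cone {A B C D : Type*} [AddCommGroup A] [Module k A] [AddCommGroup B]
    [Module k B] [AddCommGroup C] [Module k C] [AddCommGroup D] [Module k D] (d : A →ₗ[k] C)
    (f : B →ₗ[k] C) (d' : B →ₗ[k] D) (z : Module.Dual k A) (w : Module.Dual k B)
    (h : ∀ x y, f y = d x → d' y = 0 → z x = w y) :
    ∃ (χ₁ : Module.Dual k C) (χ₂ : Module.Dual k D), (∀ x, z x = χ₁ (d x)) ∧
      ∀ y, w y = χ₁ (f y) + χ₂ (d' y) := by
  obtain ⟨χ, hχ⟩ := exists_dual_comp_eq (LinearMap.prod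
    (f.comp (LinearMap.snd k _ _) - d.comp (LinearMap.fst k _ _)) (d'.comp (LinearMap.snd k _ _)))
    (z.comp (LinearMap.fst k _ _) - w.comp (LinearMap.snd k _ _)) (by
      rintro ⟨x, y⟩ hxy
      exact sub_eq_zero.2 (h x y (sub_eq_zero.1 (congrArg Prod.fst hxy)) (congrArg Prod.snd hxy)))
  refine ⟨-χ.comp (LinearMap.inl k _ _), -χ.comp (LinearMap.inr k _ _), fun x => ?_, fun y => ?_⟩
  · have h1 : χ (f 0 - d x, d' 0) = z x - w 0 := hχ (x, 0)
    rw [map_zero, map_zero, map_zero, sub_zero, zero_sub] at h1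
    rw [← h1]
    simp [← map_neg]
  · have h1 : χ (f y - d 0, d' y) = z 0 - w y := hχ (0, y)
    rw [map_zero, map_zero, zero_sub, sub_zero] at h1
    have h2 : (f y, d' y) = LinearMap.inl k C D (f y) + LinearMap.inr k C D (d' y) := by simp
    rw [h2, map_add] at h1
    change w y = -χ (LinearMap.inl k C D (f y)) + -χ (LinearMap.inr k C D (d' y))
    rw [← neg_add, h1, neg_neg]

/-- Alexander duality on morphisms of complexes. -/
def alexanderComplexMap {M N : CochainComplex (Sq k n) ℤ} (f : M ⟶ N) :
    alexanderComplex N ⟶ alexanderComplex M where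
  f j := (alexander k n).map (f.f (-j)).op
  comm' i j _ := by
    change (alexander k n).map _ ≫ (alexander k n).map _ =
      (alexander k n).map _ ≫ (alexander k n).map _
    rw [← Functor.map_comp, ← Functor.map_comp, ← op_comp, ← op_comp, f.comm]

/-- Alexander duality is exact. -/
lemma quasiIso_alexanderComplexMap {M N : CochainComplex (Sq k n) ℤ} (f : M ⟶ N)
    (hf : QuasiIso ((inclComplex k n).map f)) :
    QuasiIso ((inclComplex k n).map (alexanderComplexMap f)) := by
  rw [quasiIso_iff_exists] at hf ⊢
  intro h i j l hhi hij hjl a z w hz hzw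
  let c : Deg n := ind (posSupp a)ᶜ
  let dK := ev (((inclComplex k n).obj M).d (-j) (-i)) c
  let dK' := ev (((inclComplex k n).obj M).d (-i) (-h)) c
  let dL := ev (((inclComplex k n).obj N).d (-l) (-j)) c
  let dL' := ev (((inclComplex k n).obj N).d (-j) (-i)) c
  let fi := ev (((inclComplex k n).map f).f (-i)) c
  let fj := ev (((inclComplex k n).map f).f (-j)) c
  let zφ : Module.Dual k ((N.X (-j)).obj.obj c) := z.1
  let wφ : Module.Dual k ((M.X (-i)).obj.obj c) := w.1
  have hz' : ∀ y, zφ (dL y) = 0 := fun y =>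
    LinearMap.congr_fun (congrArg Subtype.val hz) y
  have hzw' : ∀ y, zφ (fj y) = wφ (dK y) := fun y =>
    LinearMap.congr_fun (congrArg Subtype.val hzw) y
  by_cases ha : 0 ≤ a
  -- A cocycle of the dual cone vanishes on the coboundaries of the cone of `f` in degree `c`, which
  -- by acyclicity are all the cocycles.
  · obtain ⟨χ₁, χ₂, h₁, h₂⟩ := exists_dual_of_cone dL' fi dK' zφ wφ fun x y hxy hy => by
      obtain ⟨y', x', rfl, rfl⟩ := hf (-l) (-j) (-i) (-h) (by lia) (by lia) (by lia) c y x hy hxy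
      exact (map_add zφ _ _).trans (
        (congrArg (zφ (fj y') + ·) (hz' x')).trans ((add_zero _).trans (hzw' y')))
    exact ⟨alexanderMk ha χ₁, alexanderMk ha χ₂, alexander_ext h₁, alexander_ext h₂⟩
  · refine ⟨0, 0, ?_, ?_⟩
    · rw [map_zero]
      exact alexander_eq_zero ha z
    · rw [map_zero, map_zero, add_zero]
      exact alexander_eq_zero ha w

lemma IsBounded.alexanderComplex {M : CochainComplex (Sq k n) ℤ} (hM : IsBounded M) :
    IsBounded (alexanderComplex M) := by
  obtain ⟨N, hN⟩ := hM
  exact ⟨N, fun i hi => (isZero_incl_iff _).2 (isZero_alexanderObj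
    ((isZero_incl_iff _).1 (hN (-i) (by rwa [abs_neg]))))⟩

/-- The double Alexander dual of a complex. -/
def bidualityComplex (M : CochainComplex (Sq k n) ℤ) :
    M ⟶ alexanderComplex (alexanderComplex M) where
  f j := (M.XIsoOfEq (neg_neg j)).inv ≫
    (ObjectProperty.homMk (biduality (M.X (-(-j))).property) :
      M.X (-(-j)) ⟶ (alexanderComplex (alexanderComplex M)).X j)
  comm' i j _ := by
    have h1 : (ObjectProperty.homMk (biduality (M.X (-(-i))).property) :
        M.X (-(-i)) ⟶ (alexanderComplex (alexanderComplex M)).X i) ≫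
          (alexanderComplex (alexanderComplex M)).d i j =
        M.d (-(-i)) (-(-j)) ≫ (ObjectProperty.homMk (biduality (M.X (-(-j))).property) :
          M.X (-(-j)) ⟶ (alexanderComplex (alexanderComplex M)).X j) :=
      (incl k n).map_injective (biduality_naturality _ _ _).symm
    rw [Category.assoc, h1, HomologicalComplex.XIsoOfEq_inv_comp_d_assoc,
      HomologicalComplex.d_comp_XIsoOfEq_inv_assoc]

instance (M : CochainComplex (Sq k n) ℤ) : IsIso (bidualityComplex M) := by
  have : ∀ j, IsIso ((bidualityComplex M).f j) := fun j => by
    have h1 : IsIso ((incl k n).map (ObjectProperty.homMk (biduality (M.X (-(-j))).property) :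
        M.X (-(-j)) ⟶ (alexanderComplex (alexanderComplex M)).X j)) :=
      isIso_biduality (M.X (-(-j))).property
    have h2 := isIso_of_reflects_iso (ObjectProperty.homMk (biduality (M.X (-(-j))).property) :
        M.X (-(-j)) ⟶ (alexanderComplex (alexanderComplex M)).X j) (incl k n)
    exact inferInstanceAs (IsIso ((M.XIsoOfEq (neg_neg j)).inv ≫ _))
  exact HomologicalComplex.Hom.isIso_of_components _

end AlexanderComplex

/-! ### Alexander duality exchanges the two notions of minimality -/

section Minimality

/-- The Alexander dual of a map that vanishes on socles has image in the product with the maximal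
ideal. -/
lemma range_alexanderMap_le {X Y : GrMod k n} (f : X ⟶ Y) (hf : KillsSocle f) (a : Deg n) :
    LinearMap.range (ev (alexanderMap f) a) ≤
      ⨆ j : Fin n, LinearMap.range (mulMap (alexanderObj X) (sub_unitDeg_le a j)) := by
  classical
  rintro _ ⟨φ, rfl⟩
  by_cases ha : 0 ≤ a
  -- As `f` kills socles, the functional `φ ∘ f` vanishes on the common kernel of the `x_j` with `j
  -- ∈ supp₊ a`, so it is a sum of functionals each factoring through one `x_j`.
  · obtain ⟨χ, hχ⟩ := exists_dual_sum_eq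
      (fun j : {j // j ∈ posSupp a} => mulMap X (le_add_unitDeg (ind (posSupp a)ᶜ) j.1))
      (ev (alexanderMap f) a φ).1 fun y hy => by
        rw [ev_alexanderMap, hf _ y fun j hj => ?_, map_zero]
        exact hy ⟨j, by rwa [Finset.mem_compl, not_not] at hj⟩
    have ha' : ∀ j : {j // j ∈ posSupp a}, 0 ≤ a - unitDeg j.1 := fun j i => by
      have h1 : (0 : ℤ) < a j.1 := mem_posSupp.1 j.2
      have h2 : (0 : ℤ) ≤ a i := ha i
      change (0 : ℤ) ≤ (a i : ℤ) - (unitDeg j.1 i : ℤ)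
      rw [unitDeg_apply]
      split_ifs with hij
      · rw [hij]
        lia
      · lia
    -- The support of `a - e_j` still contains `j` when `a_j ≥ 2`; the multiplication precomposed
    -- with `χ j` covers that case and `a_j = 1` alike.
    let φj (j : {j // j ∈ posSupp a}) : (alexanderObj X).obj (a - unitDeg j.1) :=
      alexanderMk (ha' j) ((χ j).comp (mulMap X ind_posSupp_compl_le))
    have hsum : ev (alexanderMap f) a φ =
        ∑ j : {j // j ∈ posSupp a}, mulMap (alexanderObj X) (sub_unitDeg_le a j.1) (φj j) := by
      refine alexander_ext fun y => ?_
      rw [alexander_sum_apply, hχ]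
      exact Finset.sum_congr rfl fun j _ => congrArg (χ j) (mulMap_mulMap X
        (compl_posSupp_le (sub_unitDeg_le a j.1)) ind_posSupp_compl_le y).symm
    rw [hsum]
    exact Submodule.sum_mem _ fun j _ => Submodule.mem_iSup_of_mem j.1
      (LinearMap.mem_range_self (mulMap (alexanderObj X) (sub_unitDeg_le a j.1)) (φj j))
  · rw [alexander_eq_zero ha φ, map_zero]
    exact Submodule.zero_mem _

/-- The Alexander dual of a map with image in the product with the maximal ideal vanishes on
socles. -/
lemma killsSocle_alexanderMap {X Y : GrMod k n} (hY : IsSquarefree Y) (f : X ⟶ Y)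
    (hf : ∀ a, LinearMap.range (ev f a) ≤
      ⨆ j : Fin n, LinearMap.range (mulMap Y (sub_unitDeg_le a j))) :
    KillsSocle (alexanderMap f) := by
  intro F φ hφ
  refine alexander_ext fun x => ?_
  have key : (⨆ j : Fin n, LinearMap.range (mulMap Y (sub_unitDeg_le (ind (posSupp (ind F))ᶜ) j))) ≤
      LinearMap.ker φ.1 := by
    refine iSup_le fun j => ?_
    rintro _ ⟨y, rfl⟩
    rw [LinearMap.mem_ker]
    by_cases hj : j ∈ F
    -- For `j ∈ F` the degree `Fᶜ - e_j` has a negative coordinate.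
    · have : y = 0 := hY.eq_zero_of_not_nonneg (fun h => by
        have h1 : (0 : ℤ) ≤ (ind (posSupp (ind F))ᶜ j : ℤ) - (unitDeg j j : ℤ) := h j
        rw [posSupp_ind, ind_apply, unitDeg_apply, if_pos rfl,
          if_neg (fun h => (Finset.mem_compl.1 h) hj)] at h1
        lia) y
      rw [this, map_zero, map_zero]
    -- For `j ∉ F`, subtracting `e_j` from `Fᶜ` gives the complement of `F ∪ {j}`, and `φ` vanishes
    -- on `x_j`-multiples from there because `x_j φ = 0`.
    · have hle : ind (posSupp (ind F))ᶜ - unitDeg j ≤ ind (posSupp (ind F + unitDeg j))ᶜ := by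
        rw [posSupp_add_unitDeg (ind_nonneg F), posSupp_ind]
        intro i
        change (ind Fᶜ i : ℤ) - (unitDeg j i : ℤ) ≤ (ind (insert j F)ᶜ i : ℤ)
        simp only [ind_apply, unitDeg_apply, Finset.mem_compl, Finset.mem_insert]
        by_cases hij : i = j <;> by_cases hi : i ∈ F <;> simp [hij, hi, hj]
      have h1 := LinearMap.congr_fun (congrArg Subtype.val (hφ j hj)) (mulMap Y hle y)
      have h2 : φ.1 (mulMap Y (compl_posSupp_le (le_add_unitDeg (ind F) j)) (mulMap Y hle y)) = 0 :=
        h1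
      rwa [mulMap_mulMap] at h2
  exact key (hf _ ⟨x, rfl⟩)

end Minimality

/-! ### Injectivity and projectivity of the standard modules -/

section SumsInjective

/-- A map to `S/P_F` amounts to a functional on the component of degree `F`, and functionals extend
along injections. -/
lemma sqInjective_quotPrime (F : Finset (Fin n)) : SqInjective (quotPrime k F) := by
  intro X Y hX hY f hf g
  have hF := ind_mem_faceSet_self F
  let ℓ : X.obj (ind F) →ₗ[k] k := (monomialCoeff k _ (ind F)).comp (ev g (ind F))
  obtain ⟨q, hq⟩ := LinearMap.exists_leftInverse_of_injective _ (LinearMap.ker_eq_bot.2 (hf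
      (ind F)))
  refine ⟨toQuotPrime hY (ℓ.comp q), hom_ext_ev fun a x => ?_⟩
  by_cases ha : a ∈ faceSet F
  · refine mulMap_quotPrime_injective (k := k) (G := F) (le_add_ind a F) (fun i hi => ?_) ?_
    · rw [deg_add_apply, ind_apply, if_neg hi, add_zero]
    · rw [← ev_mulMap, ← ev_mulMap, ← mulMap_toTop hX ha, ev_mulMap, ev_mulMap]
      refine congrArg (mulMap (quotPrime k F) _) (Subtype.ext ?_)
      rw [ev_comp, coe_ev_toQuotPrime_self]
      exact congrArg ℓ (LinearMap.congr_fun hq (toTop hX ha x))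
  · rw [quotPrime_eq_zero (ev (f ≫ _) a x) ha, quotPrime_eq_zero (ev g a x) ha]

lemma sqInjective_biproduct {J : Type} [Fintype J] (A : J → GrMod k n)
    (hA : ∀ j, SqInjective (A j)) : SqInjective (⨁ A) := by
  intro X Y hX hY f hf g
  choose h hh using fun j => hA j hX hY f hf (g ≫ biproduct.π A j)
  refine ⟨biproduct.lift h, biproduct.hom_ext _ _ fun j => ?_⟩
  rw [Category.assoc, biproduct.lift_π, hh]

lemma SqInjective.of_iso {A B : GrMod k n} (hA : SqInjective A) (e : A ≅ B) : SqInjective B :=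
  hA.of_retract e.inv e.hom e.inv_hom_id

instance (F : Finset (Fin n)) : Projective (freeModule k F) :=
  Projective.of_iso (nonempty_freeModule_iso F).some.symm inferInstance

lemma projective_biproduct {J : Type} [Fintype J] (A : J → GrMod k n) [∀ j, Projective (A j)] :
    Projective (⨁ A) where
  factors f e _ := ⟨biproduct.desc fun j => Projective.factorThru (biproduct.ι A j ≫ f) e,
    biproduct.hom_ext' _ _ fun j => by
      rw [biproduct.ι_desc_assoc, Projective.factorThru_comp]⟩

end SumsInjective

/-! ### Projective resolutions by duality -/

section Betti

/-- Direct sums over subsets, reindexed by complements. -/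
def complSigmaEquiv (β : Finset (Fin n) → ℕ) :
    ((F : Finset (Fin n)) × Fin (β Fᶜ)) ≃ ((F : Finset (Fin n)) × Fin (β F)) :=
  Equiv.sigmaCongrLeft (β := fun F => Fin (β F)) (Function.Involutive.toPerm compl compl_involutive)

lemma complSigmaEquiv_fst (β : Finset (Fin n) → ℕ) (p : (F : Finset (Fin n)) × Fin (β Fᶜ)) :
    (complSigmaEquiv β p).1 = p.1ᶜ := rfl

lemma nonempty_alexander_sum_freeModule_iso (β : Finset (Fin n) → ℕ) :
    Nonempty (alexanderObj (⨁ fun p : (F : Finset (Fin n)) × Fin (β F) => freeModule k p.1) ≅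
      ⨁ fun p : (F : Finset (Fin n)) × Fin (β Fᶜ) => quotPrime k p.1) := by
  obtain ⟨e⟩ := nonempty_alexander_biproduct_iso
    fun p : (F : Finset (Fin n)) × Fin (β F) => freeModule k p.1
  have e' : ∀ F G : Finset (Fin n), F = Gᶜ → Nonempty (alexanderObj (freeModule k F) ≅
      quotPrime k G) := by
    rintro F G h
    obtain rfl : Fᶜ = G := by rw [h, compl_compl]
    exact nonempty_alexander_freeModule_iso F
  exact ⟨e ≪≫ (biproduct.whiskerEquiv (complSigmaEquiv β) fun p =>
    (e' _ _ (complSigmaEquiv_fst β p)).some).symm⟩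

lemma nonempty_alexander_sum_quotPrime_iso (β : Finset (Fin n) → ℕ) :
    Nonempty (alexanderObj (⨁ fun p : (F : Finset (Fin n)) × Fin (β F) => quotPrime k p.1) ≅
      ⨁ fun p : (F : Finset (Fin n)) × Fin (β Fᶜ) => freeModule k p.1) := by
  obtain ⟨e⟩ := nonempty_alexander_biproduct_iso
    fun p : (F : Finset (Fin n)) × Fin (β F) => quotPrime k p.1
  have e' : ∀ F G : Finset (Fin n), F = Gᶜ → Nonempty (alexanderObj (quotPrime k F) ≅
      freeModule k G) := by
    rintro F G h
    obtain rfl : Fᶜ = G := by rw [h, compl_compl]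
    exact nonempty_alexander_quotPrime_iso F
  exact ⟨e ≪≫ (biproduct.whiskerEquiv (complSigmaEquiv β) fun p =>
    (e' _ _ (complSigmaEquiv_fst β p)).some).symm⟩
/-- The dual of a minimal projective resolution is a minimal injective resolution. -/
lemma IsSquarefreeBettiNumbers.isSquarefreeBassNumbers {M : CochainComplex (Sq k n) ℤ}
    {β : ℤ → Finset (Fin n) → ℕ} (hβ : IsSquarefreeBettiNumbers M β) :
    IsSquarefreeBassNumbers (alexanderComplex M) fun i F => β i Fᶜ := by
  obtain ⟨P, f, hf, hP⟩ := hβ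
  have hiso : ∀ i, Nonempty (((alexanderComplex P).X i).obj ≅
      ⨁ fun p : (F : Finset (Fin n)) × Fin (β i Fᶜ) => quotPrime k p.1) := fun i => by
    obtain ⟨e₁⟩ := hP i
    exact ⟨(alexanderIso e₁).symm ≪≫ (nonempty_alexander_sum_freeModule_iso (β i)).some⟩
  refine ⟨alexanderComplex P, alexanderComplexMap f, ⟨hf.bounded.alexanderComplex, fun i => ?_,
    quasiIso_alexanderComplexMap f hf.quasiIso, fun i L hL => ?_⟩, hiso⟩
  · obtain ⟨e⟩ := hiso i
    have h1 := sqInjective_biproduct (fun p : (F : Finset (Fin n)) × Fin (β i Fᶜ) =>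
      quotPrime k p.1) fun p => sqInjective_quotPrime p.1
    exact SqInjective.injective (X := (alexanderComplex P).X i) (h1.of_iso e.symm)
  · refine essential_of_killsSocle ((alexanderComplex P).X i).property ?_ L hL
    refine killsSocle_alexanderMap (P.X (-i)).property (P.d (-(i + 1)) (-i)).hom fun a => ?_
    -- The indices `-(i + 1)` and `-i - 1` are equal but not definitionally, so the index is made a
    -- variable.
    have h1 : ∀ l, l = -i - 1 → LinearMap.range (ev (P.d l (-i)).hom a) ≤
        ⨆ j : Fin n, LinearMap.range (mulMap (P.X (-i)).obj (sub_unitDeg_le a j)) := by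
      rintro l rfl
      exact hf.minimal (-i) a
    exact h1 _ (by lia)

/-- Minimal projective resolutions exist, and their terms are direct sums of modules `S(-F)`. -/
theorem exists_isSquarefreeBettiNumbers (M : CochainComplex (Sq k n) ℤ) (hM : IsBounded M) :
    ∃ β : ℤ → Finset (Fin n) → ℕ, IsSquarefreeBettiNumbers M β := by
  obtain ⟨μ, I, f, hf, hI⟩ := exists_isSquarefreeBassNumbers _ hM.alexanderComplex
  -- The term of the dual complex in degree `-i` is the dual of `I^(-(-i))`; keeping the double
  -- negation avoids transporting along `-(-i) = i`.
  let β (i : ℤ) (F : Finset (Fin n)) : ℕ := μ (-(-i)) Fᶜ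
  have hiso : ∀ i, Nonempty (((alexanderComplex I).X (-i)).obj ≅
      ⨁ fun p : (F : Finset (Fin n)) × Fin (β i F) => freeModule k p.1) := fun i => by
    obtain ⟨e₁⟩ := hI (-(-i))
    exact ⟨(alexanderIso e₁).symm ≪≫ (nonempty_alexander_sum_quotPrime_iso (μ (-(-i)))).some⟩
  refine ⟨β, alexanderComplex I, alexanderComplexMap f ≫ inv (bidualityComplex M),
    ⟨hf.bounded.alexanderComplex, fun i => ?_, ?_, fun i a => ?_⟩, hiso⟩
  · obtain ⟨j, rfl⟩ : ∃ j, -j = i := ⟨-i, neg_neg i⟩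
    have : Projective ((alexanderComplex I).X (-j)).obj :=
      Projective.of_iso (hiso j).some.symm (projective_biproduct _)
    exact projective_of_projective_obj
  · have := quasiIso_alexanderComplexMap f hf.quasiIso
    rw [Functor.map_comp]
    infer_instance
  · have h1 : ∀ l, l = -i + 1 → KillsSocle (I.d (-i) l).hom := by
      rintro l rfl
      exact killsSocle_of_essential (I.X (-i + 1)).property _ (hf.essential (-i))
    exact range_alexanderMap_le _ (h1 (-(i - 1)) (by lia)) a

end Betti

end SqfreeMod

end

/-! ### Assembly of the proposition -/

theorem proposition3p5 {k : Type u} [Field k] {n : ℕ}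
    (M : CochainComplex (SqfreeMod.Sq k n) ℤ) (hM : SqfreeMod.IsBounded M) :
    (∃ μ : ℤ → Finset (Fin n) → ℕ, SqfreeMod.IsSquarefreeBassNumbers M μ) ∧
    (∀ μ : ℤ → Finset (Fin n) → ℕ, SqfreeMod.IsSquarefreeBassNumbers M μ →
      ∀ (i : ℤ) (F : Finset (Fin n)),
        (μ i F : Cardinal.{u + 1}) =
          SqfreeMod.bassNumber (SqfreeMod.primeIdeal k F) (SqfreeMod.straightComplex M) i ∧
        (μ i F : Cardinal.{u + 1}) =
          Module.rank k (SqfreeMod.gradedExt M (SqfreeMod.omega k n)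
            ((n : ℤ) - (F.card : ℤ) - i) (SqfreeMod.ind F))) ∧
    (∃ β : ℤ → Finset (Fin n) → ℕ, SqfreeMod.IsSquarefreeBettiNumbers M β) ∧
    (∀ β : ℤ → Finset (Fin n) → ℕ, SqfreeMod.IsSquarefreeBettiNumbers M β →
      ∀ (i : ℤ) (F : Finset (Fin n)),
        (β i F : Cardinal.{u + 1}) =
          Module.rank k (SqfreeMod.gradedExt (SqfreeMod.alexanderComplex M) (SqfreeMod.omega k n)
            ((F.card : ℤ) - i) (SqfreeMod.ind Fᶜ))) := by
  refine ⟨SqfreeMod.exists_isSquarefreeBassNumbers M hM, fun μ hμ i F =>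
    ⟨SqfreeMod.bassNumber_eq hμ i F, SqfreeMod.rank_gradedExt_eq hμ i F⟩,
    SqfreeMod.exists_isSquarefreeBettiNumbers M hM, fun β hβ i F => ?_⟩
  -- The dual of a minimal projective resolution of `M` is a minimal injective resolution of `𝐀(M)`,
  -- so the Ext formula applies to the face `Fᶜ`, with `n - |Fᶜ| = |F|`.
  have h := SqfreeMod.rank_gradedExt_eq hβ.isSquarefreeBassNumbers i Fᶜ
  have hF : (n : ℤ) - ((Fᶜ).card : ℤ) - i = (F.card : ℤ) - i := by
    have := Finset.card_add_card_compl F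
    rw [Fintype.card_fin] at this
    lia
  rw [hF] at h
  refine Eq.trans ?_ h
  rw [compl_compl]
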